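/- Let $d\ge 1$, let $X=\{x_1,\dots,x_n\}\subset\mathbb{R}^d$ be a data set (repetitions allowed) and let $C=\{c^1,\dots,c^k\}\subset\mathbb{R}^d$ be a set of $k\ge 1$ distinct reference centers. Put $\mathrm{cost}_{\ell_1}(X,C)=\sum_{x\in X}\min_{c\in C}\|x-c\|_1$. A threshold tree $T$ is a binary tree each of whose internal nodes carries a coordinate $i$ and a threshold $\theta$ and sends the points with $x_i\le\theta$ to its left child and those with $x_i>\theta$ to its right child; if $P_1,\dots,P_m$ are the clusters into which the leaves of $T$ partition $X$, then $\mathrm{cost}_{\ell_1}(X,T)=\sum_{j}\min_{y\in\mathbb{R}^d}\sum_{x\in P_j}\|x-y\|_1$. A cut is a pair $\omega=(i,\theta)\in\Omega=\{1,\dots,d\}\times\mathbb{R}$, and $\mu$ is the sum over the $d$ coordinates of Lebesgue measure on the thresholds. Let $S_{ij}\subset\Omega$ be the set of the cuts that separate $c^i$ and $c^j$. Algorithm 1 starts with the tree $T_0$ that consists of a root. While some leaf of $T_t$ contains two distinct centers, let $E_t$ be the set of all pairs $(i,j)$ such that $c^i$ and $c^j$ lie in the same leaf of $T_t$, let $D_t=\max_{(i,j)\in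 E_t}\|c^i-c^j\|_1$, and let $$A_t=\bigcup_{(i,j)\in E_t}S_{ij},\qquad B_t=\bigcup_{(i,j)\in E_t:\ \mu(S_{ij})\le D_t/k^3}S_{ij},\qquad R_t=A_t\setminus B_t .$$ Pick $\omega_t$ uniformly at random from $R_t$ (that is, conditionally on the earlier cuts, with distribution $\mu$ restricted to $R_t$ and normalized), and split with $\omega_t$ every leaf of $T_t$ both of whose parts contain a center; this gives $T_{t+1}$. The output $T$ is the tree at which the loop stops. **Theorem.** There is an absolute constant $K>0$ such that for all $d,X,C$ as above the following holds. 1. Almost surely, Algorithm 1 stops after at most $k-1$ iterations, and its output $T$ has exactly $k$ leaves, each of which contains exactly one center. Moreover $$\mathbb{E}[\mathrm{cost}_{\ell_1}(X,T)]\le K\,\log k\,\log\log k\cdot\mathrm{cost}_{\ell_1}(X,C)\qquad\text{if } k\ge 3,$$ and $\mathbb{E}[\mathrm{cost}_{\ell_1}(X,T)]\le K\cdot\mathrm{cost}_{\ell_1}(X,C)$ if $k\le 2$. 2. Algorithm 1 runs in polynomial time. There are a single real RAM program (unit-cost assignments, comparisons and random draws from the uniform distribution on $[0,1]$; addition and subtraction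 of natural numbers; addition, subtraction and multiplication of real numbers; indirect addressing) and a polynomial $p$, both independent of $d,n,k,X,C$, such that on input $(X,C)$ the program always halts after at most $p(d+k)$ steps with a threshold tree in its memory, and this tree is almost surely the output of Algorithm 1 with suitable random cuts $\omega_0,\omega_1,\dots$ distributed as above, computed from the program's random numbers. In particular its expected cost satisfies the bound in part 1. -/

import Mathlib

open MeasureTheory ProbabilityTheory

noncomputable section

namespace ExplainableClustering

/-! ### Clustering costs in `ℓ₁` -/

/-- The `ℓ₁` distance on `ℝ^d`. -/
def l1Dist {d : ℕ} (x y : Fin d → ℝ) : ℝ := ∑ i, |x i - y i|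

/-- `cost(X, C) = ∑ₓ min_{c ∈ C} ‖x - c‖₁` for the data points `X 0, …, X (n-1)` and the centers
`c 0, …, c (k-1)`. -/
def centerCost {n d k : ℕ} (X : Fin n → Fin d → ℝ) (c : Fin k → Fin d → ℝ) : ℝ :=
  ∑ a, ⨅ j, l1Dist (X a) (c j)

/-- Threshold trees: the node `node i θ l r` sends a point `x` to `l` if `x i ≤ θ`, and to `r` if
`x i > θ`. -/
inductive ThresholdTree (d : ℕ) : Type
  | leaf : ThresholdTree d
  | node (i : Fin d) (θ : ℝ) (l r : ThresholdTree d) : ThresholdTree d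

namespace ThresholdTree

/-- The leaves of a tree, named by their paths from the root (`false` = left, `true` = right). -/
def leaves {d : ℕ} : ThresholdTree d → Finset (List Bool)
  | leaf => {[]}
  | node _ _ l r => l.leaves.image (List.cons false) ∪ r.leaves.image (List.cons true)

open Classical in
/-- The leaf to which the point `x` is assigned. -/
def route {d : ℕ} : ThresholdTree d → (Fin d → ℝ) → List Bool
  | leaf, _ => []
  | node i θ l r, x => if x i ≤ θ then false :: l.route x else true :: r.route x

/-- `cost(X, T)`: the sum over the leaves of the cost of the cluster of that leaf, with an
`ℓ₁`-median of the cluster as its center. -/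
def cost {n d : ℕ} (T : ThresholdTree d) (X : Fin n → Fin d → ℝ) : ℝ :=
  ∑ v ∈ T.leaves, ⨅ y : Fin d → ℝ, ∑ a with T.route (X a) = v, l1Dist (X a) y

end ThresholdTree

/-! ### The random-cut algorithm -/

/-- A coordinate cut `(i, θ)`. -/
abbrev Cut (d : ℕ) : Type := Fin d × ℝ

/-- The measure `μ(S) = ∑ᵢ Leb {θ | (i, θ) ∈ S}` on cuts. -/
def cutMeasure (d : ℕ) : Measure (Cut d) :=
  ∑ i : Fin d, (volume : Measure ℝ).map (Prod.mk i)

/-- The set of the cuts `(i, θ)` that separate `x` and `y`, that is, for which exactly one of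
`x i > θ` and `y i > θ` holds. -/
def sepCuts {d : ℕ} (x y : Fin d → ℝ) : Set (Cut d) :=
  {w | ¬ (w.2 < x w.1 ↔ w.2 < y w.1)}

/-- `E_t`: the pairs of centers that lie in the same leaf. -/
def unsepPairs {d k : ℕ} (c : Fin k → Fin d → ℝ) (T : ThresholdTree d) : Set (Fin k × Fin k) :=
  {q | T.route (c q.1) = T.route (c q.2)}

/-- The loop stops when no leaf contains two distinct centers. -/
def Separated {d k : ℕ} (c : Fin k → Fin d → ℝ) (T : ThresholdTree d) : Prop :=
  ∀ i j, T.route (c i) = T.route (c j) → c i = c j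

/-- `D_t`: the largest distance between two centers in the same leaf. -/
def maxDist {d k : ℕ} (c : Fin k → Fin d → ℝ) (T : ThresholdTree d) : ℝ :=
  sSup ((fun q : Fin k × Fin k => l1Dist (c q.1) (c q.2)) '' unsepPairs c T)

/-- `A_t`: the cuts that separate some not yet separated pair of centers. -/
def setA {d k : ℕ} (c : Fin k → Fin d → ℝ) (T : ThresholdTree d) : Set (Cut d) :=
  ⋃ q ∈ unsepPairs c T, sepCuts (c q.1) (c q.2)

/-- `B_t`: the cuts that separate some not yet separated pair `(i, j)` of centers with
`μ(S_{ij}) ≤ D_t / k³`. -/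
def setB {d k : ℕ} (c : Fin k → Fin d → ℝ) (T : ThresholdTree d) : Set (Cut d) :=
  ⋃ q ∈ {q ∈ unsepPairs c T |
      cutMeasure d (sepCuts (c q.1) (c q.2)) ≤ ENNReal.ofReal (maxDist c T / (k : ℝ) ^ 3)},
    sepCuts (c q.1) (c q.2)

/-- `R_t = A_t \ B_t`: the cuts among which the next one is picked. -/
def setR {d k : ℕ} (c : Fin k → Fin d → ℝ) (T : ThresholdTree d) : Set (Cut d) :=
  setA c T \ setB c T

open Classical in
/-- Split every leaf of the tree by the cut `w`, provided that both parts contain a center. Here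
`S` is the set of the centers that reach the root of the tree. -/
def grow {d : ℕ} (w : Cut d) : Set (Fin d → ℝ) → ThresholdTree d → ThresholdTree d
  | S, .leaf =>
      if (∃ x ∈ S, x w.1 ≤ w.2) ∧ (∃ x ∈ S, w.2 < x w.1) then .node w.1 w.2 .leaf .leaf else .leaf
  | S, .node i θ l r =>
      .node i θ (grow w {x ∈ S | x i ≤ θ} l) (grow w {x ∈ S | θ < x i} r)

/-- The tree `T_t` that is built with the cuts `w 0, …, w (t-1)`. -/
def treeAt {d k : ℕ} (c : Fin k → Fin d → ℝ) (w : ℕ → Cut d) : ℕ → ThresholdTree d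
  | 0 => .leaf
  | t + 1 => grow (w t) (Set.range c) (treeAt c w t)

/-- The output of the algorithm with the cuts `w 0, w 1, …`: the tree `T_t` for the first `t` at
which all centers are separated. -/
def output {d k : ℕ} (c : Fin k → Fin d → ℝ) (w : ℕ → Cut d) : ThresholdTree d :=
  treeAt c w (sInf {t | Separated c (treeAt c w t)})

/-- The random cuts `ω 0, ω 1, …` are those of the algorithm: as long as the loop has not stopped
before step `t`, the conditional distribution of the cut `ω t` given the earlier cuts is the
uniform distribution on `R_t`. (Cuts after the end of the loop are not used, and are free.) -/
structure IsRun {d k : ℕ} (c : Fin k → Fin d → ℝ) {Ω : Type*} [MeasurableSpace Ω] (P : Measure Ω)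
    (ω : ℕ → Ω → Cut d) : Prop where
  measurable : ∀ t, Measurable (ω t)
  uniform : ∀ (t : ℕ) (H : Set (Fin t → Cut d)) (S : Set (Cut d)),
    MeasurableSet H → MeasurableSet S →
      P {a | (¬ Separated c (treeAt c (fun s => ω s a) t) ∧ (fun s : Fin t => ω s a) ∈ H) ∧
          ω t a ∈ S} =
        ∫⁻ a in {a | ¬ Separated c (treeAt c (fun s => ω s a) t) ∧
            (fun s : Fin t => ω s a) ∈ H},
          (cutMeasure d)[|setR c (treeAt c (fun s => ω s a) t)] S ∂P

/-- The approximation factor `log k · log log k`, which is positive from `k = 3` on; it is replaced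
by `1` for `k ≤ 2`. -/
def approxFactor (k : ℕ) : ℝ :=
  if k ≤ 2 then 1 else Real.log k * Real.log (Real.log k)

/-! ### Randomized real RAM programs

The memory consists of two-dimensional arrays of natural numbers and of real numbers, `a[i][j]`,
where the name `a` of the array is a numeral in the program and the indices are computed. A step is
one assignment (of an expression, which has a constant size in a fixed program), one random number
or one evaluation of a test. There is no multiplication of natural numbers, no division and no
rounding of real numbers. -/

/-- A memory state, with the number of the random numbers consumed so far. -/
structure State : Type where
  int : ℕ → ℕ → ℕ → ℕ
  real : ℕ → ℕ → ℕ → ℝ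
  used : ℕ

namespace State

/-- The assignment `a[i][j] := v` in the memory for natural numbers. -/
def setInt (s : State) (a i j v : ℕ) : State :=
  { s with int := fun a' i' j' => if a' = a ∧ i' = i ∧ j' = j then v else s.int a' i' j' }

/-- The assignment `a[i][j] := v` in the memory for real numbers. -/
def setReal (s : State) (a i j : ℕ) (v : ℝ) : State :=
  { s with real := fun a' i' j' => if a' = a ∧ i' = i ∧ j' = j then v else s.real a' i' j' }

end State

/-- Expressions for natural numbers (with truncated subtraction). -/
inductive IExp : Type
  | const (v : ℕ) : IExp
  | get (a : ℕ) (i j : IExp) : IExp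
  | add (e f : IExp) : IExp
  | sub (e f : IExp) : IExp

/-- The value of an expression for natural numbers. -/
def IExp.eval (s : State) : IExp → ℕ
  | const v => v
  | get a i j => s.int a (i.eval s) (j.eval s)
  | add e f => e.eval s + f.eval s
  | sub e f => e.eval s - f.eval s

/-- Expressions for real numbers. -/
inductive RExp : Type
  | ofInt (e : IExp) : RExp
  | get (a : ℕ) (i j : IExp) : RExp
  | add (e f : RExp) : RExp
  | sub (e f : RExp) : RExp
  | mul (e f : RExp) : RExp

/-- The value of an expression for real numbers. -/
def RExp.eval (s : State) : RExp → ℝ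
  | ofInt e => (e.eval s : ℝ)
  | get a i j => s.real a (i.eval s) (j.eval s)
  | add e f => e.eval s + f.eval s
  | sub e f => e.eval s - f.eval s
  | mul e f => e.eval s * f.eval s

/-- Tests. -/
inductive Test : Type
  | intLt (e f : IExp) : Test
  | realLt (e f : RExp) : Test
  | not (b : Test) : Test
  | and (b b' : Test) : Test

/-- The truth of a test. -/
def Test.Holds (s : State) : Test → Prop
  | intLt e f => e.eval s < f.eval s
  | realLt e f => e.eval s < f.eval s
  | not b => ¬ b.Holds s
  | and b b' => b.Holds s ∧ b'.Holds s

/-- Programs. -/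
inductive Program : Type
  | skip : Program
  | setInt (a : ℕ) (i j e : IExp) : Program
  | setReal (a : ℕ) (i j : IExp) (e : RExp) : Program
  | random (a : ℕ) (i j : IExp) : Program
  | seq (p q : Program) : Program
  | ite (b : Test) (p q : Program) : Program
  | loop (b : Test) (p : Program) : Program

/-- `Exec u p s m s'`: started in the state `s`, with the numbers `u 0, u 1, …` as its source of
randomness, the program `p` halts after exactly `m` steps in the state `s'`. -/
inductive Exec (u : ℕ → unitInterval) : Program → State → ℕ → State → Prop
  | skip (s : State) : Exec u .skip s 1 s
  | setInt (s : State) (a : ℕ) (i j e : IExp) :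
      Exec u (.setInt a i j e) s 1 (s.setInt a (i.eval s) (j.eval s) (e.eval s))
  | setReal (s : State) (a : ℕ) (i j : IExp) (e : RExp) :
      Exec u (.setReal a i j e) s 1 (s.setReal a (i.eval s) (j.eval s) (e.eval s))
  | random (s : State) (a : ℕ) (i j : IExp) :
      Exec u (.random a i j) s 1
        { s.setReal a (i.eval s) (j.eval s) (u s.used : ℝ) with used := s.used + 1 }
  | seq {p q : Program} {s s' s'' : State} {m m' : ℕ} :
      Exec u p s m s' → Exec u q s' m' s'' → Exec u (.seq p q) s (m + m') s''
  | iteTrue {b : Test} {p q : Program} {s s' : State} {m : ℕ} :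
      b.Holds s → Exec u p s m s' → Exec u (.ite b p q) s (m + 1) s'
  | iteFalse {b : Test} {p q : Program} {s s' : State} {m : ℕ} :
      ¬ b.Holds s → Exec u q s m s' → Exec u (.ite b p q) s (m + 1) s'
  | loopStop {b : Test} {p : Program} {s : State} :
      ¬ b.Holds s → Exec u (.loop b p) s 1 s
  | loopStep {b : Test} {p : Program} {s s' s'' : State} {m m' : ℕ} :
      b.Holds s → Exec u p s m s' → Exec u (.loop b p) s' m' s'' →
        Exec u (.loop b p) s (m + m' + 1) s''

/-- The initial state: `n`, `d`, `k` in the cells `[0][0]` of the arrays `0`, `1`, `2` for natural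
numbers, the data points in the rows of the array `0` for real numbers and the centers in the rows
of the array `1`; all other cells contain `0`. -/
def State.init {n d k : ℕ} (X : Fin n → Fin d → ℝ) (c : Fin k → Fin d → ℝ) : State where
  int a i j :=
    if i = 0 ∧ j = 0 then
      if a = 0 then n else if a = 1 then d else if a = 2 then k else 0
    else 0
  real a i j :=
    if hj : j < d then
      if a = 0 then (if hi : i < n then X ⟨i, hi⟩ ⟨j, hj⟩ else 0)
      else if a = 1 then (if hi : i < k then c ⟨i, hi⟩ ⟨j, hj⟩ else 0)
      else 0
    else 0
  used := 0

/-- The tree rooted at the node number `v` in the memory. Row `v` of the array `3` for natural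
numbers holds `0` for a leaf, and `1`, the feature, and the numbers of the left and of the right
child for an internal node, whose threshold is in the cell `[v][0]` of the array `2` for real
numbers. -/
inductive State.Stores (s : State) {d : ℕ} : ℕ → ThresholdTree d → Prop
  | leaf {v : ℕ} : s.int 3 v 0 = 0 → State.Stores s v .leaf
  | node {v : ℕ} {i : Fin d} {θ : ℝ} {l r : ThresholdTree d} :
      s.int 3 v 0 = 1 → s.int 3 v 1 = (i : ℕ) → s.real 2 v 0 = θ →
        State.Stores s (s.int 3 v 2) l → State.Stores s (s.int 3 v 3) r →
          State.Stores s v (.node i θ l r)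

/-- The source of randomness: independent uniformly distributed numbers in `[0, 1]`. -/
def uniformSource : Measure (ℕ → unitInterval) :=
  Measure.infinitePi fun _ => (volume : Measure unitInterval)

end ExplainableClustering

end

open ExplainableClustering

/-! The cost of the output is at most the sum over the data points `x` of the distance from `x` to
the center in its leaf, so by linearity it suffices to bound, for one data point, the expectation
of that distance by `O(log k log log k)` times the distance `δ` from `x` to its closest center `j`.

*The chain.* From the point of view of `x`, only the set of the unseparated pairs and the set of
the centers in the leaf of `x` matter, and only finitely many classes of cuts can be told apart.
This gives the finite Markov chain `CutSystem`, in which distances are masses of sets of cuts.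
Write `D` for the diameter and `ρ` for the mass of the set `R` from which the cut is picked. By a
union bound, the forbidden cuts have mass at most `D / 4` (`CutSystem.mass_bad_le`). Hence, if `D /
2 ≤ r < D`, then each unseparated pair at a distance more than `r` is separated with probability at
least `r / (2 ρ)`, and the potential `1 + log N`, where `N` is the number of these pairs, shows
that the sum of `D / ρ` over the steps with a diameter in a range of `M` binary scales is expected
to be `O(M log k)` (`CutSystem.acc_scale_le`, `CutSystem.acc_window_le`).

*The charging argument.* The center `j` leaves the leaf of `x` only by a cut that separates the
two. These cuts have mass `δ`, and the loss at such a cut is at most `D`. A cut is in `R` only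
while the diameter drops by a factor `k³`, which is a range of `O(log k)` scales, and this gives a
factor `1 + L = O(log² k)` (`CutSystem.value_le_crude`). Now this bound is applied to what happens
after the cut: if a center at distance at most `D / (1 + L)²` from `x` remains, then the loss is at
most `D / (1 + L)`, and these losses add up to `O(δ)`. In the remaining case all centers that stay
are far from `x`, and a fixed cut can have this property only while the diameter drops by a factor
`2 (1 + L)²`, which is a range of only `O(log log k)` scales. So these losses add up to `O(δ log k
log log k)` (`CutSystem.value_le_main`).

*The algorithm as a chain.* The partition of the data points and the centers into the leaves is a
function of the previous partition and of the class of the cut (`leafRel_grow`), and this transfers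
the bound to every run of the algorithm (`IsRun.cost_bound`). Almost surely, each cut lies in `R`,
so it separates a pair of centers and increases the number of the leaves that contain centers; thus
the loop ends after at most `k - 1` steps (`IsRun.ae_separated`).

*The program.* The coordinates of the centers divide each axis into at most `k` intervals on which
membership in `R` is constant. Placed one after the other, the intervals that belong to `R` form a
segment of length `μ(R)`; a uniform point of this segment is a uniform cut from `R`, and it can be
found by additions and comparisons alone (`sample`, `isRun_runCut`). The comparison with `D / k³`
is made as `D < k³ * dist`, without a division. The program is written with bounded loops, so its
running time is a polynomial that can be read off from its text (`BoundedProgram.exec_compile`),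
and its memory follows the trees `runTree` (`BoundedProgram.Invariant.run_stepProg`). New leaves of
the tree are numbered by representatives of their sets of centers, with fresh numbers in each step.
The program makes `k` steps in any case, since further cuts do not change a tree that separates all
centers. -/

noncomputable section

namespace ExplainableClustering

/-! ### The finite cut chain -/

/-- A finite model of the random cuts seen from one data point. Cuts that put the same centers and
the data point on the same sides are identified; `α` is the type of the resulting classes,
`weight π` is the measure of the class `π`, `side π` tells on which side each center is, and
`ptSide π` on which side the data point is. -/
structure CutSystem (k : ℕ) (α : Type*) where
  weight : α → ℝ
  weight_nonneg : ∀ π, 0 ≤ weight π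
  side : α → Fin k → Prop
  ptSide : α → Prop

/-- The part of the state of the algorithm that matters for one data point: the pairs of centers
that are not yet separated, and the centers in the leaf of the data point. -/
abbrev ChainState (k : ℕ) : Type := Set (Fin k × Fin k) × Set (Fin k)

namespace CutSystem

variable {k : ℕ} {α : Type*} (Γ : CutSystem k α)

/-- The cuts that separate the two centers of the pair `q`. -/
def sep (q : Fin k × Fin k) : Set α := {π | ¬ (Γ.side π q.1 ↔ Γ.side π q.2)}

/-- The cuts that separate the data point from the center `j`. -/
def ptSep (j : Fin k) : Set α := {π | ¬ (Γ.ptSide π ↔ Γ.side π j)}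

open Classical in
/-- The state after the cut `π`: the leaf of the data point is split only if a center remains on
its side. -/
def next (s : ChainState k) (π : α) : ChainState k :=
  ({q ∈ s.1 | π ∉ Γ.sep q},
    if ∃ j ∈ s.2, π ∉ Γ.ptSep j then {j ∈ s.2 | π ∉ Γ.ptSep j} else s.2)

lemma next_le (s : ChainState k) (π : α) : Γ.next s π ≤ s := by
  refine ⟨fun q hq => hq.1, ?_⟩
  simp only [next]
  split_ifs
  · exact fun q hq => hq.1
  · exact le_rfl

variable [Fintype α]

/-- The total weight of a set of cuts. -/
def mass (Q : Set α) : ℝ := ∑ π, Q.indicator Γ.weight π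

/-- The distance of two centers, as the weight of the cuts that separate them. -/
def dist (q : Fin k × Fin k) : ℝ := Γ.mass (Γ.sep q)

/-- The distance of the data point from a center. -/
def ptDist (j : Fin k) : ℝ := Γ.mass (Γ.ptSep j)

/-- The largest distance of an unseparated pair. -/
def diam (E : Set (Fin k × Fin k)) : ℝ := sSup (Γ.dist '' E)

/-- The cuts that separate an unseparated pair, but none at distance `≤ diam / k³`. -/
def allowed (E : Set (Fin k × Fin k)) : Set α :=
  {π | (∃ q ∈ E, π ∈ Γ.sep q) ∧ ∀ q ∈ E, π ∈ Γ.sep q → Γ.diam E / (k : ℝ) ^ 3 < Γ.dist q}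

/-- The cuts that separate an unseparated pair at distance `≤ diam / k³`. -/
def bad (E : Set (Fin k × Fin k)) : Set α :=
  {π | ∃ q ∈ E, π ∈ Γ.sep q ∧ Γ.dist q ≤ Γ.diam E / (k : ℝ) ^ 3}

open Classical in
/-- The expectation of `f` after one step from the state `s`, with a random allowed cut. If all
centers are separated, then the state does not change. -/
def avg (f : ChainState k → ℝ) (s : ChainState k) : ℝ :=
  if Γ.diam s.1 = 0 then f s
  else (∑ π, (Γ.allowed s.1).indicator (fun π => Γ.weight π * f (Γ.next s π)) π) /
    Γ.mass (Γ.allowed s.1)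

/-- The expected distance of the data point, after `n` steps, from the closest center in its
leaf. -/
def value : ℕ → ChainState k → ℝ
  | 0 => fun s => sInf (Γ.ptDist '' s.2)
  | n + 1 => Γ.avg (value n)

/-- The expectation of the sum of `φ` over the first `n` states. -/
def acc (φ : ChainState k → ℝ) : ℕ → ChainState k → ℝ
  | 0 => fun _ => 0
  | n + 1 => fun s => φ s + Γ.avg (acc φ n) s

/-! ### Masses and diameters -/

lemma mass_nonneg (Q : Set α) : 0 ≤ Γ.mass Q :=
  Finset.sum_nonneg fun _ _ => Set.indicator_nonneg (fun _ _ => Γ.weight_nonneg _) _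

lemma mass_mono {Q Q' : Set α} (h : Q ⊆ Q') : Γ.mass Q ≤ Γ.mass Q' :=
  Finset.sum_le_sum fun _ _ =>
    Set.indicator_le_indicator_of_subset h (fun _ => Γ.weight_nonneg _) _

lemma mass_le_add {Q Q₁ Q₂ : Set α} (h : Q ⊆ Q₁ ∪ Q₂) : Γ.mass Q ≤ Γ.mass Q₁ + Γ.mass Q₂ := by
  classical
  rw [mass, mass, mass, ← Finset.sum_add_distrib]
  refine Finset.sum_le_sum fun π _ => ?_
  have hw := Γ.weight_nonneg π
  have := @h π
  simp only [Set.indicator_apply, Set.mem_union] at *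
  split_ifs <;> simp_all

lemma mass_inter_add_diff (Q Q' : Set α) : Γ.mass (Q ∩ Q') + Γ.mass (Q \ Q') = Γ.mass Q := by
  classical
  rw [mass, mass, mass, ← Finset.sum_add_distrib]
  refine Finset.sum_congr rfl fun π _ => ?_
  simp only [Set.indicator_apply, Set.mem_inter_iff, Set.mem_sdiff]
  split_ifs <;> simp_all

lemma dist_nonneg (q : Fin k × Fin k) : 0 ≤ Γ.dist q := Γ.mass_nonneg _

lemma dist_le_diam {E : Set (Fin k × Fin k)} {q : Fin k × Fin k} (hq : q ∈ E) :
    Γ.dist q ≤ Γ.diam E :=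
  le_csSup (Set.toFinite _).bddAbove ⟨q, hq, rfl⟩

lemma exists_dist_eq_diam {E : Set (Fin k × Fin k)} (hE : E.Nonempty) :
    ∃ q ∈ E, Γ.dist q = Γ.diam E :=
  (hE.image Γ.dist).csSup_mem (Set.toFinite _)

lemma diam_nonneg (E : Set (Fin k × Fin k)) : 0 ≤ Γ.diam E :=
  Real.sSup_nonneg (by rintro _ ⟨q, -, rfl⟩; exact Γ.dist_nonneg q)

lemma diam_mono {E E' : Set (Fin k × Fin k)} (h : E' ⊆ E) : Γ.diam E' ≤ Γ.diam E :=
  Real.sSup_le (by rintro _ ⟨q, hq, rfl⟩; exact Γ.dist_le_diam (h hq)) (Γ.diam_nonneg E)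

lemma exists_of_diam_pos {E : Set (Fin k × Fin k)} (h : 0 < Γ.diam E) :
    ∃ q ∈ E, Γ.dist q = Γ.diam E := by
  refine Γ.exists_dist_eq_diam ?_
  by_contra hE
  rw [Set.not_nonempty_iff_eq_empty] at hE
  simp [hE, diam] at h

/-- A union bound over the `k² - k` ordered pairs of distinct centers: the forbidden cuts make up
at most a quarter of the diameter. -/
lemma mass_bad_le (E : Set (Fin k × Fin k)) : Γ.mass (Γ.bad E) ≤ Γ.diam E / 4 := by
  classical
  set D := Γ.diam E
  have hD : 0 ≤ D := Γ.diam_nonneg E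
  have hterm (q : Fin k × Fin k) :
      ∑ π, ({π | π ∈ Γ.sep q ∧ Γ.dist q ≤ D / (k : ℝ) ^ 3}).indicator Γ.weight π
        ≤ D / (k : ℝ) ^ 3 := by
    by_cases h : Γ.dist q ≤ D / (k : ℝ) ^ 3
    · have hset : {π | π ∈ Γ.sep q ∧ Γ.dist q ≤ D / (k : ℝ) ^ 3} = Γ.sep q := by
        ext; simp [h]
      rw [hset]
      exact h
    · simp only [h, and_false, Set.ofPred_false, Set.indicator_empty, Finset.sum_const_zero]
      positivity
  have h1 : Γ.mass (Γ.bad E) ≤ ∑ q ∈ (Finset.univ : Finset (Fin k)).offDiag, D / (k : ℝ) ^ 3 := by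
    refine le_trans ?_ (Finset.sum_le_sum fun q _ => hterm q)
    rw [Finset.sum_comm, mass]
    refine Finset.sum_le_sum fun π _ => ?_
    have hnn : ∀ q, 0 ≤ ({π | π ∈ Γ.sep q ∧ Γ.dist q ≤ D / (k : ℝ) ^ 3}).indicator Γ.weight π :=
      fun q => Set.indicator_nonneg (fun _ _ => Γ.weight_nonneg _) _
    by_cases hπ : π ∈ Γ.bad E
    · obtain ⟨q, -, hs, hq⟩ := id hπ
      have hmem : q ∈ (Finset.univ : Finset (Fin k)).offDiag := by
        simp only [Finset.mem_offDiag, Finset.mem_univ, true_and]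
        intro h
        apply hs
        rw [h]
      refine le_trans ?_ (Finset.single_le_sum (fun q _ => hnn q) hmem)
      rw [Set.indicator_of_mem hπ, Set.indicator_of_mem (by exact ⟨hs, hq⟩)]
    · rw [Set.indicator_of_notMem hπ]
      exact Finset.sum_nonneg fun q _ => hnn q
  refine h1.trans ?_
  rw [Finset.sum_const, Finset.offDiag_card, Finset.card_univ, Fintype.card_fin, nsmul_eq_mul]
  rcases Nat.eq_zero_or_pos k with hk | hk
  · simp only [hk]; simp; positivity
  · have hk' : (0 : ℝ) < k := by exact_mod_cast hk
    rw [Nat.cast_sub (Nat.le_mul_self k), mul_div_assoc', div_le_div_iff₀ (by positivity) (by norm_num)]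
    push_cast
    have h1k : (1 : ℝ) ≤ k := by exact_mod_cast hk
    have : ((k : ℝ) * k - k) * 4 ≤ (k : ℝ) ^ 3 := by
      nlinarith [mul_nonneg hk'.le (sq_nonneg ((k : ℝ) - 2))]
    nlinarith

/-- Each unseparated pair keeps all but a quarter of the diameter of its cuts. -/
lemma dist_sub_le_mass {E : Set (Fin k × Fin k)} {q : Fin k × Fin k} (hq : q ∈ E) :
    Γ.dist q - Γ.diam E / 4 ≤ Γ.mass (Γ.allowed E ∩ Γ.sep q) := by
  have : Γ.sep q ⊆ Γ.bad E ∪ (Γ.allowed E ∩ Γ.sep q) := by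
    intro π hπ
    by_cases hb : π ∈ Γ.bad E
    · exact Or.inl hb
    · refine Or.inr ⟨⟨⟨q, hq, hπ⟩, fun q' hq' hs => ?_⟩, hπ⟩
      by_contra hc
      exact hb ⟨q', hq', hs, not_lt.1 hc⟩
  have h1 := Γ.mass_le_add this
  have h2 := Γ.mass_bad_le E
  rw [dist]
  linarith

lemma mass_allowed_pos {E : Set (Fin k × Fin k)} (h : 0 < Γ.diam E) :
    0 < Γ.mass (Γ.allowed E) := by
  obtain ⟨q, hq, hd⟩ := Γ.exists_of_diam_pos h
  have h1 := Γ.dist_sub_le_mass hq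
  have h2 := Γ.mass_mono (Set.inter_subset_left : Γ.allowed E ∩ Γ.sep q ⊆ _)
  rw [hd] at h1
  linarith

/-! ### One-step expectations -/

lemma avg_of_pos {f : ChainState k → ℝ} {s : ChainState k} (h : 0 < Γ.diam s.1) :
    Γ.avg f s = (∑ π, (Γ.allowed s.1).indicator (fun π => Γ.weight π * f (Γ.next s π)) π) /
      Γ.mass (Γ.allowed s.1) := by
  rw [avg, if_neg h.ne']

lemma avg_of_eq_zero {f : ChainState k → ℝ} {s : ChainState k} (h : Γ.diam s.1 = 0) :
    Γ.avg f s = f s := by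
  rw [avg, if_pos h]

/-- The one-step expectation is monotone, up to an extra charge `g π` for the allowed cut `π`. -/
lemma avg_le_add {f h : ChainState k → ℝ} {g : α → ℝ} {s : ChainState k}
    (hs : 0 < Γ.diam s.1)
    (H : ∀ π ∈ Γ.allowed s.1, f (Γ.next s π) ≤ h (Γ.next s π) + g π) :
    Γ.avg f s ≤ Γ.avg h s +
      ∑ π, Γ.weight π * (Γ.allowed s.1).indicator (fun π => g π / Γ.mass (Γ.allowed s.1)) π := by
  classical
  have hρ := Γ.mass_allowed_pos hs
  rw [Γ.avg_of_pos hs, Γ.avg_of_pos hs, div_add' _ _ _ hρ.ne', Finset.sum_mul,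
    ← Finset.sum_add_distrib]
  gcongr with π
  by_cases hπ : π ∈ Γ.allowed s.1
  · simp only [Set.indicator_of_mem hπ]
    have := mul_le_mul_of_nonneg_left (H π hπ) (Γ.weight_nonneg π)
    field_simp
    linarith
  · simp [Set.indicator_of_notMem hπ]

lemma avg_mono {f h : ChainState k → ℝ} {s : ChainState k} (h0 : f s ≤ h s)
    (H : ∀ π ∈ Γ.allowed s.1, f (Γ.next s π) ≤ h (Γ.next s π)) :
    Γ.avg f s ≤ Γ.avg h s := by
  rcases (Γ.diam_nonneg s.1).eq_or_lt with hs | hs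
  · rwa [Γ.avg_of_eq_zero hs.symm, Γ.avg_of_eq_zero hs.symm]
  · simpa using Γ.avg_le_add (g := fun _ => 0) hs (by simpa using H)

lemma avg_const (b : ℝ) (s : ChainState k) : Γ.avg (fun _ => b) s = b := by
  classical
  rcases (Γ.diam_nonneg s.1).eq_or_lt with hs | hs
  · rw [Γ.avg_of_eq_zero hs.symm]
  · rw [Γ.avg_of_pos hs, div_eq_iff (Γ.mass_allowed_pos hs).ne', mass, Finset.mul_sum]
    refine Finset.sum_congr rfl fun π _ => ?_
    by_cases hπ : π ∈ Γ.allowed s.1 <;> simp [hπ, mul_comm]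

lemma avg_le_const {f : ChainState k → ℝ} {s : ChainState k} {b : ℝ} (h0 : f s ≤ b)
    (H : ∀ π ∈ Γ.allowed s.1, f (Γ.next s π) ≤ b) : Γ.avg f s ≤ b := by
  simpa [avg_const] using Γ.avg_mono (h := fun _ => b) h0 H

lemma avg_add (f h : ChainState k → ℝ) (s : ChainState k) :
    Γ.avg (fun s => f s + h s) s = Γ.avg f s + Γ.avg h s := by
  classical
  rcases (Γ.diam_nonneg s.1).eq_or_lt with hs | hs
  · simp [Γ.avg_of_eq_zero hs.symm]
  · rw [Γ.avg_of_pos hs, Γ.avg_of_pos hs, Γ.avg_of_pos hs, ← add_div, ← Finset.sum_add_distrib]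
    congr 1
    refine Finset.sum_congr rfl fun π _ => ?_
    by_cases hπ : π ∈ Γ.allowed s.1 <;> simp [hπ, mul_add]

lemma avg_mul (a : ℝ) (f : ChainState k → ℝ) (s : ChainState k) :
    Γ.avg (fun s => a * f s) s = a * Γ.avg f s := by
  classical
  rcases (Γ.diam_nonneg s.1).eq_or_lt with hs | hs
  · simp [Γ.avg_of_eq_zero hs.symm]
  · rw [Γ.avg_of_pos hs, Γ.avg_of_pos hs, mul_div_assoc', Finset.mul_sum]
    congr 1
    refine Finset.sum_congr rfl fun π _ => ?_
    by_cases hπ : π ∈ Γ.allowed s.1 <;> simp [hπ, mul_left_comm]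

lemma avg_sum {β : Type*} (t : Finset β) (f : β → ChainState k → ℝ) (s : ChainState k) :
    Γ.avg (fun s => ∑ b ∈ t, f b s) s = ∑ b ∈ t, Γ.avg (f b) s := by
  classical
  induction t using Finset.induction_on with
  | empty => simp [avg_const]
  | insert a t ha ih => simp only [Finset.sum_insert ha, avg_add, ih]

/-! ### Accumulated sums -/

lemma acc_nonneg {φ : ChainState k → ℝ} (hφ : ∀ s, 0 ≤ φ s) (n : ℕ) (s : ChainState k) :
    0 ≤ Γ.acc φ n s := by
  induction n generalizing s with
  | zero => exact le_rfl
  | succ n ih =>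
    refine add_nonneg (hφ s) ?_
    rw [← Γ.avg_const 0 s]
    exact Γ.avg_mono (ih s) fun π _ => ih _

lemma acc_add (φ ψ : ChainState k → ℝ) (n : ℕ) (s : ChainState k) :
    Γ.acc (fun s => φ s + ψ s) n s = Γ.acc φ n s + Γ.acc ψ n s := by
  induction n generalizing s with
  | zero => simp [acc]
  | succ n ih =>
    have : Γ.acc (fun s => φ s + ψ s) n = fun s => Γ.acc φ n s + Γ.acc ψ n s := funext ih
    simp only [acc, this, avg_add]
    ring

lemma acc_mul (a : ℝ) (φ : ChainState k → ℝ) (n : ℕ) (s : ChainState k) :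
    Γ.acc (fun s => a * φ s) n s = a * Γ.acc φ n s := by
  induction n generalizing s with
  | zero => simp [acc]
  | succ n ih =>
    have : Γ.acc (fun s => a * φ s) n = fun s => a * Γ.acc φ n s := funext ih
    simp only [acc, this, avg_mul]
    ring

/-- A pointwise comparison on the states that can be reached from `s`. -/
lemma acc_mono {φ ψ : ChainState k → ℝ} {s : ChainState k} (h : ∀ s' ≤ s, φ s' ≤ ψ s') (n : ℕ) :
    Γ.acc φ n s ≤ Γ.acc ψ n s := by
  induction n generalizing s with
  | zero => exact le_rfl
  | succ n ih =>
    refine add_le_add (h s le_rfl) (Γ.avg_mono (ih h) fun π _ => ?_)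
    exact ih fun s' hs' => h s' (hs'.trans (Γ.next_le s π))

end CutSystem
end ExplainableClustering

namespace ExplainableClustering

namespace CutSystem

variable {k : ℕ} {α : Type*} (Γ : CutSystem k α)

/-! ### The leaf of the data point -/

/-- The centers in the leaf of the data point are unseparated, and there is at least one. -/
def Valid (s : ChainState k) : Prop := s.2.Nonempty ∧ ∀ i ∈ s.2, ∀ j ∈ s.2, (i, j) ∈ s.1

lemma Valid.next {s : ChainState k} (hs : Valid s) (π : α) : Valid (Γ.next s π) := by
  classical
  simp only [CutSystem.next]
  split_ifs with h
  · obtain ⟨j, hj, hπ⟩ := h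
    refine ⟨⟨j, hj, hπ⟩, fun i hi j hj => ⟨hs.2 i hi.1 j hj.1, ?_⟩⟩
    have h1 := hi.2
    have h2 := hj.2
    simp only [ptSep, sep, Set.mem_ofPred_eq, not_not] at *
    tauto
  · push Not at h
    refine ⟨hs.1, fun i hi j hj => ⟨hs.2 i hi j hj, ?_⟩⟩
    have h1 := h i hi
    have h2 := h j hj
    simp only [ptSep, sep, Set.mem_ofPred_eq, not_not] at *
    tauto

/-- If the center `j` gets out of the leaf of the data point, then the cut separates the two, and
the remaining centers are on the side of the data point. -/
lemma mem_ptSep_of_notMem_next {s : ChainState k} {π : α} {j : Fin k} (hj : j ∈ s.2)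
    (h : j ∉ (Γ.next s π).2) :
    π ∈ Γ.ptSep j ∧ (∃ i ∈ s.2, π ∉ Γ.ptSep i) ∧ (Γ.next s π).2 = {i ∈ s.2 | π ∉ Γ.ptSep i} := by
  classical
  simp only [next] at *
  split_ifs at * with h1
  · refine ⟨?_, h1, rfl⟩
    by_contra hc
    exact h ⟨hj, hc⟩
  · exact absurd hj h

variable [Fintype α]

/-! ### The sum of `diam / mass` over a range of scales -/

/-- The number of unseparated pairs at distance more than `r`. -/
def farCount (r : ℝ) (E : Set (Fin k × Fin k)) : ℕ := Set.ncard {q ∈ E | r < Γ.dist q}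

/-- The potential `1 + log N` of a number `N` of pairs, and `0` for `N = 0`. It drops by at least
the relative decrease of `N`, even if `N` drops to `0`. -/
def logPot (N : ℕ) : ℝ := if N = 0 then 0 else 1 + Real.log N

lemma logPot_nonneg (N : ℕ) : 0 ≤ logPot N := by
  unfold logPot
  split_ifs
  · exact le_rfl
  · have := Real.log_natCast_nonneg N
    linarith

lemma logPot_mono {N N' : ℕ} (h : N' ≤ N) : logPot N' ≤ logPot N := by
  rcases Nat.eq_zero_or_pos N' with h0 | h0
  · simpa [h0, logPot] using logPot_nonneg N
  · have h1 : 0 < N := h0.trans_le h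
    rw [logPot, logPot, if_neg h0.ne', if_neg h1.ne']
    gcongr

lemma logPot_le_sub {N N' : ℕ} (hN : 0 < N) : logPot N' ≤ logPot N - 1 + N' / N := by
  rw [logPot, logPot, if_neg hN.ne']
  have hN' : (0 : ℝ) < N := by exact_mod_cast hN
  split_ifs with h
  · simpa [h] using Real.log_natCast_nonneg N
  · have h0 : (0 : ℝ) < N' := by exact_mod_cast Nat.pos_of_ne_zero h
    have := Real.log_le_sub_one_of_pos (div_pos h0 hN')
    rw [Real.log_div h0.ne' hN'.ne'] at this
    linarith

lemma farCount_mono {r : ℝ} {E E' : Set (Fin k × Fin k)} (h : E' ⊆ E) :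
    Γ.farCount r E' ≤ Γ.farCount r E :=
  Set.ncard_le_ncard (fun _ hq => ⟨h hq.1, hq.2⟩) (Set.toFinite _)

lemma farCount_le (r : ℝ) (E : Set (Fin k × Fin k)) : Γ.farCount r E ≤ k ^ 2 := by
  have := Set.ncard_le_card {q ∈ E | r < Γ.dist q}
  simpa [farCount, sq] using this

/-- If the diameter is at most `2 r`, then a random allowed cut separates each pair at distance
more than `r` with probability at least `r / (2 mass)`, and decreases the potential by at least
as much. -/
lemma avg_logPot_le {r : ℝ} {s : ChainState k} (hr : 0 < r) (h1 : r < Γ.diam s.1)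
    (h2 : Γ.diam s.1 ≤ 2 * r) :
    Γ.avg (fun s => logPot (Γ.farCount r s.1)) s
      ≤ logPot (Γ.farCount r s.1) - r / 2 / Γ.mass (Γ.allowed s.1) := by
  classical
  have hD : 0 < Γ.diam s.1 := hr.trans h1
  set ρ := Γ.mass (Γ.allowed s.1) with hρdef
  have hρ : 0 < ρ := Γ.mass_allowed_pos hD
  set N := Γ.farCount r s.1 with hN
  have hNpos : 0 < N := by
    obtain ⟨q, hq, hd⟩ := Γ.exists_of_diam_pos hD
    rw [hN, farCount, Set.ncard_pos (Set.toFinite _)]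
    exact ⟨q, hq, by rwa [hd]⟩
  have hNR : (0 : ℝ) < N := by exact_mod_cast hNpos
  -- the expected number of the pairs that remain
  have hcount : ∑ π, (Γ.allowed s.1).indicator
        (fun π => Γ.weight π * (Γ.farCount r (Γ.next s π).1 : ℝ)) π ≤ N * (ρ - r / 2) := by
    set F : Finset (Fin k × Fin k) := Finset.univ.filter (fun q => q ∈ s.1 ∧ r < Γ.dist q)
    have hF : (F.card : ℝ) = N := by
      rw [hN, farCount, ← Set.ncard_coe_finset]
      congr 2
      ext q; simp [F]
    have hterm (q) (hq : q ∈ F) : Γ.mass (Γ.allowed s.1 \ Γ.sep q) ≤ ρ - r / 2 := by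
      simp only [F, Finset.mem_filter, Finset.mem_univ, true_and] at hq
      have h3 := Γ.dist_sub_le_mass hq.1
      have h4 := Γ.mass_inter_add_diff (Γ.allowed s.1) (Γ.sep q)
      linarith [hq.2]
    have hle : ∑ q ∈ F, Γ.mass (Γ.allowed s.1 \ Γ.sep q) ≤ N * (ρ - r / 2) := by
      refine (Finset.sum_le_sum hterm).trans ?_
      rw [Finset.sum_const, nsmul_eq_mul, hF]
    refine le_trans (le_of_eq ?_) hle
    simp only [mass]
    rw [Finset.sum_comm]
    refine Finset.sum_congr rfl fun π _ => ?_
    by_cases hπ : π ∈ Γ.allowed s.1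
    · rw [Set.indicator_of_mem hπ]
      have : (Γ.farCount r (Γ.next s π).1 : ℝ) = ∑ q ∈ F, if π ∈ Γ.sep q then (0 : ℝ) else 1 := by
        have : ∀ q, (if π ∈ Γ.sep q then (0 : ℝ) else 1) = if π ∉ Γ.sep q then 1 else 0 :=
          fun q => (ite_not _ _ _).symm
        simp only [this]
        rw [← Finset.sum_filter, Finset.sum_const, nsmul_one, farCount, ← Set.ncard_coe_finset]
        congr 2
        ext q
        simp only [next, F, Set.mem_ofPred_eq, Finset.coe_filter, Finset.mem_filter,
          Finset.mem_univ, true_and]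
        tauto
      rw [this, Finset.mul_sum]
      refine Finset.sum_congr rfl fun q _ => ?_
      by_cases hq : π ∈ Γ.sep q <;> simp [hq, hπ]
    · rw [Set.indicator_of_notMem hπ]
      refine (Finset.sum_eq_zero fun q _ => ?_).symm
      exact Set.indicator_of_notMem (fun h => hπ h.1) _
  have hstep : Γ.avg (fun s => logPot (Γ.farCount r s.1)) s
      ≤ Γ.avg (fun s => (logPot N - 1) + (1 / N : ℝ) * Γ.farCount r s.1) s := by
    have hpt (M : ℕ) : logPot M ≤ (logPot N - 1) + (1 / N : ℝ) * M := by
      have := logPot_le_sub (N' := M) hNpos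
      rw [one_div_mul_eq_div]; exact this
    exact Γ.avg_mono (hpt _) fun π _ => hpt _
  refine hstep.trans ?_
  rw [Γ.avg_add (fun _ => logPot N - 1), avg_const, avg_mul, Γ.avg_of_pos hD]
  have : (∑ π, (Γ.allowed s.1).indicator
        (fun π => Γ.weight π * (Γ.farCount r (Γ.next s π).1 : ℝ)) π) / ρ ≤ N * (1 - r / 2 / ρ) := by
    rw [div_le_iff₀ hρ]
    refine hcount.trans (le_of_eq ?_)
    field_simp
  have h5 := mul_le_mul_of_nonneg_left this (by positivity : (0 : ℝ) ≤ 1 / N)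
  have h6 : (1 / N : ℝ) * (N * (1 - r / 2 / ρ)) = 1 - r / 2 / ρ := by field_simp
  linarith

/-- The expected number of steps weighted by `diam / mass` is `O(log k)` per scale. -/
lemma acc_scale_le {r : ℝ} (hr : 0 < r) (M : ℕ) (n : ℕ) {s : ChainState k}
    (hs : Γ.diam s.1 ≤ 2 ^ M * r) :
    Γ.acc (fun s => if r < Γ.diam s.1 then Γ.diam s.1 / Γ.mass (Γ.allowed s.1) else 0) n s
      ≤ 4 * M * (1 + 2 * Real.log k) := by
  classical
  set φ : ChainState k → ℝ :=
    fun s => if r < Γ.diam s.1 then Γ.diam s.1 / Γ.mass (Γ.allowed s.1) else 0 with hφ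
  set Φ : ChainState k → ℝ :=
    fun s => 4 * ∑ i ∈ Finset.range M, logPot (Γ.farCount (2 ^ i * r) s.1) with hΦ
  have hmono (i : ℕ) (s : ChainState k) :
      Γ.avg (fun s => logPot (Γ.farCount (2 ^ i * r) s.1)) s ≤
        logPot (Γ.farCount (2 ^ i * r) s.1) :=
    Γ.avg_le_const le_rfl fun π _ => logPot_mono (Γ.farCount_mono (Γ.next_le s π).1)
  have hstep (s : ChainState k) (hs : Γ.diam s.1 ≤ 2 ^ M * r) : φ s + Γ.avg Φ s ≤ Φ s := by
    rw [hΦ, avg_mul, avg_sum]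
    by_cases hd : r < Γ.diam s.1
    · have hex : ∀ M : ℕ, Γ.diam s.1 ≤ 2 ^ M * r →
          ∃ i < M, 2 ^ i * r < Γ.diam s.1 ∧ Γ.diam s.1 ≤ 2 * (2 ^ i * r) := by
        intro M hs
        induction M with
        | zero => simp at hs; linarith
        | succ M ih =>
          by_cases h : Γ.diam s.1 ≤ 2 ^ M * r
          · obtain ⟨i, hi, h1⟩ := ih h
            exact ⟨i, by omega, h1⟩
          · refine ⟨M, by omega, not_le.1 h, ?_⟩
            rw [pow_succ] at hs
            linarith
      obtain ⟨i, hi, h1, h2⟩ := hex M hs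
      have h3 := Γ.avg_logPot_le (by positivity) h1 h2
      set ρ := Γ.mass (Γ.allowed s.1)
      have hρ : 0 < ρ := Γ.mass_allowed_pos (hr.trans hd)
      have hsum : ∑ b ∈ Finset.range M, Γ.avg (fun s => logPot (Γ.farCount (2 ^ b * r) s.1)) s
          ≤ ∑ b ∈ Finset.range M, (logPot (Γ.farCount (2 ^ b * r) s.1)
            - if b = i then 2 ^ i * r / 2 / ρ else 0) := by
        refine Finset.sum_le_sum fun b _ => ?_
        by_cases hb : b = i
        · subst hb; simpa using h3
        · simpa [hb] using hmono b s
      rw [Finset.sum_sub_distrib, Finset.sum_ite_eq', if_pos (Finset.mem_range.2 hi)] at hsum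
      have h4 : φ s ≤ 4 * (2 ^ i * r / 2 / ρ) := by
        rw [hφ]
        simp only [hd, if_true]
        rw [div_div, mul_div_assoc', div_le_div_iff₀ hρ (by positivity)]
        nlinarith
      linarith
    · have h4 : φ s = 0 := by simp [hφ, hd]
      have := Finset.sum_le_sum fun i (_ : i ∈ Finset.range M) => hmono i s
      linarith
  have hacc : ∀ n s, Γ.diam s.1 ≤ 2 ^ M * r → Γ.acc φ n s ≤ Φ s := by
    intro n
    induction n with
    | zero => exact fun s _ => mul_nonneg (by norm_num) (Finset.sum_nonneg fun _ _ => logPot_nonneg _)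
    | succ n ih =>
      intro s hs
      refine le_trans ?_ (hstep s hs)
      simp only [acc]
      gcongr
      exact Γ.avg_mono (ih s hs) fun π _ => ih _ ((Γ.diam_mono (Γ.next_le s π).1).trans hs)
  refine (hacc n s hs).trans ?_
  have hpot (i : ℕ) : logPot (Γ.farCount (2 ^ i * r) s.1) ≤ 1 + 2 * Real.log k := by
    refine (logPot_mono (Γ.farCount_le _ s.1)).trans ?_
    unfold logPot
    split_ifs
    · have := Real.log_natCast_nonneg k
      linarith
    · push_cast
      rw [Real.log_pow]
      norm_num
  calc Φ s ≤ 4 * ∑ i ∈ Finset.range M, (1 + 2 * Real.log k) := by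
        rw [hΦ]
        exact mul_le_mul_of_nonneg_left (Finset.sum_le_sum fun i _ => hpot i) (by norm_num)
    _ = _ := by rw [Finset.sum_const, Finset.card_range, nsmul_eq_mul]; ring

open Classical in
/-- A condition that can hold only while the diameter is within a factor `2 ^ M` of its value at
the first time when the condition holds is charged `O(M log k)`. -/
lemma acc_window_le {p : ChainState k → Prop} {M : ℕ}
    (hp : ∀ s s', s' ≤ s → p s → p s' → Γ.diam s.1 < 2 ^ M * Γ.diam s'.1)
    (n : ℕ) (s : ChainState k) :
    Γ.acc (fun s => if p s then Γ.diam s.1 / Γ.mass (Γ.allowed s.1) else 0) n s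
      ≤ 4 * M * (1 + 2 * Real.log k) := by
  induction n generalizing s with
  | zero =>
    have := Real.log_natCast_nonneg k
    simp only [acc]; positivity
  | succ n ih =>
    by_cases h : p s
    · have h0 : 0 < Γ.diam s.1 := by
        have := hp s s le_rfl h h
        by_contra hc
        have h1 : Γ.diam s.1 = 0 := le_antisymm (not_lt.1 hc) (Γ.diam_nonneg _)
        simp [h1] at this
      have hM : (0 : ℝ) < 2 ^ M := by positivity
      refine le_trans ?_ (Γ.acc_scale_le (r := Γ.diam s.1 / 2 ^ M) (by positivity) M (n + 1)
        (s := s) (by rw [mul_div_cancel₀ _ hM.ne']))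
      refine Γ.acc_mono (fun s' hs' => ?_) _
      by_cases h' : p s'
      · have h2 : Γ.diam s.1 / 2 ^ M < Γ.diam s'.1 := by
          rw [div_lt_iff₀ hM, mul_comm]; exact hp s s' hs' h h'
        rw [if_pos h', if_pos h2]
      · rw [if_neg h']
        split_ifs
        · exact div_nonneg (Γ.diam_nonneg _) (Γ.mass_nonneg _)
        · exact le_rfl
    · simp only [acc, h, if_false, zero_add]
      exact Γ.avg_le_const (ih s) fun π _ => ih _

/-! ### Charging the separating cuts -/

lemma ptDist_nonneg (j : Fin k) : 0 ≤ Γ.ptDist j := Γ.mass_nonneg _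

lemma ptDist_le (i j : Fin k) : Γ.ptDist j ≤ Γ.ptDist i + Γ.dist (i, j) := by
  refine Γ.mass_le_add fun π hπ => ?_
  simp only [ptSep, sep, Set.mem_union, Set.mem_ofPred_eq] at *
  tauto

lemma ptDist_le_diam {s : ChainState k} (hs : Valid s) {i j : Fin k} (hi : i ∈ s.2)
    (hj : j ∈ s.2) : Γ.ptDist j ≤ Γ.ptDist i + Γ.diam s.1 :=
  (Γ.ptDist_le i j).trans (by gcongr; exact Γ.dist_le_diam (hs.2 i hi j hj))

lemma value_le {b : ℝ} (n : ℕ) {s : ChainState k} (hs : Valid s)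
    (h : ∀ j ∈ s.2, Γ.ptDist j ≤ b) : Γ.value n s ≤ b := by
  induction n generalizing s with
  | zero =>
    obtain ⟨j, hj⟩ := hs.1
    refine (csInf_le ⟨0, ?_⟩ (Set.mem_image_of_mem _ hj)).trans (h j hj)
    rintro _ ⟨i, -, rfl⟩
    exact Γ.ptDist_nonneg i
  | succ n ih =>
    exact Γ.avg_le_const (ih hs h) fun π _ =>
      ih (hs.next Γ π) fun j hj => h j ((Γ.next_le s π).2 hj)

/-- If the value after a cut `π` that takes the center `j` away from the data point is at most
`b + G π s`, then the value is at most `b` plus the expected total charge. -/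
lemma value_le_charge {j : Fin k} {b : ℝ} (hb : Γ.ptDist j ≤ b) {G : α → ChainState k → ℝ}
    (hG0 : ∀ π s, 0 ≤ G π s)
    (hG : ∀ s π, Valid s → 0 < Γ.diam s.1 → j ∈ s.2 → π ∈ Γ.allowed s.1 → j ∉ (Γ.next s π).2 →
      ∀ n, Γ.value n (Γ.next s π) ≤ b + G π s)
    (n : ℕ) {s : ChainState k} (hs : Valid s) (hj : j ∈ s.2) :
    Γ.value n s ≤ b + ∑ π, (Γ.ptSep j).indicator Γ.weight π *
      Γ.acc (fun s => (Γ.allowed s.1).indicator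
        (fun π => G π s / Γ.mass (Γ.allowed s.1)) π) n s := by
  classical
  set ψ : α → ChainState k → ℝ := fun π s => (Γ.allowed s.1).indicator
        (fun π => G π s / Γ.mass (Γ.allowed s.1)) π with hψ
  have hψ0 (π s) : 0 ≤ ψ π s :=
    Set.indicator_nonneg (fun _ _ => div_nonneg (hG0 _ _) (Γ.mass_nonneg _)) _
  have hw (π) : 0 ≤ (Γ.ptSep j).indicator Γ.weight π :=
    Set.indicator_nonneg (fun _ _ => Γ.weight_nonneg _) _
  induction n generalizing s with
  | zero =>
    simp only [acc, mul_zero, Finset.sum_const_zero, add_zero]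
    refine (csInf_le ⟨0, ?_⟩ (Set.mem_image_of_mem _ hj)).trans hb
    rintro _ ⟨i, -, rfl⟩
    exact Γ.ptDist_nonneg i
  | succ n ih =>
    rcases (Γ.diam_nonneg s.1).eq_or_lt with hD | hD
    · rw [value, Γ.avg_of_eq_zero hD.symm]
      refine (ih hs hj).trans ?_
      gcongr with π
      · exact hw π
      · simp only [acc, Γ.avg_of_eq_zero hD.symm]
        linarith [hψ0 π s]
    · set h : ChainState k → ℝ :=
        fun s => b + ∑ π, (Γ.ptSep j).indicator Γ.weight π * Γ.acc (ψ π) n s with hh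
      have hnn (s) : 0 ≤ ∑ π, (Γ.ptSep j).indicator Γ.weight π * Γ.acc (ψ π) n s :=
        Finset.sum_nonneg fun π _ => mul_nonneg (hw π) (Γ.acc_nonneg (hψ0 π) n s)
      have key := Γ.avg_le_add (f := Γ.value n) (h := h)
        (g := fun π => (Γ.ptSep j).indicator (fun π => G π s) π) hD (by
          intro π hπ
          by_cases hmem : j ∈ (Γ.next s π).2
          · refine (ih (hs.next Γ π) hmem).trans ?_
            have : 0 ≤ (Γ.ptSep j).indicator (fun π => G π s) π :=
              Set.indicator_nonneg (fun _ _ => hG0 _ _) _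
            simp only [hh]
            linarith
          · refine (hG s π hs hD hj hπ hmem n).trans ?_
            rw [Set.indicator_of_mem (Γ.mem_ptSep_of_notMem_next hj hmem).1]
            have := hnn (Γ.next s π)
            simp only [hh]
            linarith)
      rw [value]
      refine key.trans (le_of_eq ?_)
      rw [hh, Γ.avg_add (fun _ => b), avg_const, avg_sum, add_assoc, ← Finset.sum_add_distrib]
      congr 1
      refine Finset.sum_congr rfl fun π _ => ?_
      rw [avg_mul, acc, mul_add, add_comm]
      congr 1
      by_cases h1 : π ∈ Γ.ptSep j <;> by_cases h2 : π ∈ Γ.allowed s.1 <;> simp [h1, h2]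

/-- A fixed cut is allowed only while the diameter drops by a factor `k³`. -/
lemma acc_allowed_le {M : ℕ} (hM : k ^ 3 ≤ 2 ^ M) (hk : (0 : ℝ) < k) (π : α) (n : ℕ)
    (s : ChainState k) :
    Γ.acc (fun s => (Γ.allowed s.1).indicator
      (fun _ => Γ.diam s.1 / Γ.mass (Γ.allowed s.1)) π) n s ≤ 4 * M * (1 + 2 * Real.log k) := by
  classical
  have h2 := Γ.acc_window_le (p := fun s => π ∈ Γ.allowed s.1) (M := M) (by
    intro s s' hle hp hp'
    obtain ⟨q, hq, hsep⟩ := hp'.1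
    have h3 := hp.2 q (hle.1 hq) hsep
    rw [div_lt_iff₀ (by positivity)] at h3
    have h4 := Γ.dist_le_diam hq
    have h5 : (k : ℝ) ^ 3 ≤ 2 ^ M := by exact_mod_cast hM
    nlinarith [Γ.diam_nonneg s'.1, Γ.dist_nonneg q, mul_le_mul h4 h5 (by positivity) (Γ.diam_nonneg s'.1)]) n s
  refine le_trans (le_of_eq ?_) h2
  congr 1

/-- The `O(log² k)` bound, with respect to any center `j` in the leaf of the data point: a cut is
allowed only while the diameter drops by a factor `k³`. -/
lemma value_le_crude {M : ℕ} (hM : k ^ 3 ≤ 2 ^ M) (j : Fin k) (n : ℕ) {s : ChainState k}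
    (hs : Valid s) (hj : j ∈ s.2) :
    Γ.value n s ≤ (1 + 4 * M * (1 + 2 * Real.log k)) * Γ.ptDist j := by
  classical
  have hk : (0 : ℝ) < k := by exact_mod_cast j.pos
  have h1 := Γ.value_le_charge (j := j) (b := Γ.ptDist j) le_rfl (G := fun _ s => Γ.diam s.1)
    (fun _ s => Γ.diam_nonneg s.1) (by
      intro s π hs _ hj _ _ n
      refine Γ.value_le n (hs.next Γ π) fun i hi => ?_
      exact Γ.ptDist_le_diam hs hj ((Γ.next_le s π).2 hi)) n hs hj
  refine h1.trans ?_
  rw [add_mul, one_mul]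
  gcongr
  rw [mul_comm (_ * _) (Γ.ptDist j), ptDist, mass, Finset.sum_mul]
  refine Finset.sum_le_sum fun π _ => ?_
  refine mul_le_mul_of_nonneg_left ?_ (Set.indicator_nonneg (fun _ _ => Γ.weight_nonneg _) _)
  exact Γ.acc_allowed_le hM hk π n s

/-- The main bound. A cut that takes the closest center `j` away from the data point at diameter
`D` is harmless if `D ≤ dist(x, j)`, or if a center at distance at most `D / W` remains (by the crude
bound). Otherwise it is heavy, and a cut can be heavy only while the diameter drops by a factor
`2 W`. -/
lemma value_le_main {L : ℝ} (hL : 0 ≤ L)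
    (hcrude : ∀ (j : Fin k) (n : ℕ) (s : ChainState k), Valid s → j ∈ s.2 →
      Γ.value n s ≤ (1 + L) * Γ.ptDist j)
    (hwin : ∀ (π : α) (n : ℕ) (s : ChainState k), Γ.acc (fun s => (Γ.allowed s.1).indicator
        (fun _ => Γ.diam s.1 / Γ.mass (Γ.allowed s.1)) π) n s ≤ L)
    {M : ℕ} (hM : 2 * (1 + L) ^ 2 ≤ 2 ^ M) (j : Fin k) (n : ℕ) {s : ChainState k}
    (hs : Valid s) (hj : j ∈ s.2) :
    Γ.value n s ≤ (3 + 4 * M * (1 + 2 * Real.log k)) * Γ.ptDist j := by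
  classical
  set δ := Γ.ptDist j with hδ
  have hδ0 : 0 ≤ δ := Γ.ptDist_nonneg j
  set W : ℝ := (1 + L) ^ 2 with hW
  have hW0 : 0 < W := by positivity
  let heavy (π : α) (s : ChainState k) : Prop :=
    Valid s ∧ j ∈ s.2 ∧ δ < Γ.diam s.1 ∧ (∃ i ∈ s.2, π ∉ Γ.ptSep i) ∧
      ∀ i ∈ s.2, π ∉ Γ.ptSep i → Γ.diam s.1 / W < Γ.ptDist i
  let G (π : α) (s : ChainState k) : ℝ :=
    (if heavy π s then Γ.diam s.1 else 0) + (1 + L) / W * Γ.diam s.1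
  have h1 := Γ.value_le_charge (j := j) (b := 2 * δ) (by linarith) (G := G)
    (fun π s => by
      have := Γ.diam_nonneg s.1
      simp only [G]; split_ifs <;> positivity)
    (by
      intro s π hs hD hj hπ hnot n
      obtain ⟨hsep, ⟨i, hi, hiπ⟩, hnext⟩ := Γ.mem_ptSep_of_notMem_next hj hnot
      have hall : ∀ i ∈ (Γ.next s π).2, Γ.ptDist i ≤ δ + Γ.diam s.1 := fun i hi =>
        Γ.ptDist_le_diam hs hj ((Γ.next_le s π).2 hi)
      have hrest : 0 ≤ (1 + L) / W * Γ.diam s.1 := by positivity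
      by_cases hh : heavy π s
      · refine (Γ.value_le n (hs.next Γ π) hall).trans ?_
        simp only [G, hh, if_true]
        linarith
      · by_cases hDδ : Γ.diam s.1 ≤ δ
        · refine (Γ.value_le n (hs.next Γ π) hall).trans ?_
          simp only [G, hh, if_false]
          linarith
        · have : ∃ i ∈ s.2, π ∉ Γ.ptSep i ∧ Γ.ptDist i ≤ Γ.diam s.1 / W := by
            by_contra hc
            push Not at hc
            exact hh ⟨hs, hj, not_le.1 hDδ, ⟨i, hi, hiπ⟩, hc⟩
          obtain ⟨i, hi, hiπ, hle⟩ := this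
          refine (hcrude i n _ (hs.next Γ π) (by rw [hnext]; exact ⟨hi, hiπ⟩)).trans ?_
          simp only [G, hh, if_false]
          have := mul_le_mul_of_nonneg_left hle (by positivity : 0 ≤ 1 + L)
          have h3 : (1 + L) * (Γ.diam s.1 / W) = (1 + L) / W * Γ.diam s.1 := by ring
          linarith) n hs hj
  refine h1.trans ?_
  have hfin : ∑ π, (Γ.ptSep j).indicator Γ.weight π *
      Γ.acc (fun s => (Γ.allowed s.1).indicator
        (fun π => G π s / Γ.mass (Γ.allowed s.1)) π) n s ≤
      (1 + 4 * M * (1 + 2 * Real.log k)) * δ := by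
    rw [mul_comm, hδ, ptDist, mass, Finset.sum_mul]
    refine Finset.sum_le_sum fun π _ => ?_
    refine mul_le_mul_of_nonneg_left ?_ (Set.indicator_nonneg (fun _ _ => Γ.weight_nonneg _) _)
    have h2 := Γ.acc_window_le (p := heavy π) (M := M) (by
      rintro s s' hle ⟨-, -, -, -, hp⟩ ⟨hv, hj', hδ', ⟨i, hi, hiπ⟩, -⟩
      have h3 := hp i (hle.2 hi) hiπ
      have h4 := Γ.ptDist_le_diam hv hj' hi
      rw [div_lt_iff₀ hW0] at h3
      have h5 : Γ.ptDist i * W ≤ 2 * Γ.diam s'.1 * W := by gcongr; linarith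
      have h6 := mul_le_mul_of_nonneg_right hM (Γ.diam_nonneg s'.1)
      linarith) n s
    have h3 := hwin π n s
    have h4 : (1 + L) / W * L ≤ 1 := by
      rw [hW, div_mul_eq_mul_div, div_le_one (by positivity)]
      nlinarith
    calc Γ.acc (fun s => (Γ.allowed s.1).indicator
          (fun π => G π s / Γ.mass (Γ.allowed s.1)) π) n s
        ≤ Γ.acc (fun s => (if heavy π s then Γ.diam s.1 / Γ.mass (Γ.allowed s.1) else 0) +
            (1 + L) / W * (Γ.allowed s.1).indicator
              (fun _ => Γ.diam s.1 / Γ.mass (Γ.allowed s.1)) π) n s := by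
          refine Γ.acc_mono (fun s' _ => ?_) n
          have := Γ.diam_nonneg s'.1
          have := Γ.mass_nonneg (Γ.allowed s'.1)
          by_cases hπ : π ∈ Γ.allowed s'.1
          · simp only [Set.indicator_of_mem hπ, G, add_div]
            gcongr
            · split_ifs <;> simp
            · rw [mul_div_assoc]
          · simp only [Set.indicator_of_notMem hπ, mul_zero, add_zero]
            split_ifs <;> positivity
      _ = _ := by rw [acc_add, acc_mul]
      _ ≤ 4 * M * (1 + 2 * Real.log k) + (1 + L) / W * L := by
          refine add_le_add (le_trans (le_of_eq ?_) h2) (by gcongr)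
          congr!
      _ ≤ _ := by linarith
  linarith

/-- The approximation factor as a function of `M ≥ log₂ (2 (1 + L)²)`, where `1 + L` is the factor
of the crude bound. -/
lemma value_le_factor {M₀ M : ℕ} (hM₀ : k ^ 3 ≤ 2 ^ M₀)
    (hM : 2 * (1 + 4 * M₀ * (1 + 2 * Real.log k)) ^ 2 ≤ 2 ^ M) (j : Fin k) (n : ℕ)
    {s : ChainState k} (hs : Valid s) (hj : j ∈ s.2) :
    Γ.value n s ≤ (3 + 4 * M * (1 + 2 * Real.log k)) * Γ.ptDist j := by
  classical
  have hk : (0 : ℝ) < k := by exact_mod_cast j.pos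
  have hlog := Real.log_natCast_nonneg k
  refine Γ.value_le_main (L := 4 * M₀ * (1 + 2 * Real.log k)) (by positivity)
    (fun j n s hs hj => Γ.value_le_crude hM₀ j n hs hj) (fun π n s => ?_) hM j n hs hj
  exact Γ.acc_allowed_le hM₀ hk π n s

end CutSystem

/-- The factor of the main bound, with `M₀` and `M` chosen as small as possible up to constants, is
`O(log k · log log k)`. -/
lemma exists_factor_le : ∃ K : ℝ, 0 < K ∧ ∀ k : ℕ, 0 < k → ∃ M₀ M : ℕ, k ^ 3 ≤ 2 ^ M₀ ∧
    2 * (1 + 4 * M₀ * (1 + 2 * Real.log k)) ^ 2 ≤ 2 ^ M ∧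
      3 + 4 * M * (1 + 2 * Real.log k) ≤ K * approxFactor k := by
  have hlog3 : 1 < Real.log 3 := by
    rw [Real.lt_log_iff_exp_lt (by norm_num)]
    exact Real.exp_one_lt_d9.trans (by norm_num)
  set ε := Real.log (Real.log 3) with hε
  have hε0 : 0 < ε := Real.log_pos hlog3
  refine ⟨387 / ε + 396, by positivity, fun k hk => ?_⟩
  set l := Nat.log 2 k + 1 with hl
  set m := Nat.log 2 l + 1 with hm
  have hkl : k < 2 ^ l := Nat.lt_pow_succ_log_self (by norm_num) k
  have hlm : l < 2 ^ m := Nat.lt_pow_succ_log_self (by norm_num) l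
  have hlogk := Real.log_natCast_nonneg k
  have hl1 : (1 : ℝ) ≤ l := by rw [hl]; push_cast; linarith [(Nat.log 2 k).cast_nonneg (α := ℝ)]
  have hlog2 : Real.log 2 < 1 := by
    have := Real.log_two_lt_d9
    linarith
  have hlog2' : 1 / 2 < Real.log 2 := by
    have := Real.log_two_gt_d9
    linarith
  have hlogkl : Real.log k ≤ l := by
    have h1 : Real.log k ≤ Real.log (2 ^ l) := by
      apply Real.log_le_log (by exact_mod_cast hk)
      exact_mod_cast hkl.le
    rw [Real.log_pow] at h1
    nlinarith
  refine ⟨3 * l, 12 + 4 * m, ?_, ?_, ?_⟩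
  · rw [mul_comm, pow_mul]
    exact Nat.pow_le_pow_left hkl.le 3
  · have h1 : 1 + 4 * ((3 * l : ℕ) : ℝ) * (1 + 2 * Real.log k) ≤ 37 * (l : ℝ) ^ 2 := by
      push_cast
      nlinarith
    have h2 : (l : ℝ) ≤ 2 ^ m := by exact_mod_cast hlm.le
    have h0 : 0 ≤ 1 + 4 * ((3 * l : ℕ) : ℝ) * (1 + 2 * Real.log k) := by positivity
    calc 2 * (1 + 4 * ((3 * l : ℕ) : ℝ) * (1 + 2 * Real.log k)) ^ 2
        ≤ 2 * (37 * (l : ℝ) ^ 2) ^ 2 := by gcongr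
      _ = 2738 * (l : ℝ) ^ 4 := by ring
      _ ≤ 2 ^ 12 * ((2 : ℝ) ^ m) ^ 4 := by gcongr; norm_num
      _ = _ := by rw [← pow_mul, ← pow_add]; ring_nf
  · rcases Nat.lt_or_ge 2 k with h3 | h2
    · rw [approxFactor, if_neg (not_le.2 h3)]
      have hk3 : (3 : ℝ) ≤ k := by exact_mod_cast h3
      have hlk : Real.log 3 ≤ Real.log k := Real.log_le_log (by norm_num) hk3
      have hLL : ε ≤ Real.log (Real.log k) := Real.log_le_log (by linarith) hlk
      set LL := Real.log (Real.log k)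
      have hlogb (x : ℕ) (hx : 1 ≤ x) : (Nat.log 2 x : ℝ) ≤ 2 * Real.log x := by
        have h1 : ((2 ^ Nat.log 2 x : ℕ) : ℝ) ≤ x := by
          exact_mod_cast Nat.pow_log_le_self 2 (by omega)
        have h2 := Real.log_le_log (by positivity) h1
        push_cast at h2
        rw [Real.log_pow] at h2
        nlinarith [(Nat.log 2 x).cast_nonneg (α := ℝ)]
      have hl3 : (l : ℝ) ≤ 3 * Real.log k := by
        have := hlogb k hk
        rw [hl]; push_cast; linarith
      have hm1 : (m : ℝ) ≤ 5 + 2 * LL := by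
        have h1 := hlogb l (by omega)
        have h2 : Real.log l ≤ Real.log (3 * Real.log k) :=
          Real.log_le_log (by linarith) hl3
        rw [Real.log_mul (by norm_num) (by linarith)] at h2
        have h4 : Real.log 3 < 2 := by
          rw [Real.log_lt_iff_lt_exp (by norm_num)]
          have := Real.add_one_lt_exp (x := 2) (by norm_num)
          linarith
        rw [hm]; push_cast; linarith
      have hLL' : 387 ≤ 387 / ε * LL := by
        rw [div_mul_eq_mul_div, le_div_iff₀ hε0]
        linarith
      push_cast
      calc 3 + 4 * (12 + 4 * (m : ℝ)) * (1 + 2 * Real.log k)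
          ≤ 3 * Real.log k + 4 * (12 + 4 * (m : ℝ)) * (3 * Real.log k) := by
            gcongr <;> linarith
        _ = (147 + 48 * (m : ℝ)) * Real.log k := by ring
        _ ≤ ((387 / ε + 396) * LL) * Real.log k := by
            gcongr
            linarith
        _ = _ := by ring
    · rw [approxFactor, if_pos h2]
      have hl2 : l ≤ 2 := by
        have := Nat.log_mono_right (b := 2) h2
        have h4 : Nat.log 2 2 = 1 := Nat.log_pow (by norm_num) 1
        omega
      have hm2 : m ≤ 2 := by
        have := Nat.log_mono_right (b := 2) hl2
        have h4 : Nat.log 2 2 = 1 := Nat.log_pow (by norm_num) 1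
        omega
      have hm2' : (m : ℝ) ≤ 2 := by exact_mod_cast hm2
      have hlk : Real.log k ≤ 1 := by
        have := Real.log_le_log (by exact_mod_cast hk) (by exact_mod_cast h2 : (k : ℝ) ≤ 2)
        linarith
      have : 0 < 387 / ε := by positivity
      push_cast
      nlinarith

end ExplainableClustering

namespace ExplainableClustering

/-! ### Splitting the leaves of a tree -/

variable {d k n : ℕ}

lemma ThresholdTree.route_mem_leaves (T : ThresholdTree d) (x : Fin d → ℝ) :
    T.route x ∈ T.leaves := by
  induction T with
  | leaf => simp [route, leaves]
  | node i θ l r ihl ihr =>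
    by_cases h : x i ≤ θ <;> simp [route, leaves, h, ihl, ihr]

/-- Two points are in the same leaf after a split if and only if they were so before, and the cut
does not separate them or does not split their leaf. -/
lemma route_grow_eq_iff (w : Cut d) (S : Set (Fin d → ℝ)) (T : ThresholdTree d)
    (p q : Fin d → ℝ) :
    (grow w S T).route p = (grow w S T).route q ↔ T.route p = T.route q ∧
      ((∃ a ∈ S, T.route p = T.route a ∧ ¬ w.2 < a w.1) →
        (∃ b ∈ S, T.route p = T.route b ∧ w.2 < b w.1) → (w.2 < p w.1 ↔ w.2 < q w.1)) := by
  induction T generalizing S with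
  | leaf =>
    simp only [grow, ThresholdTree.route, true_and]
    split_ifs with h
    · obtain ⟨h1, h2⟩ := h
      simp only [not_lt, h1, h2, forall_const]
      by_cases hp : p w.1 ≤ w.2 <;> by_cases hq : q w.1 ≤ w.2 <;>
        simp [ThresholdTree.route, hp, hq, ← not_le]
    · simp only [ThresholdTree.route, true_iff, not_lt]
      exact fun h1 h2 => absurd ⟨h1, h2⟩ h
  | node i θ l r ihl ihr =>
    by_cases hp : p i ≤ θ <;> by_cases hq : q i ≤ θ
    · simp only [grow, ThresholdTree.route, hp, hq, if_true, List.cons.injEq, true_and]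
      rw [ihl]
      have (P : (Fin d → ℝ) → Prop) : (∃ a ∈ {x ∈ S | x i ≤ θ}, l.route p = l.route a ∧ P a) ↔
          ∃ a ∈ S, (false :: l.route p = if a i ≤ θ then false :: l.route a else true :: r.route a)
            ∧ P a := by
        constructor
        · rintro ⟨a, ⟨ha, hle⟩, h1, h2⟩
          exact ⟨a, ha, by simp [hle, h1], h2⟩
        · rintro ⟨a, ha, h1, h2⟩
          by_cases hle : a i ≤ θ
          · exact ⟨a, ⟨ha, hle⟩, by simpa [hle] using h1, h2⟩
          · simp [hle] at h1
      rw [this, this]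
    · simp [grow, ThresholdTree.route, hp, hq]
    · simp [grow, ThresholdTree.route, hp, hq]
    · simp only [grow, ThresholdTree.route, hp, hq, if_false, List.cons.injEq, true_and]
      rw [ihr]
      have (P : (Fin d → ℝ) → Prop) : (∃ a ∈ {x ∈ S | θ < x i}, r.route p = r.route a ∧ P a) ↔
          ∃ a ∈ S, (true :: r.route p = if a i ≤ θ then false :: l.route a else true :: r.route a)
            ∧ P a := by
        constructor
        · rintro ⟨a, ⟨ha, hle⟩, h1, h2⟩
          exact ⟨a, ha, by simp [not_le.2 hle, h1], h2⟩
        · rintro ⟨a, ha, h1, h2⟩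
          by_cases hle : a i ≤ θ
          · simp [hle] at h1
          · exact ⟨a, ⟨ha, not_le.1 hle⟩, by simpa [hle] using h1, h2⟩
      rw [this, this]

/-- No leaf is empty after a split if none was empty before. -/
lemma exists_mem_route_grow (w : Cut d) {S : Set (Fin d → ℝ)} {T : ThresholdTree d}
    (h : ∀ v ∈ T.leaves, ∃ a ∈ S, T.route a = v) :
    ∀ v ∈ (grow w S T).leaves, ∃ a ∈ S, (grow w S T).route a = v := by
  induction T generalizing S with
  | leaf =>
    simp only [grow]
    split_ifs with hs
    · obtain ⟨⟨a, ha, h1⟩, ⟨b, hb, h2⟩⟩ := hs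
      simp only [ThresholdTree.leaves, Finset.image_singleton, Finset.mem_union,
        Finset.mem_singleton, ThresholdTree.route]
      rintro v (rfl | rfl)
      · exact ⟨a, ha, by simp [h1]⟩
      · exact ⟨b, hb, by simp [not_le.2 h2]⟩
    · exact h
  | node i θ l r ihl ihr =>
    simp only [grow, ThresholdTree.leaves, Finset.mem_union, Finset.mem_image] at *
    rintro v (⟨v, hv, rfl⟩ | ⟨v, hv, rfl⟩)
    · obtain ⟨a, ⟨ha, hle⟩, h1⟩ := ihl (S := {x ∈ S | x i ≤ θ}) (fun v hv => by
        obtain ⟨a, ha, h1⟩ := h _ (Or.inl ⟨v, hv, rfl⟩)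
        by_cases hle : a i ≤ θ
        · exact ⟨a, ⟨ha, hle⟩, by simpa [ThresholdTree.route, hle] using h1⟩
        · simp [ThresholdTree.route, hle] at h1) v hv
      exact ⟨a, ha, by simp [ThresholdTree.route, hle, h1]⟩
    · obtain ⟨a, ⟨ha, hle⟩, h1⟩ := ihr (S := {x ∈ S | θ < x i}) (fun v hv => by
        obtain ⟨a, ha, h1⟩ := h _ (Or.inr ⟨v, hv, rfl⟩)
        by_cases hle : a i ≤ θ
        · simp [ThresholdTree.route, hle] at h1
        · exact ⟨a, ⟨ha, not_le.1 hle⟩, by simpa [ThresholdTree.route, hle] using h1⟩) v hv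
      exact ⟨a, ha, by simp [ThresholdTree.route, not_le.2 hle, h1]⟩

/-- A cut that splits no leaf does not change the tree. -/
lemma grow_eq_self {w : Cut d} {S : Set (Fin d → ℝ)} {T : ThresholdTree d}
    (h : ∀ a ∈ S, ∀ b ∈ S, T.route a = T.route b → (w.2 < a w.1 ↔ w.2 < b w.1)) :
    grow w S T = T := by
  induction T generalizing S with
  | leaf =>
    rw [grow, if_neg]
    rintro ⟨⟨a, ha, h1⟩, ⟨b, hb, h2⟩⟩
    exact absurd ((h a ha b hb rfl).2 h2) (not_lt.2 h1)
  | node i θ l r ihl ihr =>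
    rw [grow, ihl, ihr]
    · rintro a ⟨ha, h1⟩ b ⟨hb, h2⟩ h3
      exact h a ha b hb (by simp [ThresholdTree.route, not_le.2 h1, not_le.2 h2, h3])
    · rintro a ⟨ha, h1⟩ b ⟨hb, h2⟩ h3
      exact h a ha b hb (by simp [ThresholdTree.route, show a i ≤ θ from h1, show b i ≤ θ from h2, h3])

lemma exists_route_treeAt (hk : 0 < k) (c : Fin k → Fin d → ℝ) (w : ℕ → Cut d) (t : ℕ) :
    ∀ v ∈ (treeAt c w t).leaves, ∃ j, (treeAt c w t).route (c j) = v := by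
  have : ∀ v ∈ (treeAt c w t).leaves, ∃ a ∈ Set.range c, (treeAt c w t).route a = v := by
    induction t with
    | zero =>
      simp only [treeAt, ThresholdTree.leaves, Finset.mem_singleton, ThresholdTree.route]
      rintro v rfl
      exact ⟨_, ⟨⟨0, hk⟩, rfl⟩, rfl⟩
    | succ t ih => exact exists_mem_route_grow _ ih
  intro v hv
  obtain ⟨_, ⟨j, rfl⟩, h⟩ := this v hv
  exact ⟨j, h⟩

lemma treeAt_congr (c : Fin k → Fin d → ℝ) {w w' : ℕ → Cut d} {t : ℕ}
    (h : ∀ s < t, w s = w' s) : treeAt c w t = treeAt c w' t := by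
  induction t with
  | zero => rfl
  | succ t ih => rw [treeAt, treeAt, ih fun s hs => h s (by omega), h t (by omega)]

lemma Separated.grow_eq {c : Fin k → Fin d → ℝ} {T : ThresholdTree d} (h : Separated c T)
    (w : Cut d) : grow w (Set.range c) T = T := by
  refine grow_eq_self ?_
  rintro _ ⟨i, rfl⟩ _ ⟨j, rfl⟩ hij
  rw [h i j hij]

lemma Separated.treeAt_eq {c : Fin k → Fin d → ℝ} {w : ℕ → Cut d} {t : ℕ}
    (h : Separated c (treeAt c w t)) {t' : ℕ} (ht : t ≤ t') :
    treeAt c w t' = treeAt c w t := by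
  induction t', ht using Nat.le_induction with
  | base => rfl
  | succ t' _ ih => rw [treeAt, ih, h.grow_eq]

/-- After the loop has stopped, the tree does not change any more. -/
lemma output_eq {c : Fin k → Fin d → ℝ} {w : ℕ → Cut d} {t : ℕ}
    (h : Separated c (treeAt c w t)) : output c w = treeAt c w t := by
  have h1 : Separated c (treeAt c w (sInf {t | Separated c (treeAt c w t)})) :=
    Nat.sInf_mem (s := {t | Separated c (treeAt c w t)}) ⟨t, h⟩
  exact (h1.treeAt_eq (Nat.sInf_le h)).symm

/-! ### Leaves and centers -/

/-- A cut that separates two unseparated centers increases the number of the leaves. -/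
lemma card_route_grow_lt {c : Fin k → Fin d → ℝ} {T : ThresholdTree d} {w : Cut d}
    (h : w ∈ setA c T) :
    (Finset.univ.image fun j => T.route (c j)).card <
      (Finset.univ.image fun j => (grow w (Set.range c) T).route (c j)).card := by
  classical
  set T' := grow w (Set.range c) T
  have href : ∀ i j, T'.route (c i) = T'.route (c j) → T.route (c i) = T.route (c j) :=
    fun i j hij => ((route_grow_eq_iff _ _ _ _ _).1 hij).1
  simp only [setA, Set.mem_iUnion] at h
  obtain ⟨⟨i, j⟩, hE, hsep⟩ := h
  simp only [unsepPairs, sepCuts, Set.mem_ofPred_eq] at hE hsep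
  have hij : T'.route (c i) ≠ T'.route (c j) := by
    intro hij
    refine hsep (((route_grow_eq_iff _ _ _ _ _).1 hij).2 ?_ ?_)
    · by_cases hi : w.2 < c i w.1
      · exact ⟨c j, ⟨j, rfl⟩, hE, by tauto⟩
      · exact ⟨c i, ⟨i, rfl⟩, rfl, hi⟩
    · by_cases hi : w.2 < c i w.1
      · exact ⟨c i, ⟨i, rfl⟩, rfl, hi⟩
      · exact ⟨c j, ⟨j, rfl⟩, hE, by tauto⟩
  -- otherwise the leaves would correspond to each other one-to-one
  by_contra hle
  have hsub : ∃ g : List Bool → List Bool, ∀ l, g (T'.route (c l)) = T.route (c l) := by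
    refine ⟨fun v => if hv : ∃ l, T'.route (c l) = v then T.route (c hv.choose) else [], ?_⟩
    intro l
    have hv : ∃ l', T'.route (c l') = T'.route (c l) := ⟨l, rfl⟩
    beta_reduce
    rw [dif_pos hv]
    exact href _ _ hv.choose_spec
  obtain ⟨g, hg⟩ := hsub
  have himg : (Finset.univ.image fun j => T.route (c j)) =
      (Finset.univ.image fun j => T'.route (c j)).image g := by
    rw [Finset.image_image]
    exact Finset.image_congr fun l _ => (hg l).symm
  have hcard : ((Finset.univ.image fun j => T'.route (c j)).image g).card =
      (Finset.univ.image fun j => T'.route (c j)).card := by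
    refine le_antisymm Finset.card_image_le ?_
    rw [← himg]; exact not_lt.1 hle
  have hinj := Finset.card_image_iff.1 hcard
  exact hij (hinj (by simp) (by simp) (by rw [hg, hg]; exact hE))

/-- If each cut separates an unseparated pair as long as there is one, then the centers are
separated after at most `k - 1` steps. -/
lemma exists_separated (hk : 0 < k) (c : Fin k → Fin d → ℝ) {w : ℕ → Cut d}
    (h : ∀ t, ¬ Separated c (treeAt c w t) → w t ∈ setA c (treeAt c w t)) :
    ∃ t ≤ k - 1, Separated c (treeAt c w t) := by
  classical
  by_contra hc
  push Not at hc
  have hcard : ∀ t ≤ k, t + 1 ≤ (Finset.univ.image fun j => (treeAt c w t).route (c j)).card ∨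
      t = k := by
    intro t ht
    induction t with
    | zero =>
      left
      exact Finset.card_pos.2 ⟨_, Finset.mem_image_of_mem _ (Finset.mem_univ (⟨0, hk⟩ : Fin k))⟩
    | succ t ih =>
      rcases ih (by omega) with h1 | h1
      · left
        exact h1.trans_lt (card_route_grow_lt (h t (hc t (by omega))))
      · omega
  rcases hcard (k - 1) (by omega) with h1 | h1
  · refine hc (k - 1) le_rfl fun i j hij => ?_
    have h2 : (Finset.univ.image fun j => (treeAt c w (k - 1)).route (c j)).card =
        (Finset.univ : Finset (Fin k)).card := by
      refine le_antisymm Finset.card_image_le ?_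
      rw [Finset.card_univ, Fintype.card_fin]; omega
    rw [Finset.card_image_iff.1 h2 (by simp) (by simp) hij]
  · omega

lemma Separated.existsUnique_route {c : Fin k → Fin d → ℝ} (hc : Function.Injective c) (hk : 0 < k)
    {w : ℕ → Cut d} {t : ℕ} (h : Separated c (treeAt c w t)) :
    ∀ v ∈ (treeAt c w t).leaves, ∃! j, (treeAt c w t).route (c j) = v := by
  intro v hv
  obtain ⟨j, hj⟩ := exists_route_treeAt hk c w t v hv
  exact ⟨j, hj, fun i hi => hc (h i j (hi.trans hj.symm))⟩

lemma Separated.card_leaves {c : Fin k → Fin d → ℝ} (hc : Function.Injective c) (hk : 0 < k)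
    {w : ℕ → Cut d} {t : ℕ} (h : Separated c (treeAt c w t)) :
    (treeAt c w t).leaves.card = k := by
  classical
  have : (treeAt c w t).leaves = Finset.univ.image fun j => (treeAt c w t).route (c j) := by
    ext v
    simp only [Finset.mem_image, Finset.mem_univ, true_and]
    constructor
    · exact exists_route_treeAt hk c w t v
    · rintro ⟨j, rfl⟩
      exact ThresholdTree.route_mem_leaves _ _
  rw [this, Finset.card_image_of_injective, Finset.card_univ, Fintype.card_fin]
  exact fun i j hij => hc (h i j hij)

/-! ### The cost of a tree -/

lemma l1Dist_nonneg (x y : Fin d → ℝ) : 0 ≤ l1Dist x y := Finset.sum_nonneg fun _ _ => abs_nonneg _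

lemma bddBelow_cost (X : Fin n → Fin d → ℝ) (p : Fin n → Prop) [DecidablePred p] :
    BddBelow (Set.range fun y : Fin d → ℝ => ∑ a with p a, l1Dist (X a) y) :=
  ⟨0, by rintro _ ⟨y, rfl⟩; exact Finset.sum_nonneg fun _ _ => l1Dist_nonneg _ _⟩

/-- Distributing the cost of each cluster evenly over its points. The cost is determined by the
partition of the data set. -/
lemma ThresholdTree.cost_eq (T : ThresholdTree d) (X : Fin n → Fin d → ℝ) :
    T.cost X = ∑ a, (⨅ y : Fin d → ℝ, ∑ b with T.route (X b) = T.route (X a), l1Dist (X b) y) /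
      (Finset.univ.filter fun b => T.route (X b) = T.route (X a)).card := by
  classical
  rw [cost, ← Finset.sum_fiberwise_of_maps_to (s := Finset.univ) (t := T.leaves)
    (g := fun a => T.route (X a)) (fun a _ => T.route_mem_leaves _)]
  refine Finset.sum_congr rfl fun v _ => ?_
  rw [Finset.sum_congr rfl (g := fun _ => (⨅ y : Fin d → ℝ, ∑ b with T.route (X b) = v,
      l1Dist (X b) y) / (Finset.univ.filter fun b => T.route (X b) = v).card) (by
    intro a ha
    rw [(Finset.mem_filter.1 ha).2]), Finset.sum_const, nsmul_eq_mul]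
  rcases (Finset.univ.filter fun b => T.route (X b) = v).eq_empty_or_nonempty with h | h
  · simp [h]
  · rw [mul_div_cancel₀]
    exact_mod_cast h.card_pos.ne'

/-- If each leaf contains exactly one center, then this center can serve as the center of the
cluster. -/
lemma cost_le_sum {T : ThresholdTree d} (X : Fin n → Fin d → ℝ) {c : Fin k → Fin d → ℝ}
    (h : ∀ v ∈ T.leaves, ∃! j, T.route (c j) = v) :
    T.cost X ≤ ∑ a, sInf ((fun j => l1Dist (X a) (c j)) '' {j | T.route (X a) = T.route (c j)}) := by
  classical
  rw [ThresholdTree.cost, ← Finset.sum_fiberwise_of_maps_to (s := Finset.univ) (t := T.leaves)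
    (g := fun a => T.route (X a)) (fun a _ => T.route_mem_leaves _)]
  refine Finset.sum_le_sum fun v hv => ?_
  obtain ⟨j, hj, hu⟩ := h v hv
  refine (ciInf_le (bddBelow_cost X _) (c j)).trans (Finset.sum_le_sum fun a ha => ?_)
  have ha' : T.route (X a) = v := (Finset.mem_filter.1 ha).2
  have : {j | T.route (X a) = T.route (c j)} = {j} := by
    ext i
    rw [ha']
    exact ⟨fun hi => hu i hi.symm, fun hi => by rw [Set.mem_singleton_iff.1 hi]; exact hj.symm⟩
  rw [this, Set.image_singleton, csInf_singleton]

/-! ### The measure of the separating cuts -/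

lemma measurableSet_sepCuts (x y : Fin d → ℝ) : MeasurableSet (sepCuts x y) := by
  have (z : Fin d → ℝ) : MeasurableSet {w : Cut d | w.2 < z w.1} :=
    measurableSet_lt measurable_snd ((measurable_of_countable z).comp measurable_fst)
  exact ((this x).iff (this y)).compl

lemma cutMeasure_apply {S : Set (Cut d)} (hS : MeasurableSet S) :
    cutMeasure d S = ∑ i, volume (Prod.mk i ⁻¹' S) := by
  rw [cutMeasure, Measure.finsetSum_apply]
  exact Finset.sum_congr rfl fun i _ => Measure.map_apply measurable_prodMk_left hS

lemma cutMeasure_sepCuts (x y : Fin d → ℝ) :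
    cutMeasure d (sepCuts x y) = ENNReal.ofReal (l1Dist x y) := by
  rw [cutMeasure_apply (measurableSet_sepCuts x y), l1Dist,
    ENNReal.ofReal_sum_of_nonneg fun _ _ => abs_nonneg _]
  refine Finset.sum_congr rfl fun i _ => ?_
  have : Prod.mk i ⁻¹' sepCuts x y = Set.Ico (min (x i) (y i)) (max (x i) (y i)) := by
    ext θ
    simp only [sepCuts, Set.mem_preimage, Set.mem_ofPred_eq, Set.mem_Ico, ← not_lt (a := θ),
      lt_min_iff, lt_max_iff]
    tauto
  rw [this, Real.volume_Ico, max_sub_min_eq_abs, abs_sub_comm]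

end ExplainableClustering

namespace ExplainableClustering

variable {d k n : ℕ}

/-! ### Patterns of cuts and partitions of the points -/

/-- The data points and the centers, as one family. -/
def points (X : Fin n → Fin d → ℝ) (c : Fin k → Fin d → ℝ) : Fin n ⊕ Fin k → Fin d → ℝ :=
  Sum.elim X c

/-- The side of the cut `w` on which each data point and each center lies. -/
def pattern (X : Fin n → Fin d → ℝ) (c : Fin k → Fin d → ℝ) (w : Cut d) : Fin n ⊕ Fin k → Prop :=
  fun p => w.2 < points X c p w.1

/-- The partition of the data points and the centers into the leaves of a tree, as a relation. -/
def leafRel (X : Fin n → Fin d → ℝ) (c : Fin k → Fin d → ℝ) (T : ThresholdTree d) :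
    Fin n ⊕ Fin k → Fin n ⊕ Fin k → Prop :=
  fun p q => T.route (points X c p) = T.route (points X c q)

/-- The partition after a cut with the pattern `π`, if the partition was `σ`. -/
def stepRel (σ : Fin n ⊕ Fin k → Fin n ⊕ Fin k → Prop) (π : Fin n ⊕ Fin k → Prop) :
    Fin n ⊕ Fin k → Fin n ⊕ Fin k → Prop :=
  fun p q => σ p q ∧ ((∃ a, σ p (.inr a) ∧ ¬ π (.inr a)) → (∃ b, σ p (.inr b) ∧ π (.inr b)) →
    (π p ↔ π q))

lemma leafRel_grow (X : Fin n → Fin d → ℝ) (c : Fin k → Fin d → ℝ) (T : ThresholdTree d)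
    (w : Cut d) :
    leafRel X c (grow w (Set.range c) T) = stepRel (leafRel X c T) (pattern X c w) := by
  ext p q
  simp only [leafRel, stepRel, pattern, route_grow_eq_iff, Set.exists_range_iff, points,
    Sum.elim_inr]

lemma measurable_pattern (X : Fin n → Fin d → ℝ) (c : Fin k → Fin d → ℝ) :
    Measurable (pattern X c) := by
  refine measurable_pi_lambda _ fun p => measurableSet_setOfPred.1 ?_
  exact measurableSet_lt measurable_snd ((measurable_of_countable _).comp measurable_fst)

lemma measurable_leafRel_treeAt {Ω : Type*} [MeasurableSpace Ω] (X : Fin n → Fin d → ℝ)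
    (c : Fin k → Fin d → ℝ) {ω : ℕ → Ω → Cut d} {t : ℕ} (hω : ∀ s < t, Measurable (ω s)) :
    Measurable fun a => leafRel X c (treeAt c (fun s => ω s a) t) := by
  induction t with
  | zero =>
    simp only [treeAt]
    exact measurable_const
  | succ t ih =>
    simp only [treeAt, leafRel_grow]
    exact (Measurable.of_discrete (f := fun z : (Fin n ⊕ Fin k → Fin n ⊕ Fin k → Prop) ×
      (Fin n ⊕ Fin k → Prop) => stepRel z.1 z.2)).comp
        ((ih fun s hs => hω s (by omega)).prodMk
          ((measurable_pattern X c).comp (hω t (by omega))))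

/-! ### The finite model of the data -/

/-- The cut chain of the data point `a`: a class of cuts consists of the cuts with a given
pattern. (Patterns of infinite measure separate no points, and get the weight `0`.) -/
def cutSystem (X : Fin n → Fin d → ℝ) (c : Fin k → Fin d → ℝ) (a : Fin n) :
    CutSystem k (Fin n ⊕ Fin k → Prop) where
  weight π := (cutMeasure d).real (pattern X c ⁻¹' {π})
  weight_nonneg _ := measureReal_nonneg
  side π j := π (.inr j)
  ptSide π := π (.inl a)

/-- The state of the cut chain for a partition of the points. -/
def relState (a : Fin n) (σ : Fin n ⊕ Fin k → Fin n ⊕ Fin k → Prop) : ChainState k :=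
  ({q | σ (.inr q.1) (.inr q.2)}, {j | σ (.inl a) (.inr j)})

variable (X : Fin n → Fin d → ℝ) (c : Fin k → Fin d → ℝ) (a : Fin n)

lemma relState_leafRel (T : ThresholdTree d) :
    relState a (leafRel X c T) = (unsepPairs c T, {j | T.route (X a) = T.route (c j)}) := rfl

/-- The finite model represents the measure faithfully, where it is finite. -/
lemma mass_eq {Q : Set (Fin n ⊕ Fin k → Prop)} (hQ : cutMeasure d (pattern X c ⁻¹' Q) ≠ ⊤) :
    (cutSystem X c a).mass Q = (cutMeasure d).real (pattern X c ⁻¹' Q) := by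
  classical
  have h1 : pattern X c ⁻¹' Q = ⋃ π ∈ Q.toFinset, pattern X c ⁻¹' {π} := by
    ext w; simp
  have hfin : ∀ π ∈ Q.toFinset, cutMeasure d (pattern X c ⁻¹' {π}) ≠ ⊤ := by
    intro π hπ
    refine ne_top_of_le_ne_top hQ (measure_mono (Set.preimage_mono ?_))
    simpa using hπ
  rw [h1, measureReal_biUnion_finset (h := hfin)]
  · rw [CutSystem.mass, ← Finset.sum_subset (Finset.subset_univ Q.toFinset)]
    · refine Finset.sum_congr rfl fun π hπ => ?_
      rw [Set.indicator_of_mem (Set.mem_toFinset.1 hπ)]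
      rfl
    · intro π _ hπ
      exact Set.indicator_of_notMem (fun h => hπ (Set.mem_toFinset.2 h)) _
  · intro π _ π' _ hne
    exact Disjoint.preimage _ (Set.disjoint_singleton.2 hne)
  · exact fun π _ => measurable_pattern X c (measurableSet_singleton π)

lemma dist_cutSystem (q : Fin k × Fin k) :
    (cutSystem X c a).dist q = l1Dist (c q.1) (c q.2) := by
  have h : cutMeasure d (pattern X c ⁻¹' (cutSystem X c a).sep q) =
      ENNReal.ofReal (l1Dist (c q.1) (c q.2)) := cutMeasure_sepCuts _ _
  rw [CutSystem.dist, mass_eq X c a (by rw [h]; exact ENNReal.ofReal_ne_top), measureReal_def, h,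
    ENNReal.toReal_ofReal (l1Dist_nonneg _ _)]

lemma ptDist_cutSystem (j : Fin k) :
    (cutSystem X c a).ptDist j = l1Dist (X a) (c j) := by
  have h : cutMeasure d (pattern X c ⁻¹' (cutSystem X c a).ptSep j) =
      ENNReal.ofReal (l1Dist (X a) (c j)) := cutMeasure_sepCuts _ _
  rw [CutSystem.ptDist, mass_eq X c a (by rw [h]; exact ENNReal.ofReal_ne_top), measureReal_def, h,
    ENNReal.toReal_ofReal (l1Dist_nonneg _ _)]

lemma diam_unsepPairs (T : ThresholdTree d) :
    (cutSystem X c a).diam (unsepPairs c T) = maxDist c T := by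
  rw [CutSystem.diam, maxDist, funext (dist_cutSystem X c a)]

lemma maxDist_nonneg (T : ThresholdTree d) : 0 ≤ maxDist c T :=
  Real.sSup_nonneg (by rintro _ ⟨q, -, rfl⟩; exact l1Dist_nonneg _ _)

lemma mem_setB_iff (T : ThresholdTree d) (w : Cut d) : w ∈ setB c T ↔
    ∃ q ∈ unsepPairs c T, w ∈ sepCuts (c q.1) (c q.2) ∧
      l1Dist (c q.1) (c q.2) ≤ maxDist c T / (k : ℝ) ^ 3 := by
  have := maxDist_nonneg c T
  simp only [setB, cutMeasure_sepCuts, Set.mem_iUnion, Set.mem_ofPred_eq, exists_prop,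
    ENNReal.ofReal_le_ofReal_iff (show 0 ≤ maxDist c T / (k : ℝ) ^ 3 by positivity)]
  constructor
  · rintro ⟨q, ⟨h1, h2⟩, h3⟩; exact ⟨q, h1, h3, h2⟩
  · rintro ⟨q, h1, h3, h2⟩; exact ⟨q, ⟨h1, h2⟩, h3⟩

lemma mem_setR_iff (T : ThresholdTree d) (w : Cut d) : w ∈ setR c T ↔
    (∃ q ∈ unsepPairs c T, w ∈ sepCuts (c q.1) (c q.2)) ∧
      ∀ q ∈ unsepPairs c T, w ∈ sepCuts (c q.1) (c q.2) →
        maxDist c T / (k : ℝ) ^ 3 < l1Dist (c q.1) (c q.2) := by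
  rw [setR, Set.mem_sdiff, mem_setB_iff, setA]
  simp only [Set.mem_iUnion, exists_prop, not_exists, not_and, not_le]

lemma setR_eq (T : ThresholdTree d) :
    setR c T = pattern X c ⁻¹' (cutSystem X c a).allowed (unsepPairs c T) := by
  ext w
  rw [mem_setR_iff]
  simp only [Set.mem_preimage, CutSystem.allowed, Set.mem_ofPred_eq, dist_cutSystem,
    diam_unsepPairs]
  rfl

lemma measurableSet_setA (T : ThresholdTree d) : MeasurableSet (setA c T) :=
  MeasurableSet.biUnion (Set.to_countable _) fun _ _ => measurableSet_sepCuts _ _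

lemma measurableSet_setR (T : ThresholdTree d) : MeasurableSet (setR c T) :=
  (measurableSet_setA c T).diff
    (MeasurableSet.biUnion (Set.to_countable _) fun _ _ => measurableSet_sepCuts _ _)

lemma cutMeasure_setR_ne_top (T : ThresholdTree d) : cutMeasure d (setR c T) ≠ ⊤ := by
  refine ne_top_of_le_ne_top ?_ (measure_mono Set.sdiff_subset)
  refine (measure_biUnion_lt_top (Set.toFinite _) fun q _ => ?_).ne
  rw [cutMeasure_sepCuts]
  exact ENNReal.ofReal_lt_top

lemma l1Dist_eq_zero {x y : Fin d → ℝ} : l1Dist x y = 0 ↔ x = y := by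
  rw [l1Dist, Finset.sum_eq_zero_iff_of_nonneg fun _ _ => abs_nonneg _]
  simp [sub_eq_zero, funext_iff]

lemma maxDist_eq_zero_iff (T : ThresholdTree d) : maxDist c T = 0 ↔ Separated c T := by
  constructor
  · intro h i j hij
    have : l1Dist (c i) (c j) ≤ maxDist c T :=
      le_csSup (Set.toFinite _).bddAbove ⟨(i, j), hij, rfl⟩
    exact l1Dist_eq_zero.1 (le_antisymm (h ▸ this) (l1Dist_nonneg _ _))
  · intro h
    refine le_antisymm (Real.sSup_le ?_ le_rfl) (maxDist_nonneg c T)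
    rintro _ ⟨⟨i, j⟩, hij, rfl⟩
    exact (l1Dist_eq_zero.2 (h i j hij)).le

lemma cutMeasure_setR_pos {T : ThresholdTree d} (h : ¬ Separated c T) :
    cutMeasure d (setR c T) ≠ 0 := by
  -- the data points play no role here
  let X₀ : Fin 1 → Fin d → ℝ := fun _ _ => 0
  have h0 : 0 < (cutSystem X₀ c 0).diam (unsepPairs c T) := by
    rw [diam_unsepPairs]
    exact (maxDist_nonneg c T).lt_of_ne fun h0 => h ((maxDist_eq_zero_iff c T).1 h0.symm)
  have h1 := (cutSystem X₀ c 0).mass_allowed_pos h0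
  have h2 := cutMeasure_setR_ne_top c T
  rw [setR_eq X₀ c 0] at h2 ⊢
  rw [mass_eq X₀ c 0 h2, measureReal_def] at h1
  exact fun h3 => by simp [h3] at h1

lemma relState_grow (T : ThresholdTree d) (w : Cut d) :
    relState a (leafRel X c (grow w (Set.range c) T)) =
      (cutSystem X c a).next (relState a (leafRel X c T)) (pattern X c w) := by
  classical
  rw [leafRel_grow]
  have hrefl : ∀ p, leafRel X c T p p := fun p => rfl
  generalize leafRel X c T = σ at *
  generalize pattern X c w = π
  simp only [relState, stepRel, CutSystem.next, CutSystem.sep, CutSystem.ptSep, cutSystem,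
    Set.mem_ofPred_eq, not_not, Prod.mk.injEq]
  constructor
  · ext ⟨i, j⟩
    simp only [Set.mem_ofPred_eq]
    refine and_congr_right fun hij => ⟨fun h => ?_, fun h _ _ => h⟩
    by_cases hi : π (.inr i) <;> by_cases hj : π (.inr j) <;> simp only [hi, hj, iff_self]
    · have := h ⟨j, hij, hj⟩ ⟨i, hrefl _, hi⟩
      tauto
    · have := h ⟨i, hrefl _, hi⟩ ⟨j, hij, hj⟩
      tauto
  · split_ifs with h
    · obtain ⟨i, hi, hπ⟩ := h
      ext j
      simp only [Set.mem_ofPred_eq]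
      refine and_congr_right fun hj => ⟨fun h => ?_, fun h _ _ => h⟩
      by_contra hc
      refine hc (h ?_ ?_)
      · by_cases hx : π (.inr i)
        · exact ⟨j, hj, by tauto⟩
        · exact ⟨i, hi, hx⟩
      · by_cases hx : π (.inr i)
        · exact ⟨i, hi, hx⟩
        · exact ⟨j, hj, by tauto⟩
    · push Not at h
      ext j
      simp only [Set.mem_ofPred_eq, and_iff_left_iff_imp]
      rintro hj ⟨i, hi, h1⟩ ⟨i', hi', h2⟩
      have := h i hi
      have := h i' hi'
      tauto

/-- The cost is a function of the partition of the points. -/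
lemma exists_cost_eq : ∃ g : (Fin n ⊕ Fin k → Fin n ⊕ Fin k → Prop) → ℝ,
    ∀ T : ThresholdTree d, T.cost X = g (leafRel X c T) := by
  have : Function.FactorsThrough (fun T : ThresholdTree d => T.cost X) (leafRel X c) := by
    intro T T' h
    beta_reduce
    rw [ThresholdTree.cost_eq, ThresholdTree.cost_eq]
    refine Finset.sum_congr rfl fun a _ => ?_
    have : (Finset.univ.filter fun b => T.route (X b) = T.route (X a)) =
        Finset.univ.filter fun b => T'.route (X b) = T'.route (X a) :=
      Finset.filter_congr fun b _ => iff_of_eq (congrFun (congrFun h (.inl b)) (.inl a))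
    rw [this]
  obtain ⟨g, hg⟩ := (Function.factorsThrough_iff _).1 this
  exact ⟨g, fun T => congrFun hg T⟩

/-! ### The distribution of the run -/

section run

variable {Ω : Type*} [MeasurableSpace Ω] {P : Measure Ω}
  {ω : ℕ → Ω → Cut d} {X c}

/-- The conditional distribution of the next cut, given the partition of the points. -/
lemma IsRun.measure_leafRel_inter (hω : IsRun c P ω) (X : Fin n → Fin d → ℝ) (t : ℕ)
    {T : ThresholdTree d} (hT : ¬ Separated c T) {S : Set (Cut d)} (hS : MeasurableSet S) :
    P {x | leafRel X c (treeAt c (fun s => ω s x) t) = leafRel X c T ∧ ω t x ∈ S} =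
      (cutMeasure d)[|setR c T] S *
        P {x | leafRel X c (treeAt c (fun s => ω s x) t) = leafRel X c T} := by
  -- extend a history by the cut chosen at time `0`, which is not used
  have hsep (T' : ThresholdTree d) (h : leafRel X c T' = leafRel X c T) :
      unsepPairs c T' = unsepPairs c T := by
    ext ⟨i, j⟩
    exact iff_of_eq (congrFun (congrFun h (.inr i)) (.inr j))
  have hSep (T' : ThresholdTree d) (h : leafRel X c T' = leafRel X c T) : ¬ Separated c T' := by
    rw [← maxDist_eq_zero_iff, maxDist, hsep T' h, ← maxDist, maxDist_eq_zero_iff]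
    exact hT
  have hR (T' : ThresholdTree d) (h : leafRel X c T' = leafRel X c T) :
      setR c T' = setR c T := by
    ext w
    rw [mem_setR_iff, mem_setR_iff, maxDist, hsep T' h, ← maxDist]
  obtain ⟨i₀, -⟩ : ∃ i : Fin d, True := by
    by_contra hc
    refine hT fun i j _ => funext fun x => absurd ⟨x, trivial⟩ hc
  let ext (h : Fin t → Cut d) (s : ℕ) : Cut d := if hs : s < t then h ⟨s, hs⟩ else (i₀, 0)
  let H : Set (Fin t → Cut d) := {h | leafRel X c (treeAt c (ext h) t) = leafRel X c T}
  have hH : MeasurableSet H := by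
    have : Measurable fun h => leafRel X c (treeAt c (fun s => ext h s) t) := by
      refine measurable_leafRel_treeAt X c fun s hs => ?_
      simp only [ext, dif_pos hs]
      exact measurable_pi_apply _
    exact this (measurableSet_singleton _)
  have hmem (x : Ω) : (fun s : Fin t => ω s x) ∈ H ↔
      leafRel X c (treeAt c (fun s => ω s x) t) = leafRel X c T := by
    simp only [H, Set.mem_ofPred_eq]
    rw [treeAt_congr c (w := ext fun s : Fin t => ω s x) (w' := fun s => ω s x)
      (fun s hs => by simp [ext, hs])]
  have key := hω.uniform t H S hH hS
  have hset : {x | ¬ Separated c (treeAt c (fun s => ω s x) t) ∧ (fun s : Fin t => ω s x) ∈ H} =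
      {x | leafRel X c (treeAt c (fun s => ω s x) t) = leafRel X c T} := by
    ext x
    simp only [Set.mem_ofPred_eq, hmem]
    exact ⟨fun h => h.2, fun h => ⟨hSep _ h, h⟩⟩
  have hset' : {x | (¬ Separated c (treeAt c (fun s => ω s x) t) ∧
      (fun s : Fin t => ω s x) ∈ H) ∧ ω t x ∈ S} =
      {x | leafRel X c (treeAt c (fun s => ω s x) t) = leafRel X c T ∧ ω t x ∈ S} := by
    ext x
    have := Set.ext_iff.1 hset x
    simp only [Set.mem_ofPred_eq] at this ⊢
    rw [this]
  have hmeas : MeasurableSet {x | leafRel X c (treeAt c (fun s => ω s x) t) = leafRel X c T} :=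
    (measurable_leafRel_treeAt X c fun s _ => hω.measurable s) (measurableSet_singleton _)
  rw [hset, hset'] at key
  rw [key, setLIntegral_congr_fun (g := fun _ => (cutMeasure d)[|setR c T] S) hmeas
    (fun x hx => by beta_reduce; rw [hR _ hx])]
  rw [lintegral_const, Measure.restrict_apply_univ]

/-- Almost surely, each cut lies in the set from which it is to be picked. -/
lemma IsRun.ae_mem_setR (hω : IsRun c P ω) :
    ∀ᵐ x ∂P, ∀ t, ¬ Separated c (treeAt c (fun s => ω s x) t) →
      ω t x ∈ setR c (treeAt c (fun s => ω s x) t) := by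
  rw [ae_all_iff]
  intro t
  let X₀ : Fin 1 → Fin d → ℝ := fun _ _ => 0
  have hae : ∀ σ, ∀ᵐ x ∂P, leafRel X₀ c (treeAt c (fun s => ω s x) t) = σ →
      ¬ Separated c (treeAt c (fun s => ω s x) t) →
        ω t x ∈ setR c (treeAt c (fun s => ω s x) t) := by
    intro σ
    by_cases hσ : ∃ T, leafRel X₀ c T = σ ∧ ¬ Separated c T
    · obtain ⟨T, rfl, hT⟩ := hσ
      have h := hω.measure_leafRel_inter X₀ t hT (measurableSet_setR c T).compl
      have h0 : (cutMeasure d)[|setR c T] (setR c T)ᶜ = 0 := by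
        rw [cond_apply (measurableSet_setR c T)]
        simp
      rw [h0, zero_mul] at h
      filter_upwards [measure_eq_zero_iff_ae_notMem.1 h] with x hx hx' _
      by_contra hc
      refine hx ⟨hx', fun h => hc ?_⟩
      rwa [setR_eq X₀ c 0, ← show (relState 0 (leafRel X₀ c (treeAt c (fun s => ω s x) t))).1 =
        unsepPairs c (treeAt c (fun s => ω s x) t) from rfl, hx', relState_leafRel,
        ← setR_eq X₀ c 0]
    · exact Filter.Eventually.of_forall fun x hx hs => absurd ⟨_, hx, hs⟩ hσ
  have := ae_all_iff.2 hae
  filter_upwards [this] with x hx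
  exact hx _ rfl

lemma IsRun.ae_separated (hk : 0 < k) (hω : IsRun c P ω) :
    ∀ᵐ x ∂P, ∃ t ≤ k - 1, Separated c (treeAt c (fun s => ω s x) t) := by
  filter_upwards [hω.ae_mem_setR] with x hx
  exact exists_separated hk c fun t ht => (hx t ht).1

lemma IsRun.ae_output_eq (hk : 0 < k) (hω : IsRun c P ω) {t : ℕ} (ht : k - 1 ≤ t) :
    ∀ᵐ x ∂P, Separated c (treeAt c (fun s => ω s x) t) ∧
      (output c fun s => ω s x) = treeAt c (fun s => ω s x) t := by
  filter_upwards [hω.ae_separated hk] with x ⟨t', ht', hx⟩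
  have h := hx.treeAt_eq (ht'.trans ht)
  have h' : Separated c (treeAt c (fun s => ω s x) t) := by rwa [h]
  exact ⟨h', output_eq h'⟩

/-! ### The expected cost -/

variable [IsProbabilityMeasure P]

/-- The expectation of a function of finitely many events. -/
lemma integral_finite {β : Type*} [Fintype β] [MeasurableSpace β] [DiscreteMeasurableSpace β]
    {Z : Ω → β} (hZ : Measurable Z) (g : β → ℝ) :
    ∫ x, g (Z x) ∂P = ∑ z, P.real {x | Z x = z} * g z := by
  have := Measure.isProbabilityMeasure_map (μ := P) hZ.aemeasurable
  rw [← integral_map hZ.aemeasurable (Measurable.of_discrete (f := g)).aestronglyMeasurable,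
    integral_fintype (Integrable.of_finite)]
  refine Finset.sum_congr rfl fun z _ => ?_
  rw [map_measureReal_apply hZ (measurableSet_singleton z), smul_eq_mul]
  rfl

open Classical in
/-- The Markov property: the chain of the data point `a` follows the finite model. -/
lemma IsRun.integral_succ (hω : IsRun c P ω) (X : Fin n → Fin d → ℝ) (a : Fin n) (t : ℕ)
    (f : ChainState k → ℝ) :
    ∫ x, f (relState a (leafRel X c (treeAt c (fun s => ω s x) (t + 1)))) ∂P =
      ∫ x, (cutSystem X c a).avg f (relState a (leafRel X c (treeAt c (fun s => ω s x) t))) ∂P := by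
  classical
  set Γ := cutSystem X c a with hΓ
  have hmR : Measurable fun x => leafRel X c (treeAt c (fun s => ω s x) t) :=
    measurable_leafRel_treeAt X c fun s _ => hω.measurable s
  have hmπ : Measurable fun x => pattern X c (ω t x) :=
    (measurable_pattern X c).comp (hω.measurable t)
  simp only [treeAt, relState_grow]
  rw [integral_finite hmR fun σ => Γ.avg f (relState a σ),
    integral_finite (hmR.prodMk hmπ) fun z => f (Γ.next (relState a z.1) z.2),
    Fintype.sum_prod_type]
  refine Finset.sum_congr rfl fun σ _ => ?_
  by_cases hσ : ∃ T, leafRel X c T = σ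
  · obtain ⟨T, rfl⟩ := hσ
    by_cases hT : Separated c T
    · have hD : Γ.diam (relState a (leafRel X c T)).1 = 0 := by
        rw [relState_leafRel, diam_unsepPairs, maxDist_eq_zero_iff]; exact hT
      rw [Γ.avg_of_eq_zero hD]
      have h1 : ∀ π, P.real {x | (leafRel X c (treeAt c (fun s => ω s x) t), pattern X c (ω t x)) =
          (leafRel X c T, π)} * f (Γ.next (relState a (leafRel X c T)) π) =
          P.real {x | (leafRel X c (treeAt c (fun s => ω s x) t), pattern X c (ω t x)) =
          (leafRel X c T, π)} * f (relState a (leafRel X c T)) := by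
        intro π
        by_cases hπ : ∃ w, pattern X c w = π
        · obtain ⟨w, rfl⟩ := hπ
          rw [← relState_grow, hT.grow_eq]
        · have : {x | (leafRel X c (treeAt c (fun s => ω s x) t), pattern X c (ω t x)) =
              (leafRel X c T, π)} = ∅ := by
            ext x
            simp only [Prod.mk.injEq, Set.mem_ofPred_eq, Set.mem_empty_iff_false, iff_false, not_and]
            exact fun _ h => hπ ⟨_, h⟩
          rw [this]; simp
      rw [Finset.sum_congr rfl fun π _ => h1 π, ← Finset.sum_mul]
      congr 1
      have h2 : {x | leafRel X c (treeAt c (fun s => ω s x) t) = leafRel X c T} =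
          ⋃ π ∈ (Finset.univ : Finset (Fin n ⊕ Fin k → Prop)),
            {x | (leafRel X c (treeAt c (fun s => ω s x) t), pattern X c (ω t x)) =
              (leafRel X c T, π)} := by
        ext x; simp
      rw [h2, measureReal_biUnion_finset]
      · intro π _ π' _ hne
        refine Set.disjoint_left.2 fun x hx hx' => hne ?_
        simp only [Set.mem_ofPred_eq, Prod.mk.injEq] at hx hx'
        rw [← hx.2, hx'.2]
      · exact fun π _ => (hmR.prodMk hmπ) (measurableSet_singleton _)
    · have hD : 0 < Γ.diam (relState a (leafRel X c T)).1 := by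
        rw [relState_leafRel, diam_unsepPairs]
        exact (maxDist_nonneg c T).lt_of_ne fun h0 => hT ((maxDist_eq_zero_iff c T).1 h0.symm)
      rw [Γ.avg_of_pos hD, mul_div_assoc', Finset.mul_sum, Finset.sum_div]
      refine Finset.sum_congr rfl fun π _ => ?_
      have h1 := hω.measure_leafRel_inter X t hT
        (measurable_pattern X c (measurableSet_singleton π))
      have h2 : P.real {x | (leafRel X c (treeAt c (fun s => ω s x) t), pattern X c (ω t x)) =
          (leafRel X c T, π)} = ((cutMeasure d)[|setR c T]).real (pattern X c ⁻¹' {π}) *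
          P.real {x | leafRel X c (treeAt c (fun s => ω s x) t) = leafRel X c T} := by
        simp only [measureReal_def, ← ENNReal.toReal_mul, ← h1, Prod.mk.injEq]
        rfl
      have h3 : ((cutMeasure d)[|setR c T]).real (pattern X c ⁻¹' {π}) =
          (Γ.allowed (unsepPairs c T)).indicator Γ.weight π / Γ.mass (Γ.allowed (unsepPairs c T)) := by
        have hfin := cutMeasure_setR_ne_top c T
        rw [setR_eq X c a] at hfin
        rw [mass_eq X c a hfin, measureReal_def, cond_apply (measurableSet_setR c T),
          ENNReal.toReal_mul, ENNReal.toReal_inv, setR_eq X c a, inv_mul_eq_div, measureReal_def]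
        congr 1
        by_cases hπ : π ∈ Γ.allowed (unsepPairs c T)
        · rw [Set.indicator_of_mem hπ, ← Set.preimage_inter, Set.inter_singleton_of_mem hπ]
          rfl
        · rw [Set.indicator_of_notMem hπ, ← Set.preimage_inter,
            Set.inter_singleton_eq_empty.2 hπ]
          simp
      rw [h2, h3, relState_leafRel]
      by_cases hπ : π ∈ Γ.allowed (unsepPairs c T)
      · simp only [Set.indicator_of_mem hπ]; ring
      · simp only [Set.indicator_of_notMem hπ]; ring
  · have h0 : {x | leafRel X c (treeAt c (fun s => ω s x) t) = σ} = ∅ := by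
      ext x
      simp only [Set.mem_ofPred_eq, Set.mem_empty_iff_false, iff_false]
      exact fun h => hσ ⟨_, h⟩
    rw [h0]
    simp only [measureReal_empty, zero_mul]
    refine Finset.sum_eq_zero fun π _ => ?_
    have : {x | (leafRel X c (treeAt c (fun s => ω s x) t), pattern X c (ω t x)) = (σ, π)} = ∅ := by
      ext x
      simp only [Set.mem_ofPred_eq, Set.mem_empty_iff_false, iff_false, Prod.mk.injEq, not_and]
      exact fun h => absurd ⟨_, h⟩ hσ
    rw [this]; simp

lemma IsRun.integral_value (hω : IsRun c P ω) (X : Fin n → Fin d → ℝ) (a : Fin n) (t m : ℕ) :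
    ∫ x, (cutSystem X c a).value m
      (relState a (leafRel X c (treeAt c (fun s => ω s x) t))) ∂P =
      (cutSystem X c a).value (m + t) (Set.univ, Set.univ) := by
  induction t generalizing m with
  | zero =>
    have : relState a (leafRel X c (.leaf : ThresholdTree d)) = (Set.univ, Set.univ) := by
      rw [relState_leafRel]
      simp [unsepPairs, ThresholdTree.route]
    simp [treeAt, this]
  | succ t ih =>
    rw [hω.integral_succ X a t]
    refine (ih (m + 1)).trans ?_
    congr 1
    omega

lemma integrable_finite {β : Type*} [Finite β] [MeasurableSpace β] [DiscreteMeasurableSpace β]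
    {Z : Ω → β} (hZ : Measurable Z) (g : β → ℝ) : Integrable (fun x => g (Z x)) P := by
  have := Measure.isProbabilityMeasure_map (μ := P) hZ.aemeasurable
  exact (Integrable.of_finite (f := g) (μ := P.map Z)).comp_measurable hZ

/-- Part 1, with an explicit factor. -/
theorem IsRun.cost_bound (hk : 0 < k) (hc : Function.Injective c) (hω : IsRun c P ω)
    (X : Fin n → Fin d → ℝ) {M₀ M : ℕ} (hM₀ : k ^ 3 ≤ 2 ^ M₀)
    (hM : 2 * (1 + 4 * M₀ * (1 + 2 * Real.log k)) ^ 2 ≤ 2 ^ M) :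
    Integrable (fun x => (output c fun s => ω s x).cost X) P ∧
      ∫ x, (output c fun s => ω s x).cost X ∂P ≤
        (3 + 4 * M * (1 + 2 * Real.log k)) * centerCost X c := by
  have hmR : Measurable fun x => leafRel X c (treeAt c (fun s => ω s x) (k - 1)) :=
    measurable_leafRel_treeAt X c fun s _ => hω.measurable s
  have hout := hω.ae_output_eq hk le_rfl
  have heq : (fun x => (output c fun s => ω s x).cost X) =ᵐ[P]
      fun x => (treeAt c (fun s => ω s x) (k - 1)).cost X := by
    filter_upwards [hout] with x hx
    rw [hx.2]
  obtain ⟨g, hg⟩ := exists_cost_eq X c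
  have hint : Integrable (fun x => (treeAt c (fun s => ω s x) (k - 1)).cost X) P := by
    simp only [hg]
    exact integrable_finite hmR g
  refine ⟨hint.congr heq.symm, ?_⟩
  rw [integral_congr_ae heq]
  have hint' (a : Fin n) : Integrable (fun x => (cutSystem X c a).value 0
      (relState a (leafRel X c (treeAt c (fun s => ω s x) (k - 1))))) P :=
    integrable_finite hmR fun σ => (cutSystem X c a).value 0 (relState a σ)
  calc ∫ x, (treeAt c (fun s => ω s x) (k - 1)).cost X ∂P
      ≤ ∫ x, ∑ a, (cutSystem X c a).value 0
          (relState a (leafRel X c (treeAt c (fun s => ω s x) (k - 1)))) ∂P := by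
        refine integral_mono_ae hint (integrable_finsetSum _ fun a _ => hint' a) ?_
        filter_upwards [hout] with x hx
        refine (cost_le_sum X (hx.1.existsUnique_route hc hk)).trans (le_of_eq ?_)
        refine Finset.sum_congr rfl fun a _ => ?_
        rw [relState_leafRel, CutSystem.value, funext (ptDist_cutSystem X c a)]
    _ = ∑ a, (cutSystem X c a).value (0 + (k - 1)) (Set.univ, Set.univ) := by
        rw [integral_finsetSum _ fun a _ => hint' a]
        exact Finset.sum_congr rfl fun a _ => hω.integral_value X a _ _
    _ ≤ ∑ a, (3 + 4 * M * (1 + 2 * Real.log k)) * ⨅ j, l1Dist (X a) (c j) := by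
        refine Finset.sum_le_sum fun a _ => ?_
        have : Nonempty (Fin k) := ⟨⟨0, hk⟩⟩
        obtain ⟨j, hj⟩ := exists_eq_ciInf_of_finite (f := fun j => l1Dist (X a) (c j))
        rw [← hj]
        have := (cutSystem X c a).value_le_factor hM₀ hM j (0 + (k - 1))
          (s := (Set.univ, Set.univ)) ⟨⟨j, trivial⟩, fun _ _ _ _ => trivial⟩ trivial
        rwa [ptDist_cutSystem] at this
    _ = _ := by rw [centerCost, Finset.mul_sum]

end run

end ExplainableClustering

namespace ExplainableClustering

variable {d k n : ℕ}

/-! ### Picking a point of a union of intervals -/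

/-- One step of the walk through a list of consecutive intervals, where the cell `(f, j)` has the
length `len f j` and stands for the thresholds from `x j f` on for the feature `f`. The components
of the walk are: `1` if the cell has been found, and else `0`; the remaining length; the feature and
the threshold found. -/
def pickStep (len x : ℕ → ℕ → ℝ) (ρ : ℕ × ℝ × ℕ × ℝ) (f j : ℕ) : ℕ × ℝ × ℕ × ℝ :=
  if ρ.1 < 1 then
    if ρ.2.1 < len f j then (1, ρ.2.1, f, x j f + ρ.2.1)
    else (ρ.1, ρ.2.1 - len f j, ρ.2.2.1, ρ.2.2.2)
  else ρ

/-- The walk through the cells of a list. -/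
def pickList (len x : ℕ → ℕ → ℝ) (l : List (ℕ × ℕ)) (ρ : ℕ × ℝ × ℕ × ℝ) : ℕ × ℝ × ℕ × ℝ :=
  l.foldl (fun ρ q => pickStep len x ρ q.1 q.2) ρ

/-- The walk through all cells, feature by feature. -/
def pickAll (d k : ℕ) (len x : ℕ → ℕ → ℝ) (ρ : ℕ × ℝ × ℕ × ℝ) : ℕ × ℝ × ℕ × ℝ :=
  (List.range d).foldl (fun ρ f => (List.range k).foldl (fun ρ j => pickStep len x ρ f j) ρ) ρ

/-- The list of the pairs `(f, j)` with `f < d` and `j < k`. -/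
def cellList (d k : ℕ) : List (ℕ × ℕ) :=
  (List.range d).flatMap fun f => (List.range k).map fun j => (f, j)

lemma pickAll_eq (d k : ℕ) (len x : ℕ → ℕ → ℝ) (ρ : ℕ × ℝ × ℕ × ℝ) :
    pickAll d k len x ρ = pickList len x (cellList d k) ρ := by
  rw [pickAll, pickList, cellList, List.foldl_flatMap]
  simp only [List.foldl_map]

lemma sum_map_range {M : Type*} [AddCommMonoid M] (k : ℕ) (g : ℕ → M) :
    ((List.range k).map g).sum = ∑ j ∈ Finset.range k, g j := by
  induction k with
  | zero => simp
  | succ k ih => simp [List.range_succ, Finset.sum_range_succ, ih]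

lemma sum_map_cellList {M : Type*} [AddCommMonoid M] (d k : ℕ) (g : ℕ → ℕ → M) :
    ((cellList d k).map fun q => g q.1 q.2).sum = ∑ f : Fin d, ∑ j : Fin k, g f j := by
  have h (f : ℕ) : ∑ j : Fin k, g f j = ((List.range k).map (g f)).sum := by
    rw [Fin.sum_univ_eq_sum_range (g f), sum_map_range]
  simp only [h]
  rw [Fin.sum_univ_eq_sum_range (fun f => ((List.range k).map (g f)).sum), ← sum_map_range,
    cellList]
  generalize List.range d = l
  induction l with
  | nil => rfl
  | cons f l ih =>
    rw [List.flatMap_cons, List.map_append, List.sum_append, ih, List.map_cons, List.sum_cons,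
      List.map_map]
    rfl

lemma measurable_pickList (len x : ℕ → ℕ → ℝ) (l : List (ℕ × ℕ)) :
    Measurable (pickList len x l) := by
  induction l with
  | nil => exact measurable_id
  | cons q l ih =>
    refine ih.comp ?_
    refine Measurable.ite (measurableSet_lt measurable_fst measurable_const) ?_ measurable_id
    refine Measurable.ite (measurableSet_lt (by fun_prop) measurable_const) ?_ ?_ <;> fun_prop

lemma pickList_found (len x : ℕ → ℕ → ℝ) (l : List (ℕ × ℕ)) (z : ℝ × ℕ × ℝ) :
    pickList len x l (1, z) = (1, z) := by
  induction l with
  | nil => rfl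
  | cons q l ih =>
    have h : pickStep len x (1, z) q.1 q.2 = (1, z) := by simp [pickStep]
    rw [pickList, List.foldl_cons, h]
    exact ih

lemma pickList_lt (len x : ℕ → ℕ → ℝ) {m : ℕ} {l : List (ℕ × ℕ)} (hl : ∀ q ∈ l, q.1 < m)
    {ρ : ℕ × ℝ × ℕ × ℝ} (hρ : ρ.2.2.1 < m) : (pickList len x l ρ).2.2.1 < m := by
  induction l generalizing ρ with
  | nil => exact hρ
  | cons q l ih =>
    refine ih (fun q hq => hl q (List.mem_cons_of_mem _ hq)) ?_
    have := hl q List.mem_cons_self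
    simp only [pickStep]
    split_ifs <;> simpa

/-- If the starting point is uniform, then so is the point that is picked. -/
lemma volume_pickList (len x : ℕ → ℕ → ℝ) (hlen : ∀ f j, 0 ≤ len f j) {S : Set (ℕ × ℝ)}
    (hS : MeasurableSet S) (l : List (ℕ × ℕ)) :
    volume {r : ℝ | 0 ≤ r ∧ r < (l.map fun q => len q.1 q.2).sum ∧
        (pickList len x l (0, r, 0, 0)).2.2 ∈ S} =
      (l.map fun q => volume {θ : ℝ | x q.2 q.1 ≤ θ ∧ θ < x q.2 q.1 + len q.1 q.2 ∧
        (q.1, θ) ∈ S}).sum := by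
  induction l with
  | nil =>
    simp only [List.map_nil, List.sum_nil]
    rw [measure_eq_zero_iff_ae_notMem.2]
    exact Filter.Eventually.of_forall fun r hr => absurd hr.2.1 (not_lt.2 hr.1)
  | cons q l ih =>
    obtain ⟨f, j⟩ := q
    simp only [List.map_cons, List.sum_cons]
    rw [← ih]
    set L := (l.map fun q => len q.1 q.2).sum with hL
    have hL0 : 0 ≤ L := List.sum_nonneg (by
      simp only [List.mem_map]
      rintro _ ⟨q, -, rfl⟩; exact hlen _ _)
    have hl0 := hlen f j
    have hsplit : {r : ℝ | 0 ≤ r ∧ r < len f j + L ∧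
        (pickList len x ((f, j) :: l) (0, r, 0, 0)).2.2 ∈ S} =
        (fun r => x j f + r) ⁻¹' {θ | x j f ≤ θ ∧ θ < x j f + len f j ∧ (f, θ) ∈ S} ∪
        (fun r => r + -len f j) ⁻¹' {r | 0 ≤ r ∧ r < L ∧
          (pickList len x l (0, r, 0, 0)).2.2 ∈ S} := by
      ext r
      simp only [Set.mem_union, Set.mem_preimage, Set.mem_ofPred_eq]
      by_cases hr : r < len f j
      · have : pickList len x ((f, j) :: l) (0, r, 0, 0) = (1, r, f, x j f + r) := by
          rw [pickList, List.foldl_cons]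
          simp only [pickStep, zero_lt_one, hr, if_true]
          exact pickList_found _ _ _ _
        rw [this]
        constructor
        · rintro ⟨h1, h2, h3⟩
          exact Or.inl ⟨by linarith, by linarith, h3⟩
        · rintro (⟨h1, h2, h3⟩ | ⟨h1, -⟩)
          · exact ⟨by linarith, by linarith, h3⟩
          · linarith
      · have : pickList len x ((f, j) :: l) (0, r, 0, 0) =
            pickList len x l (0, r + -len f j, 0, 0) := by
          rw [pickList, List.foldl_cons]
          simp only [pickStep, zero_lt_one, hr, if_true, if_false, ← sub_eq_add_neg]
          rfl
        rw [this]
        constructor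
        · rintro ⟨h1, h2, h3⟩
          exact Or.inr ⟨by linarith, by linarith, h3⟩
        · rintro (⟨h1, h2, h3⟩ | ⟨h1, h2, h3⟩)
          · linarith
          · exact ⟨by linarith, by linarith, h3⟩
    have hm : MeasurableSet {θ : ℝ | x j f ≤ θ ∧ θ < x j f + len f j ∧ (f, θ) ∈ S} :=
      measurableSet_Ici.inter (measurableSet_Iio.inter (measurable_prodMk_left hS))
    rw [hsplit, measure_union' _ ((measurable_const_add _) hm), measure_preimage_add,
      measure_preimage_add_right]
    refine Set.disjoint_left.2 ?_
    rintro r ⟨-, h1, -⟩ ⟨h2, -⟩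
    simp only at h1 h2
    linarith

/-! ### The cells of the set from which a cut is picked -/

open Classical in
/-- The smallest coordinate of a center beyond that of the center `j`. -/
def nextCoord (c : Fin k → Fin d → ℝ) (f : Fin d) (j : Fin k) : ℝ :=
  sInf {y | ∃ l, y = c l f ∧ c j f < c l f}

/-- The cell `(f, j)` makes part of the set `R`: the cut at the center `j` is in `R`, and no
center with a smaller number has the same coordinate. -/
def IsCell (c : Fin k → Fin d → ℝ) (T : ThresholdTree d) (f : Fin d) (j : Fin k) : Prop :=
  (f, c j f) ∈ setR c T ∧ ∀ a < j, c a f ≠ c j f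

open Classical in
/-- The length of the interval of thresholds `[c j f, nextCoord c f j)` if it makes part of `R`. -/
def cellLen (c : Fin k → Fin d → ℝ) (T : ThresholdTree d) (f : Fin d) (j : Fin k) : ℝ :=
  if IsCell c T f j then nextCoord c f j - c j f else 0

section cells

variable (c : Fin k → Fin d → ℝ) (T : ThresholdTree d)

lemma nextCoord_spec {f : Fin d} {j : Fin k} (h : ∃ l, c j f < c l f) :
    c j f < nextCoord c f j ∧ (∃ l, c l f = nextCoord c f j) ∧
      ∀ l, c j f < c l f → nextCoord c f j ≤ c l f := by
  have hfin : {y | ∃ l, y = c l f ∧ c j f < c l f}.Finite :=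
    (Set.finite_range fun l => c l f).subset (by rintro _ ⟨l, rfl, -⟩; exact ⟨l, rfl⟩)
  obtain ⟨l₀, hl₀⟩ := h
  obtain ⟨l, h1, h2⟩ := Set.Nonempty.csInf_mem (s := {y | ∃ l, y = c l f ∧ c j f < c l f})
    ⟨c l₀ f, l₀, rfl, hl₀⟩ hfin
  rw [← nextCoord] at h1
  exact ⟨h1 ▸ h2, ⟨l, h1.symm⟩, fun l hl => csInf_le hfin.bddBelow ⟨l, rfl, hl⟩⟩

variable {c T}

lemma exists_lt_of_mem_setR {f : Fin d} {θ : ℝ} (h : (f, θ) ∈ setR c T) :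
    (∃ l, θ < c l f) ∧ ∃ l, c l f ≤ θ := by
  obtain ⟨⟨q, -, hq⟩, -⟩ := (mem_setR_iff c T _).1 h
  simp only [sepCuts, Set.mem_ofPred_eq] at hq
  by_cases h1 : θ < c q.1 f
  · exact ⟨⟨_, h1⟩, q.2, not_lt.1 fun h2 => hq ⟨fun _ => h2, fun _ => h1⟩⟩
  · refine ⟨⟨q.2, ?_⟩, q.1, not_lt.1 h1⟩
    by_contra h2
    exact hq ⟨fun h => absurd h h1, fun h => absurd h h2⟩

/-- Cuts with the same centers on the left lie in the same cell. -/
lemma mem_setR_congr {f : Fin d} {θ θ' : ℝ} (h : ∀ l, θ < c l f ↔ θ' < c l f) :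
    (f, θ) ∈ setR c T ↔ (f, θ') ∈ setR c T := by
  simp only [mem_setR_iff, sepCuts, Set.mem_ofPred_eq, h]

lemma mem_setR_iff_exists_cell {f : Fin d} {θ : ℝ} :
    (f, θ) ∈ setR c T ↔ ∃ j, c j f ≤ θ ∧ θ < c j f + cellLen c T f j := by
  classical
  constructor
  · intro h
    obtain ⟨⟨l₁, hl₁⟩, ⟨l₀, hl₀⟩⟩ := exists_lt_of_mem_setR h
    -- the center closest to the left of `θ`, with the smallest number
    obtain ⟨j₁, hj₁, hmax⟩ := Finset.exists_max_image (Finset.univ.filter fun l => c l f ≤ θ)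
      (fun l => c l f) ⟨l₀, by simpa using hl₀⟩
    simp only [Finset.mem_filter, Finset.mem_univ, true_and] at hj₁ hmax
    obtain ⟨j, hj, hmin⟩ := Finset.exists_min_image (Finset.univ.filter fun l => c l f = c j₁ f)
      id ⟨j₁, by simp⟩
    simp only [Finset.mem_filter, Finset.mem_univ, true_and, id] at hj hmin
    have hiff : ∀ l, θ < c l f ↔ c j f < c l f := by
      intro l
      refine ⟨fun hl => hj ▸ hj₁.trans_lt hl, fun hl => ?_⟩
      by_contra hc
      have := hmax l (not_lt.1 hc)
      rw [hj] at hl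
      linarith
    have hcell : IsCell c T f j := by
      refine ⟨(mem_setR_congr hiff).1 h, fun a ha hca => ?_⟩
      exact absurd (hmin a (hca.trans hj)) (not_le.2 ha)
    obtain ⟨-, ⟨l, hl⟩, -⟩ := nextCoord_spec c ⟨l₁, (hiff l₁).1 hl₁⟩
    have hlt : θ < nextCoord c f j := by
      rw [← hl, hiff, hl]
      exact (nextCoord_spec c ⟨l₁, (hiff l₁).1 hl₁⟩).1
    refine ⟨j, hj ▸ hj₁, ?_⟩
    rw [cellLen, if_pos hcell]
    linarith
  · rintro ⟨j, h1, h2⟩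
    by_cases hcell : IsCell c T f j
    · rw [cellLen, if_pos hcell] at h2
      refine (mem_setR_congr fun l => ?_).2 hcell.1
      refine ⟨fun hl => h1.trans_lt hl, fun hl => ?_⟩
      have := (nextCoord_spec c ⟨l, hl⟩).2.2 l hl
      linarith
    · rw [cellLen, if_neg hcell] at h2
      linarith

lemma cell_unique {f : Fin d} {θ : ℝ} {i j : Fin k} (hi : c i f ≤ θ)
    (hi' : θ < c i f + cellLen c T f i) (hj : c j f ≤ θ) (hj' : θ < c j f + cellLen c T f j) :
    i = j := by
  have key : ∀ {i : Fin k}, c i f ≤ θ → θ < c i f + cellLen c T f i → IsCell c T f i ∧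
      ∀ l, c i f < c l f → θ < c l f := by
    intro i hi hi'
    by_cases hcell : IsCell c T f i
    · refine ⟨hcell, fun l hl => ?_⟩
      rw [cellLen, if_pos hcell] at hi'
      have := (nextCoord_spec c ⟨l, hl⟩).2.2 l hl
      linarith
    · rw [cellLen, if_neg hcell] at hi'
      linarith
  obtain ⟨h1, h2⟩ := key hi hi'
  obtain ⟨h3, h4⟩ := key hj hj'
  have heq : c i f = c j f := by
    rcases lt_trichotomy (c i f) (c j f) with h | h | h
    · have := h2 j h; linarith
    · exact h
    · have := h4 i h; linarith
  rcases lt_trichotomy i j with h | h | h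
  · exact absurd heq (h3.2 i h)
  · exact h
  · exact absurd heq.symm (h1.2 j h)

lemma cellLen_nonneg (f : Fin d) (j : Fin k) : 0 ≤ cellLen c T f j := by
  rw [cellLen]
  split_ifs with h
  · obtain ⟨⟨l, hl⟩, -⟩ := exists_lt_of_mem_setR h.1
    have := (nextCoord_spec c ⟨l, hl⟩).1
    linarith
  · exact le_rfl

/-- The cells partition the set `R`. -/
lemma cutMeasure_setR_inter {S : Set (Cut d)} (hS : MeasurableSet S) :
    cutMeasure d (setR c T ∩ S) = ∑ f : Fin d, ∑ j : Fin k,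
      volume {θ : ℝ | c j f ≤ θ ∧ θ < c j f + cellLen c T f j ∧ (f, θ) ∈ S} := by
  rw [cutMeasure_apply ((measurableSet_setR c T).inter hS)]
  refine Finset.sum_congr rfl fun f _ => ?_
  have : Prod.mk f ⁻¹' (setR c T ∩ S) = ⋃ j ∈ (Finset.univ : Finset (Fin k)),
      {θ : ℝ | c j f ≤ θ ∧ θ < c j f + cellLen c T f j ∧ (f, θ) ∈ S} := by
    ext θ
    simp only [Set.mem_preimage, Set.mem_inter_iff, mem_setR_iff_exists_cell, Finset.mem_univ,
      Set.iUnion_true, Set.mem_iUnion, Set.mem_ofPred_eq]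
    constructor
    · rintro ⟨⟨j, h1, h2⟩, h3⟩; exact ⟨j, h1, h2, h3⟩
    · rintro ⟨j, h1, h2, h3⟩; exact ⟨⟨j, h1, h2⟩, h3⟩
  rw [this, measure_biUnion_finset]
  · intro i _ j _ hij
    exact Set.disjoint_left.2 fun θ h1 h2 => hij (cell_unique h1.1 h1.2.1 h2.1 h2.2.1)
  · exact fun j _ => measurableSet_Ici.inter (measurableSet_Iio.inter (measurable_prodMk_left hS))

lemma cutMeasure_setR : cutMeasure d (setR c T) =
    ENNReal.ofReal (∑ f : Fin d, ∑ j : Fin k, cellLen c T f j) := by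
  have h := cutMeasure_setR_inter (c := c) (T := T) MeasurableSet.univ
  rw [Set.inter_univ] at h
  rw [h, ENNReal.ofReal_sum_of_nonneg fun f _ => Finset.sum_nonneg fun j _ => cellLen_nonneg f j]
  refine Finset.sum_congr rfl fun f _ => ?_
  rw [ENNReal.ofReal_sum_of_nonneg fun j _ => cellLen_nonneg f j]
  refine Finset.sum_congr rfl fun j _ => ?_
  have : {θ : ℝ | c j f ≤ θ ∧ θ < c j f + cellLen c T f j ∧ (f, θ) ∈ Set.univ} =
      Set.Ico (c j f) (c j f + cellLen c T f j) := by
    ext θ; simp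
  rw [this, Real.volume_Ico, add_sub_cancel_left]

end cells

/-! ### The sampled cut -/

/-- The coordinate `f` of the center `j`, and `0` outside of the range. -/
def coordN (c : Fin k → Fin d → ℝ) (j f : ℕ) : ℝ :=
  if hf : f < d then if hj : j < k then c ⟨j, hj⟩ ⟨f, hf⟩ else 0 else 0

/-- The length of the cell `(f, j)`, and `0` outside of the range. -/
def cellLenN (c : Fin k → Fin d → ℝ) (T : ThresholdTree d) (f j : ℕ) : ℝ :=
  if h : f < d ∧ j < k then cellLen c T ⟨f, h.1⟩ ⟨j, h.2⟩ else 0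

/-- The feature with the number `f`; the number is less than `d` in all uses. -/
def toFeature (hd : 0 < d) (f : ℕ) : Fin d := if h : f < d then ⟨f, h⟩ else ⟨0, hd⟩

/-- The cut picked with the random number `v ∈ [0, 1]`: the point at the position `v * μ(R)` on the
line formed by the cells. -/
def sample (hd : 0 < d) (c : Fin k → Fin d → ℝ) (T : ThresholdTree d) (v : ℝ) : Cut d :=
  let ρ := pickAll d k (cellLenN c T) (coordN c)
    (0, v * ∑ f : Fin d, ∑ j : Fin k, cellLen c T f j, 0, 0)
  (toFeature hd ρ.2.2.1, ρ.2.2.2)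

variable (hd : 0 < d) {c : Fin k → Fin d → ℝ} {T : ThresholdTree d}

lemma sample_congr {T' : ThresholdTree d} (h : unsepPairs c T = unsepPairs c T') :
    sample hd c T = sample hd c T' := by
  have hR : setR c T = setR c T' := by
    ext w
    rw [mem_setR_iff, mem_setR_iff, maxDist, h, ← maxDist]
  have hcell : IsCell c T = IsCell c T' := by
    funext f j
    simp only [IsCell, hR]
  have h1 : cellLen c T = cellLen c T' := by
    funext f j
    rw [cellLen, cellLen, hcell]
  have h2 : cellLenN c T = cellLenN c T' := by
    funext f j
    simp only [cellLenN, h1]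
  funext v
  simp only [sample, h1, h2]

lemma measurable_sample : Measurable (sample hd c T) := by
  have h : Measurable fun v : ℝ => (pickAll d k (cellLenN c T) (coordN c)
    (0, v * ∑ f : Fin d, ∑ j : Fin k, cellLen c T f j, 0, 0)).2.2 := by
    simp only [pickAll_eq]
    refine measurable_snd.comp (measurable_snd.comp ((measurable_pickList _ _ _).comp ?_))
    fun_prop
  exact ((Measurable.of_discrete (f := toFeature hd)).comp (measurable_fst.comp h)).prodMk (measurable_snd.comp h)

/-- The sampled cut has the uniform distribution on `R`. -/
lemma volume_sample (hT : ¬ Separated c T) {S : Set (Cut d)} (hS : MeasurableSet S) :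
    volume {v : unitInterval | sample hd c T v ∈ S} = (cutMeasure d)[|setR c T] S := by
  set L := ∑ f : Fin d, ∑ j : Fin k, cellLen c T f j with hL
  have hL0 : 0 < L := by
    have h := cutMeasure_setR_pos c hT
    rw [cutMeasure_setR] at h
    simpa using h
  set S' : Set (ℕ × ℝ) := {z | (toFeature hd z.1, z.2) ∈ S} with hS'
  have hS'm : MeasurableSet S' :=
    (((Measurable.of_discrete (f := toFeature hd)).comp measurable_fst).prodMk measurable_snd) hS
  have hlen : ∀ f j, 0 ≤ cellLenN c T f j := by
    intro f j
    rw [cellLenN]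
    split_ifs
    · exact cellLen_nonneg _ _
    · exact le_rfl
  have hlenN (f : Fin d) (j : Fin k) : cellLenN c T f j = cellLen c T f j := by
    simp [cellLenN]
  have hcN (f : Fin d) (j : Fin k) : coordN c j f = c j f := by
    simp [coordN]
  have h1 := volume_pickList (cellLenN c T) (coordN c) hlen hS'm (cellList d k)
  rw [sum_map_cellList d k (fun f j => cellLenN c T f j),
    sum_map_cellList d k (fun f j => volume {θ : ℝ | coordN c j f ≤ θ ∧
      θ < coordN c j f + cellLenN c T f j ∧ (f, θ) ∈ S'})] at h1
  simp only [hlenN, hcN, ← hL] at h1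
  have h2 : ∀ f : Fin d, toFeature hd f = f := fun f => by simp [toFeature]
  simp only [hS', Set.mem_ofPred_eq, h2] at h1
  rw [← cutMeasure_setR_inter hS] at h1
  rw [cond_apply (measurableSet_setR c T), ← h1, cutMeasure_setR, ← hL]
  have hsc := Real.volume_preimage_mul_right hL0.ne' {r : ℝ | 0 ≤ r ∧ r < L ∧
    (toFeature hd (pickList (cellLenN c T) (coordN c) (cellList d k) (0, r, 0, 0)).2.2.1,
      (pickList (cellLenN c T) (coordN c) (cellList d k) (0, r, 0, 0)).2.2.2) ∈ S}
  rw [abs_of_pos (inv_pos.2 hL0), ENNReal.ofReal_inv_of_pos hL0] at hsc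
  rw [← hsc, unitInterval.volume_apply]
  refine measure_congr ?_
  have hne : ∀ᵐ v : ℝ, v ≠ 1 := by
    rw [ae_iff]; simp
  filter_upwards [hne] with v hv
  refine propext ?_
  constructor
  · rintro ⟨⟨v', h0, h1⟩, hmem, rfl⟩
    have hlt : v' < 1 := lt_of_le_of_ne h1 hv
    refine ⟨by positivity, by nlinarith, ?_⟩
    simp only [Set.mem_ofPred_eq, sample, pickAll_eq] at hmem
    exact hmem
  · rintro ⟨h0, h1, hmem⟩
    have h0' : 0 ≤ v := by
      by_contra hc
      nlinarith
    have h1' : v < 1 := by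
      by_contra hc
      nlinarith
    refine ⟨⟨v, h0', h1'.le⟩, ?_, rfl⟩
    simp only [Set.mem_ofPred_eq, sample, pickAll_eq]
    exact hmem

/-! ### The run computed from uniform random numbers -/

/-- The tree after `t` steps, with the cuts sampled with the random numbers `u 0, …, u (t-1)`. -/
def runTree (hd : 0 < d) (c : Fin k → Fin d → ℝ) (u : ℕ → unitInterval) : ℕ → ThresholdTree d
  | 0 => .leaf
  | t + 1 => grow (sample hd c (runTree hd c u t) (u t)) (Set.range c) (runTree hd c u t)

/-- The cut sampled in step `t`. -/
def runCut (hd : 0 < d) (c : Fin k → Fin d → ℝ) (t : ℕ) (u : ℕ → unitInterval) : Cut d :=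
  sample hd c (runTree hd c u t) (u t)

variable (c)

lemma treeAt_runCut (u : ℕ → unitInterval) (t : ℕ) :
    treeAt c (fun s => runCut hd c s u) t = runTree hd c u t := by
  induction t with
  | zero => rfl
  | succ t ih => rw [treeAt, ih]; rfl

lemma runTree_congr {u u' : ℕ → unitInterval} {t : ℕ} (h : ∀ s < t, u s = u' s) :
    runTree hd c u t = runTree hd c u' t := by
  induction t with
  | zero => rfl
  | succ t ih => rw [runTree, runTree, ih fun s hs => h s (by omega), h t (by omega)]

lemma measurable_runCut (t : ℕ) : Measurable (runCut hd c t) := by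
  induction t using Nat.strong_induction_on with
  | _ t ih =>
    let X₀ : Fin 0 → Fin d → ℝ := fun _ _ => 0
    have hm : Measurable fun u => leafRel X₀ c (runTree hd c u t) := by
      simp only [← treeAt_runCut]
      exact measurable_leafRel_treeAt X₀ c fun s hs => ih s hs
    -- for a given partition of the centers, the cut is a measurable function of one number
    intro S hS
    have : runCut hd c t ⁻¹' S = ⋃ σ, {u | leafRel X₀ c (runTree hd c u t) = σ} ∩
        {u | ∃ T, leafRel X₀ c T = σ ∧ sample hd c T (u t) ∈ S} := by
      ext u
      simp only [Set.mem_preimage, Set.mem_iUnion, Set.mem_inter_iff, Set.mem_ofPred_eq,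
        exists_eq_left']
      refine ⟨fun h => ⟨_, rfl, h⟩, ?_⟩
      rintro ⟨T, hT, h⟩
      have hE : unsepPairs c (runTree hd c u t) = unsepPairs c T := by
        ext ⟨i, j⟩
        exact iff_of_eq (congrFun (congrFun hT.symm (.inr i)) (.inr j))
      rw [runCut, sample_congr hd hE]
      exact h
    rw [this]
    refine MeasurableSet.iUnion fun σ => (hm (measurableSet_singleton σ)).inter ?_
    by_cases hσ : ∃ T, leafRel X₀ c T = σ
    · obtain ⟨T, rfl⟩ := hσ
      have : {u : ℕ → unitInterval | ∃ T', leafRel X₀ c T' = leafRel X₀ c T ∧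
          sample hd c T' (u t) ∈ S} = {u | sample hd c T (u t) ∈ S} := by
        ext u
        simp only [Set.mem_ofPred_eq]
        refine ⟨?_, fun h => ⟨T, rfl, h⟩⟩
        rintro ⟨T', hT, h⟩
        have hE : unsepPairs c T = unsepPairs c T' := by
          ext ⟨i, j⟩
          exact iff_of_eq (congrFun (congrFun hT.symm (.inr i)) (.inr j))
        rwa [sample_congr hd hE]
      rw [this]
      exact ((measurable_sample hd).comp
        (measurable_subtype_coe.comp (measurable_pi_apply t))) hS
    · convert MeasurableSet.empty
      ext u
      simp only [Set.mem_ofPred_eq, Set.mem_empty_iff_false, iff_false]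
      rintro ⟨T, hT, -⟩
      exact hσ ⟨T, hT⟩

/-- The sampled cuts are those of the algorithm: the random number of step `t` is independent of
the earlier ones. -/
theorem isRun_runCut : IsRun c uniformSource (runCut hd c) where
  measurable := measurable_runCut hd c
  uniform := by
    intro t H S hH hS
    let X₀ : Fin 0 → Fin d → ℝ := fun _ _ => 0
    simp only [treeAt_runCut]
    have hm (t : ℕ) : Measurable fun u => leafRel X₀ c (runTree hd c u t) := by
      simp only [← treeAt_runCut]
      exact measurable_leafRel_treeAt X₀ c fun s _ => measurable_runCut hd c s
    have hE {T T' : ThresholdTree d} (h : leafRel X₀ c T = leafRel X₀ c T') :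
        unsepPairs c T = unsepPairs c T' := by
      ext ⟨i, j⟩
      exact iff_of_eq (congrFun (congrFun h (.inr i)) (.inr j))
    have hSep {T T' : ThresholdTree d} (h : leafRel X₀ c T = leafRel X₀ c T') :
        Separated c T ↔ Separated c T' := by
      rw [← maxDist_eq_zero_iff, maxDist, hE h, ← maxDist, maxDist_eq_zero_iff]
    have hR {T T' : ThresholdTree d} (h : leafRel X₀ c T = leafRel X₀ c T') :
        setR c T = setR c T' := by
      ext w
      rw [mem_setR_iff, mem_setR_iff, maxDist, hE h, ← maxDist]
    -- the event that the history is in `H` and the partition is `σ`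
    let G (σ : Fin 0 ⊕ Fin k → Fin 0 ⊕ Fin k → Prop) : Set (ℕ → unitInterval) :=
      {u | leafRel X₀ c (runTree hd c u t) = σ} ∩
        {u | ¬ Separated c (runTree hd c u t) ∧ (fun s : Fin t => runCut hd c s u) ∈ H}
    have hGm' : MeasurableSet {u : ℕ → unitInterval | ¬ Separated c (runTree hd c u t) ∧
        (fun s : Fin t => runCut hd c s u) ∈ H} := by
      refine MeasurableSet.inter ?_ ?_
      · have : {u : ℕ → unitInterval | ¬ Separated c (runTree hd c u t)} =
            (fun u => leafRel X₀ c (runTree hd c u t)) ⁻¹'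
              {σ | ∃ T, leafRel X₀ c T = σ ∧ ¬ Separated c T} := by
          ext u
          simp only [Set.mem_ofPred_eq, Set.mem_preimage]
          exact ⟨fun h => ⟨_, rfl, h⟩, fun ⟨T, hT, h⟩ => by rwa [hSep hT] at h⟩
        change MeasurableSet {u : ℕ → unitInterval | ¬ Separated c (runTree hd c u t)}
        rw [this]
        exact hm t (MeasurableSet.of_discrete)
      · exact (measurable_pi_lambda _ fun s : Fin t => measurable_runCut hd c s) hH
    have hGm (σ) : MeasurableSet (G σ) := (hm t (measurableSet_singleton σ)).inter hGm'
    have hindep : IndepFun (fun u (i : Finset.range t) => u i) (fun u : ℕ → unitInterval => u t)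
        uniformSource := by
      have h1 : iIndepFun (fun i (u : ℕ → unitInterval) => u i) uniformSource :=
        iIndepFun_infinitePi (X := fun _ (v : unitInterval) => v) fun _ => measurable_id
      have h2 := h1.indepFun_finset (Finset.range t) {t} (by simp)
        (fun i => measurable_pi_apply i)
      exact h2.comp (φ := id) (ψ := fun z : ({t} : Finset ℕ) → unitInterval =>
        z ⟨t, Finset.mem_singleton_self t⟩) measurable_id (measurable_pi_apply _)
    have hlaw (A : Set unitInterval) (hA : MeasurableSet A) :
        uniformSource ((fun u : ℕ → unitInterval => u t) ⁻¹' A) = volume A :=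
      (measurePreserving_eval_infinitePi (fun _ : ℕ => (volume : Measure unitInterval)) t).measure_preimage
        hA.nullMeasurableSet
    let extend (z : Finset.range t → unitInterval) (s : ℕ) : unitInterval :=
      if hs : s ∈ Finset.range t then z ⟨s, hs⟩ else 0
    have hext : Measurable extend := by
      refine measurable_pi_lambda _ fun s => ?_
      by_cases hs : s ∈ Finset.range t
      · simp only [extend, dif_pos hs]; exact measurable_pi_apply _
      · simp only [extend, dif_neg hs]; exact measurable_const
    have hagree (u : ℕ → unitInterval) : ∀ s < t, extend (fun i => u i) s = u s := by
      intro s hs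
      simp only [extend, dif_pos (Finset.mem_range.2 hs)]
    have hG (σ) : G σ = (fun u (i : Finset.range t) => u i) ⁻¹' (extend ⁻¹' G σ) := by
      ext u
      have h1 := runTree_congr hd c (hagree u)
      have h2 : (fun s : Fin t => runCut hd c s (extend fun i => u i)) =
          fun s : Fin t => runCut hd c s u := by
        funext s
        rw [runCut, runCut, runTree_congr hd c (fun s' hs' => hagree u s' (hs'.trans s.2)),
          hagree u s s.2]
      simp only [G, Set.mem_preimage, Set.mem_inter_iff, Set.mem_ofPred_eq, h1, h2]
    have hkey (σ) : uniformSource (G σ ∩ {u | runCut hd c t u ∈ S}) =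
        ∫⁻ u in G σ, (cutMeasure d)[|setR c (runTree hd c u t)] S ∂uniformSource := by
      by_cases hσ : ∃ T, leafRel X₀ c T = σ ∧ ¬ Separated c T
      · obtain ⟨T, rfl, hT⟩ := hσ
        have h1 : G (leafRel X₀ c T) ∩ {u | runCut hd c t u ∈ S} =
            (fun u (i : Finset.range t) => u i) ⁻¹' (extend ⁻¹' G (leafRel X₀ c T)) ∩
              (fun u => u t) ⁻¹' {v : unitInterval | sample hd c T v ∈ S} := by
          rw [← hG]
          ext u
          refine and_congr_right fun hu => ?_
          simp only [Set.mem_ofPred_eq, Set.mem_preimage, runCut]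
          rw [sample_congr hd (hE hu.1)]
        have hA : MeasurableSet {v : unitInterval | sample hd c T v ∈ S} :=
          ((measurable_sample hd).comp measurable_subtype_coe) hS
        rw [h1, indepFun_iff_measure_inter_preimage_eq_mul.1 hindep _ _ (hext (hGm _)) hA,
          ← hG, hlaw _ hA, volume_sample hd hT hS,
          setLIntegral_congr_fun (g := fun _ => (cutMeasure d)[|setR c T] S) (hGm _)
            (fun u hu => by beta_reduce; rw [hR hu.1]), lintegral_const,
          Measure.restrict_apply_univ, mul_comm]
      · have : G σ = ∅ := by
          ext u
          simp only [G, Set.mem_inter_iff, Set.mem_ofPred_eq, Set.mem_empty_iff_false, iff_false]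
          rintro ⟨h1, h2, -⟩
          exact hσ ⟨_, h1, h2⟩
        simp [this]
    have hdisj : Pairwise (Function.onFun Disjoint G) := by
      intro σ σ' hne
      exact Set.disjoint_left.2 fun u h1 h2 => hne (h1.1.symm.trans h2.1)
    have hU : {u : ℕ → unitInterval | ¬ Separated c (runTree hd c u t) ∧
        (fun s : Fin t => runCut hd c s u) ∈ H} = ⋃ σ, G σ := by
      ext u; simp [G]
    have hU' : {u : ℕ → unitInterval | (¬ Separated c (runTree hd c u t) ∧
        (fun s : Fin t => runCut hd c s u) ∈ H) ∧ runCut hd c t u ∈ S} =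
        ⋃ σ, G σ ∩ {u | runCut hd c t u ∈ S} := by
      rw [← Set.iUnion_inter, ← hU]; rfl
    rw [hU', hU, lintegral_iUnion hGm hdisj, measure_iUnion]
    · exact tsum_congr hkey
    · exact fun σ σ' hne => (hdisj hne).mono Set.inter_subset_left Set.inter_subset_left
    · exact fun σ => (hGm σ).inter (measurable_runCut hd c t hS)

end ExplainableClustering

namespace ExplainableClustering

/-! ### Programs with bounded loops -/

/-- The memory cell `a[0][0]`, used as a variable. -/
abbrev IExp.var (a : ℕ) : IExp := .get a (.const 0) (.const 0)

/-- Programs whose only loops are `for v = 0, …, b[0][0] - 1`, where the loop variable is the cell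
`v[0][0]`. -/
inductive BoundedProgram : Type
  | skip : BoundedProgram
  | setInt (a : ℕ) (i j e : IExp) : BoundedProgram
  | setReal (a : ℕ) (i j : IExp) (e : RExp) : BoundedProgram
  | random (a : ℕ) (i j : IExp) : BoundedProgram
  | seq (p q : BoundedProgram) : BoundedProgram
  | ite (b : Test) (p q : BoundedProgram) : BoundedProgram
  | forLoop (b v : ℕ) (p : BoundedProgram) : BoundedProgram

namespace BoundedProgram

/-- The program with the bounded loops expanded. -/
def compile : BoundedProgram → Program
  | skip => .skip
  | setInt a i j e => .setInt a i j e
  | setReal a i j e => .setReal a i j e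
  | random a i j => .random a i j
  | seq p q => .seq p.compile q.compile
  | ite b p q => .ite b p.compile q.compile
  | forLoop b v p => .seq (.setInt v (.const 0) (.const 0) (.const 0))
      (.loop (.intLt (.var v) (.var b))
        (.seq p.compile (.setInt v (.const 0) (.const 0) (.add (.var v) (.const 1)))))

open Classical in
/-- The final state of a program. -/
def run (u : ℕ → unitInterval) : BoundedProgram → State → State
  | skip, s => s
  | setInt a i j e, s => s.setInt a (i.eval s) (j.eval s) (e.eval s)
  | setReal a i j e, s => s.setReal a (i.eval s) (j.eval s) (e.eval s)
  | random a i j, s =>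
      { s.setReal a (i.eval s) (j.eval s) (u s.used : ℝ) with used := s.used + 1 }
  | seq p q, s => run u q (run u p s)
  | ite b p q, s => if b.Holds s then run u p s else run u q s
  | forLoop b v p, s =>
      (fun s => (run u p s).setInt v 0 0 ((run u p s).int v 0 0 + 1))^[s.int b 0 0]
        (s.setInt v 0 0 0)

/-- Whether the program contains an assignment to the array `a` for natural numbers. -/
def writesInt (a : ℕ) : BoundedProgram → Bool
  | skip => false
  | setInt a' _ _ _ => a == a'
  | setReal _ _ _ _ => false
  | random _ _ _ => false
  | seq p q => p.writesInt a || q.writesInt a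
  | ite _ p q => p.writesInt a || q.writesInt a
  | forLoop _ v p => a == v || p.writesInt a

/-- Whether the program contains an assignment to the array `a` for real numbers. -/
def writesReal (a : ℕ) : BoundedProgram → Bool
  | skip => false
  | setInt _ _ _ _ => false
  | setReal a' _ _ _ => a == a'
  | random a' _ _ => a == a'
  | seq p q => p.writesReal a || q.writesReal a
  | ite _ p q => p.writesReal a || q.writesReal a
  | forLoop _ _ p => p.writesReal a

/-- Whether the program uses random numbers. -/
def usesRandom : BoundedProgram → Bool
  | skip => false
  | setInt _ _ _ _ => false
  | setReal _ _ _ _ => false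
  | random _ _ _ => true
  | seq p q => p.usesRandom || q.usesRandom
  | ite _ p q => p.usesRandom || q.usesRandom
  | forLoop _ _ p => p.usesRandom

/-- The loops run up to one of the sizes `d` and `k` of the input, which are in the arrays `1` and
`2` and are not assigned to, and the loop variables are not assigned to in the bodies of the
loops. -/
def wellFormed : BoundedProgram → Bool
  | skip => true
  | setInt _ _ _ _ => true
  | setReal _ _ _ _ => true
  | random _ _ _ => true
  | seq p q => p.wellFormed && q.wellFormed
  | ite _ p q => p.wellFormed && q.wellFormed
  | forLoop b v p => p.wellFormed && !p.writesInt v && !p.writesInt b && (b == 1 || b == 2) &&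
      !(v == b)

/-- A bound for the number of steps, as a polynomial in `d + k`. -/
def steps : BoundedProgram → Polynomial ℕ
  | skip => 1
  | setInt _ _ _ _ => 1
  | setReal _ _ _ _ => 1
  | random _ _ _ => 1
  | seq p q => p.steps + q.steps
  | ite _ p q => p.steps + q.steps + 1
  | forLoop _ _ p => Polynomial.X * (p.steps + 2) + 2

/-- The state `s'` agrees with the state `s` on everything that `p` does not write. -/
structure Frame (p : BoundedProgram) (s s' : State) : Prop where
  int : ∀ a, p.writesInt a = false → s'.int a = s.int a
  real : ∀ a, p.writesReal a = false → s'.real a = s.real a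
  used : p.usesRandom = false → s'.used = s.used

end BoundedProgram

namespace State

variable (s : State) (a a' i j : ℕ)

lemma int_setInt_ne (v : ℕ) (h : a' ≠ a) : (s.setInt a i j v).int a' = s.int a' := by
  funext i' j'
  simp [setInt, h]

lemma int_setInt (v i' j' : ℕ) :
    (s.setInt a i j v).int a i' j' = if i' = i ∧ j' = j then v else s.int a i' j' := by
  simp [setInt]

lemma real_setInt (v : ℕ) : (s.setInt a i j v).real = s.real := rfl

lemma real_setReal_ne (v : ℝ) (h : a' ≠ a) : (s.setReal a i j v).real a' = s.real a' := by
  funext i' j'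
  simp [setReal, h]

lemma real_setReal (v : ℝ) (i' j' : ℕ) :
    (s.setReal a i j v).real a i' j' = if i' = i ∧ j' = j then v else s.real a i' j' := by
  simp [setReal]

lemma int_setReal (v : ℝ) : (s.setReal a i j v).int = s.int := rfl

end State

namespace BoundedProgram

variable (u : ℕ → unitInterval) {p q : BoundedProgram} {s s' s'' : State}

lemma Frame.trans (h : Frame p s s') (h' : Frame p s' s'') : Frame p s s'' where
  int a ha := (h'.int a ha).trans (h.int a ha)
  real a ha := (h'.real a ha).trans (h.real a ha)
  used ha := (h'.used ha).trans (h.used ha)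

lemma frame_run (p : BoundedProgram) (s : State) : Frame p s (p.run u s) := by
  induction p generalizing s with
  | skip => exact ⟨fun _ _ => rfl, fun _ _ => rfl, fun _ => rfl⟩
  | setInt a i j e =>
    refine ⟨fun a' h => State.int_setInt_ne _ _ _ _ _ _ ?_, fun _ _ => rfl, fun _ => rfl⟩
    simpa [writesInt] using h
  | setReal a i j e =>
    refine ⟨fun _ _ => rfl, fun a' h => State.real_setReal_ne _ _ _ _ _ _ ?_, fun _ => rfl⟩
    simpa [writesReal] using h
  | random a i j =>
    refine ⟨fun _ _ => rfl, fun a' h => State.real_setReal_ne s a a' _ _ _ ?_, fun h => ?_⟩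
    · simpa [writesReal] using h
    · simp [usesRandom] at h
  | seq p q ihp ihq =>
    refine ⟨fun a h => ?_, fun a h => ?_, fun h => ?_⟩
    · simp only [writesInt, Bool.or_eq_false_iff] at h
      exact ((ihq _).int a h.2).trans ((ihp _).int a h.1)
    · simp only [writesReal, Bool.or_eq_false_iff] at h
      exact ((ihq _).real a h.2).trans ((ihp _).real a h.1)
    · simp only [usesRandom, Bool.or_eq_false_iff] at h
      exact ((ihq _).used h.2).trans ((ihp _).used h.1)
  | ite b p q ihp ihq =>
    simp only [run]
    refine ⟨fun a h => ?_, fun a h => ?_, fun h => ?_⟩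
    · simp only [writesInt, Bool.or_eq_false_iff] at h
      split_ifs
      · exact (ihp _).int a h.1
      · exact (ihq _).int a h.2
    · simp only [writesReal, Bool.or_eq_false_iff] at h
      split_ifs
      · exact (ihp _).real a h.1
      · exact (ihq _).real a h.2
    · simp only [usesRandom, Bool.or_eq_false_iff] at h
      split_ifs
      · exact (ihp _).used h.1
      · exact (ihq _).used h.2
  | forLoop b v p ih =>
    simp only [run]
    generalize s.int b 0 0 = N
    have h0 : Frame (forLoop b v p) s (s.setInt v 0 0 0) := by
      refine ⟨fun a h => State.int_setInt_ne _ _ _ _ _ _ ?_, fun _ _ => rfl, fun _ => rfl⟩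
      simp only [writesInt, Bool.or_eq_false_iff, beq_eq_false_iff_ne] at h
      exact h.1
    induction N with
    | zero => exact h0
    | succ N ihN =>
      rw [Function.iterate_succ_apply']
      refine ihN.trans ⟨fun a h => ?_, fun a h => ?_, fun h => ?_⟩
      · simp only [writesInt, Bool.or_eq_false_iff, beq_eq_false_iff_ne] at h
        rw [State.int_setInt_ne _ _ _ _ _ _ h.1]
        exact (ih _).int a h.2
      · exact (ih _).real a h
      · exact (ih _).used h

/-- The invariant rule for bounded loops. The invariant need not mention what the loop does not
write. -/
lemma run_forLoop_induction {b v : ℕ} (hv : p.writesInt v = false) {N : ℕ} (hN : s.int b 0 0 = N)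
    (I : ℕ → State → Prop) (h0 : I 0 (s.setInt v 0 0 0))
    (hstep : ∀ i < N, ∀ s', Frame (forLoop b v p) s s' → s'.int v 0 0 = i → I i s' →
      I (i + 1) ((p.run u s').setInt v 0 0 (i + 1))) :
    I N ((forLoop b v p).run u s) := by
  simp only [run, hN]
  have key : ∀ M ≤ N,
      Frame (forLoop b v p) s ((fun s => (run u p s).setInt v 0 0 ((run u p s).int v 0 0 + 1))^[M]
        (s.setInt v 0 0 0)) ∧
      ((fun s => (run u p s).setInt v 0 0 ((run u p s).int v 0 0 + 1))^[M]
        (s.setInt v 0 0 0)).int v 0 0 = M ∧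
      I M ((fun s => (run u p s).setInt v 0 0 ((run u p s).int v 0 0 + 1))^[M]
        (s.setInt v 0 0 0)) := by
    intro M hM
    induction M with
    | zero =>
      refine ⟨⟨fun a h => State.int_setInt_ne _ _ _ _ _ _ ?_, fun _ _ => rfl, fun _ => rfl⟩,
        by simp [State.int_setInt], h0⟩
      simp only [writesInt, Bool.or_eq_false_iff, beq_eq_false_iff_ne] at h
      exact h.1
    | succ M ih =>
      obtain ⟨h1, h2, h3⟩ := ih (by omega)
      rw [Function.iterate_succ_apply']
      set st := (fun s => (run u p s).setInt v 0 0 ((run u p s).int v 0 0 + 1))^[M]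
        (s.setInt v 0 0 0)
      have h4 : (run u p st).int v 0 0 = M := by rw [(frame_run u p st).int v hv, h2]
      simp only [h4]
      refine ⟨h1.trans ⟨fun a h => ?_, fun a h => (frame_run u p st).real a h,
        fun h => (frame_run u p st).used h⟩, by simp [State.int_setInt], hstep M (by omega) st h1 h2 h3⟩
      simp only [writesInt, Bool.or_eq_false_iff, beq_eq_false_iff_ne] at h
      rw [State.int_setInt_ne _ _ _ _ _ _ h.1]
      exact (frame_run u p st).int a h.2
  exact (key N le_rfl).2.2

/-- A well-formed program halts within `steps` steps. -/
lemma exec_compile (hp : p.wellFormed = true) {N : ℕ} (h1 : s.int 1 0 0 ≤ N)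
    (h2 : s.int 2 0 0 ≤ N) (h12 : p.writesInt 1 = false ∧ p.writesInt 2 = false) :
    ∃ m ≤ p.steps.eval N, Exec u p.compile s m (p.run u s) := by
  induction p generalizing s with
  | skip => exact ⟨1, by simp [steps], .skip s⟩
  | setInt a i j e => exact ⟨1, by simp [steps], .setInt s a i j e⟩
  | setReal a i j e => exact ⟨1, by simp [steps], .setReal s a i j e⟩
  | random a i j => exact ⟨1, by simp [steps], .random s a i j⟩
  | seq p q ihp ihq =>
    simp only [wellFormed, Bool.and_eq_true, writesInt, Bool.or_eq_false_iff] at hp h12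
    obtain ⟨m, hm, he⟩ := ihp hp.1 h1 h2 ⟨h12.1.1, h12.2.1⟩
    have hf := frame_run u p s
    obtain ⟨m', hm', he'⟩ := ihq (s := p.run u s) hp.2 (by rwa [hf.int 1 h12.1.1])
      (by rwa [hf.int 2 h12.2.1]) ⟨h12.1.2, h12.2.2⟩
    exact ⟨m + m', by simp only [steps, Polynomial.eval_add]; omega, .seq he he'⟩
  | ite b p q ihp ihq =>
    simp only [wellFormed, Bool.and_eq_true, writesInt, Bool.or_eq_false_iff] at hp h12
    simp only [run, steps, Polynomial.eval_add, Polynomial.eval_one]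
    by_cases h : b.Holds s
    · obtain ⟨m, hm, he⟩ := ihp hp.1 h1 h2 ⟨h12.1.1, h12.2.1⟩
      rw [if_pos h]
      exact ⟨m + 1, by omega, .iteTrue h he⟩
    · obtain ⟨m, hm, he⟩ := ihq hp.2 h1 h2 ⟨h12.1.2, h12.2.2⟩
      rw [if_neg h]
      exact ⟨m + 1, by omega, .iteFalse h he⟩
  | forLoop b v p ih =>
    simp only [wellFormed, Bool.and_eq_true, Bool.not_eq_true', Bool.or_eq_true, beq_iff_eq,
      beq_eq_false_iff_ne, writesInt, Bool.or_eq_false_iff] at hp h12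
    obtain ⟨⟨⟨⟨hwf, hv⟩, hb⟩, hb12⟩, hvb⟩ := hp
    have hN : s.int b 0 0 ≤ N := by rcases hb12 with rfl | rfl <;> assumption
    set g : State → State := fun s => (run u p s).setInt v 0 0 ((run u p s).int v 0 0 + 1) with hg
    set L : Program := .loop (.intLt (.var v) (.var b))
        (.seq p.compile (.setInt v (.const 0) (.const 0) (.add (.var v) (.const 1)))) with hL
    have key : ∀ (r : ℕ) (st : State), st.int 1 0 0 ≤ N → st.int 2 0 0 ≤ N →
        st.int v 0 0 + r = st.int b 0 0 →
        ∃ m ≤ r * (p.steps.eval N + 2) + 1, Exec u L st m (g^[r] st) := by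
      intro r
      induction r with
      | zero =>
        intro st _ _ hr
        refine ⟨1, by omega, .loopStop ?_⟩
        simp only [Test.Holds, IExp.eval]
        omega
      | succ r ihr =>
        intro st hst1 hst2 hr
        obtain ⟨m, hm, he⟩ := ih hwf hst1 hst2 ⟨h12.1.2, h12.2.2⟩
        have hf := frame_run u p st
        have hgv : (g st).int v 0 0 = st.int v 0 0 + 1 := by
          rw [hg]
          simp only [State.int_setInt, hf.int v hv, and_self, if_true]
        obtain ⟨m', hm', he'⟩ := ihr (g st)
          (by rw [hg]; simp only [State.int_setInt_ne _ _ _ _ _ _ h12.1.1, hf.int 1 h12.1.2]; exact hst1)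
          (by rw [hg]; simp only [State.int_setInt_ne _ _ _ _ _ _ h12.2.1, hf.int 2 h12.2.2]; exact hst2)
          (by
            rw [hgv]
            have : (g st).int b 0 0 = st.int b 0 0 := by
              rw [hg]
              simp only [State.int_setInt_ne _ _ _ _ _ _ (Ne.symm hvb), hf.int b hb]
            rw [this]; omega)
        refine ⟨m + 1 + m' + 1, ?_, ?_⟩
        · rw [Nat.succ_mul]; omega
        · rw [Function.iterate_succ_apply]
          refine .loopStep ?_ (.seq he (.setInt _ _ _ _ _)) he'
          simp only [Test.Holds, IExp.eval]
          omega
    obtain ⟨m, hm, he⟩ := key (s.int b 0 0) (s.setInt v 0 0 0)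
      (by rw [State.int_setInt_ne _ _ _ _ _ _ h12.1.1]; exact h1)
      (by rw [State.int_setInt_ne _ _ _ _ _ _ h12.2.1]; exact h2)
      (by rw [State.int_setInt_ne _ _ _ _ _ _ (Ne.symm hvb)]; simp [State.int_setInt])
    refine ⟨1 + m, ?_, .seq (.setInt _ _ _ _ _) he⟩
    simp only [steps, Polynomial.eval_add, Polynomial.eval_mul, Polynomial.eval_X,
      Polynomial.eval_ofNat]
    have := Nat.mul_le_mul_right (p.steps.eval N + 2) hN
    omega

end BoundedProgram
end ExplainableClustering

namespace ExplainableClustering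

namespace BoundedProgram

/-! ### The program: distances and diameters -/

/-! The arrays are used as follows. For natural numbers: `3` is the tree, `4` the leaves of the
centers, `5` the largest number of a node in use, `6` the new leaves of the centers, `10` the step,
`11` a feature, `12`, `13` and `14` centers, `20`, `21`, `22` and `26` flags, `23` tells whether the
cut has been found, `24` is the feature of the cut, and `25` the number of a center that represents a
new leaf. For real numbers: `1` holds the centers, `2` the thresholds of the tree, `3` the distances of
the centers, `4` the lengths of the cells, `5` the diameter, `7` the next coordinate, `8` the total
length of the cells, `9` the remaining length, and `10` the threshold of the cut. In what follows,
"the center `12`" is the center whose number is in the variable `12`, and so on. -/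

/-- Equality of natural numbers. -/
def eqTest (e f : IExp) : Test := .and (.not (.intLt e f)) (.not (.intLt f e))

/-- Equality of real numbers. -/
def realEqTest (e f : RExp) : Test := .and (.not (.realLt e f)) (.not (.realLt f e))

lemma holds_eqTest (s : State) (e f : IExp) : (eqTest e f).Holds s ↔ e.eval s = f.eval s := by
  simp only [eqTest, Test.Holds]
  omega

lemma holds_realEqTest (s : State) (e f : RExp) :
    (realEqTest e f).Holds s ↔ e.eval s = f.eval s := by
  simp only [realEqTest, Test.Holds, not_lt]
  exact ⟨fun h => le_antisymm h.2 h.1, fun h => ⟨h.ge, h.le⟩⟩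

/-- The coordinate of a center. -/
abbrev coordExp (j f : ℕ) : RExp := .get 1 (.var j) (.var f)

/-- A loop over all pairs of centers, with the variables `13` and `14`. -/
def pairLoop (p : BoundedProgram) : BoundedProgram := forLoop 2 13 (forLoop 2 14 p)

variable (u : ℕ → unitInterval) {s : State}

lemma run_ite_pos {b : Test} {p q : BoundedProgram} (h : b.Holds s) :
    (ite b p q).run u s = p.run u s := if_pos h

lemma run_ite_neg {b : Test} {p q : BoundedProgram} (h : ¬ b.Holds s) :
    (ite b p q).run u s = q.run u s := if_neg h

/-- The invariant rule for loops over pairs, where the invariant depends on the set of the pairs that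
have been dealt with. -/
lemma run_pairLoop_induction {p : BoundedProgram} {k : ℕ} (h13 : p.writesInt 13 = false)
    (h14 : p.writesInt 14 = false) (h2 : p.writesInt 2 = false) (hk : s.int 2 0 0 = k)
    (I : (ℕ → ℕ → Prop) → State → Prop)
    (hI : ∀ P st v, I P st → I P (st.setInt 13 0 0 v) ∧ I P (st.setInt 14 0 0 v))
    (h0 : I (fun _ _ => False) s)
    (hstep : ∀ a < k, ∀ b < k, ∀ P st, Frame (pairLoop p) s st → st.int 13 0 0 = a →
      st.int 14 0 0 = b → I P st → I (fun i j => P i j ∨ (i = a ∧ j = b)) (p.run u st)) :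
    I (fun i j => i < k ∧ j < k) ((pairLoop p).run u s) := by
  refine run_forLoop_induction u (by simp [writesInt, h13]) hk
    (fun m st => I (fun i j => i < m ∧ j < k) st) ?_ ?_
  · simpa using (hI _ _ 0 h0).1
  · intro a ha st hf h13a hst
    refine (hI _ _ _ ?_).1
    have hk' : st.int 2 0 0 = k := by rw [hf.int 2 (by simp [writesInt, h2]), hk]
    have := run_forLoop_induction u (s := st) (v := 14) h14 hk'
      (fun m st => I (fun i j => (i < a ∧ j < k) ∨ (i = a ∧ j < m)) st) (by
        simpa using (hI _ _ 0 hst).2) (by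
        intro b hb st' hf' h14b hst'
        refine (hI _ _ _ ?_).2
        have hframe : Frame (pairLoop p) s st' := by
          refine hf.trans ⟨fun x hx => hf'.int x ?_, fun x hx => hf'.real x ?_,
            fun hx => hf'.used ?_⟩
          · simp only [writesInt, Bool.or_eq_false_iff] at hx ⊢
            exact hx.2
          · exact hx
          · exact hx
        have := hstep a ha b hb _ st' hframe
          (by rw [hf'.int 13 (by simp [writesInt, h13]), h13a]) h14b hst'
        convert this using 3
        omega)
    convert this using 3
    omega

/-- The distance of the centers `13` and `14`. -/
def distCell : BoundedProgram :=
  seq (setReal 3 (.var 13) (.var 14) (.ofInt (.const 0)))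
    (forLoop 1 11 (ite (.realLt (coordExp 13 11) (coordExp 14 11))
      (setReal 3 (.var 13) (.var 14)
        (.add (.get 3 (.var 13) (.var 14)) (.sub (coordExp 14 11) (coordExp 13 11))))
      (setReal 3 (.var 13) (.var 14)
        (.add (.get 3 (.var 13) (.var 14)) (.sub (coordExp 13 11) (coordExp 14 11))))))

/-- The distance of two centers in the memory. -/
def memDist (s : State) (a b : ℕ) : ℝ :=
  ∑ f ∈ Finset.range (s.int 1 0 0), |s.real 1 a f - s.real 1 b f|

lemma run_distCell (s : State) (i j : ℕ) :
    (distCell.run u s).real 3 i j =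
      if i = s.int 13 0 0 ∧ j = s.int 14 0 0 then memDist s (s.int 13 0 0) (s.int 14 0 0)
      else s.real 3 i j := by
  rw [distCell, run]
  revert i j
  refine run_forLoop_induction u (s := (setReal 3 (.var 13) (.var 14) (.ofInt (.const 0))).run u s)
    ?_ (N := s.int 1 0 0) rfl (fun m st => ∀ i j, st.real 3 i j =
    if i = s.int 13 0 0 ∧ j = s.int 14 0 0 then
      ∑ f ∈ Finset.range m, |s.real 1 (s.int 13 0 0) f - s.real 1 (s.int 14 0 0) f|
    else s.real 3 i j) ?_ ?_
  · rfl
  · intro i j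
    simp [run, State.real_setInt, State.real_setReal, IExp.eval, RExp.eval]
  · intro m hm st hf hv hst i j
    have e13 : st.int 13 = s.int 13 := hf.int 13 rfl
    have e14 : st.int 14 = s.int 14 := hf.int 14 rfl
    have e1 : st.real 1 = s.real 1 :=
      (hf.real 1 rfl).trans (State.real_setReal_ne _ _ _ _ _ _ (by decide))
    have hb : (Test.realLt (coordExp 13 11) (coordExp 14 11)).Holds st ↔
        s.real 1 (s.int 13 0 0) m < s.real 1 (s.int 14 0 0) m := by
      simp only [Test.Holds, RExp.eval, IExp.eval, e13, e14, e1, hv]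
    rw [Finset.sum_range_succ, State.real_setInt]
    by_cases h : s.real 1 (s.int 13 0 0) m < s.real 1 (s.int 14 0 0) m
    · rw [run_ite_pos u (hb.2 h), abs_of_neg (by linarith)]
      simp only [run, RExp.eval, IExp.eval, e13, e14, e1, hv, State.real_setReal, hst, and_self,
        if_true]
      split_ifs
      · ring
      · rfl
    · rw [run_ite_neg u (mt hb.1 h), abs_of_nonneg (by linarith)]
      simp only [run, RExp.eval, IExp.eval, e13, e14, e1, hv, State.real_setReal, hst, and_self,
        if_true]
      split_ifs <;> rfl

/-- The matrix of the distances. -/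
def distProg : BoundedProgram := pairLoop distCell

lemma run_distProg {k : ℕ} (hk : s.int 2 0 0 = k) :
    ∀ i j, i < k ∧ j < k → (distProg.run u s).real 3 i j = memDist s i j := by
  refine run_pairLoop_induction u (by rfl) (by rfl) (by rfl) hk
    (fun P st => ∀ i j, P i j → st.real 3 i j = memDist s i j) (fun _ _ _ h => ⟨h, h⟩)
    (fun _ _ h => h.elim) ?_
  intro a ha b hb P st hf h13 h14 hst i j hij
  rw [run_distCell, h13, h14]
  have : memDist st = memDist s := by
    funext a b
    simp only [memDist, hf.int 1 rfl, hf.real 1 rfl]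
  split_ifs with h
  · rw [this, h.1, h.2]
  · exact hst i j (hij.resolve_right h)

/-- The diameter. -/
def diamProg : BoundedProgram :=
  seq (setReal 5 (.const 0) (.const 0) (.ofInt (.const 0)))
    (pairLoop (ite (.and (eqTest (.get 4 (.var 13) (.const 0)) (.get 4 (.var 14) (.const 0)))
        (.realLt (.get 5 (.const 0) (.const 0)) (.get 3 (.var 13) (.var 14))))
      (setReal 5 (.const 0) (.const 0) (.get 3 (.var 13) (.var 14))) skip))

lemma run_diamProg {k : ℕ} (hk : s.int 2 0 0 = k) :
    0 ≤ (diamProg.run u s).real 5 0 0 ∧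
    (∀ i j, i < k ∧ j < k → s.int 4 i 0 = s.int 4 j 0 →
      s.real 3 i j ≤ (diamProg.run u s).real 5 0 0) ∧
    ((diamProg.run u s).real 5 0 0 = 0 ∨ ∃ i j, (i < k ∧ j < k) ∧ s.int 4 i 0 = s.int 4 j 0 ∧
      (diamProg.run u s).real 5 0 0 = s.real 3 i j) := by
  rw [diamProg, run]
  refine run_pairLoop_induction u
    (s := (setReal 5 (.const 0) (.const 0) (.ofInt (.const 0))).run u s) ?_ ?_ ?_ hk
    (fun P st => 0 ≤ st.real 5 0 0 ∧
      (∀ i j, P i j → s.int 4 i 0 = s.int 4 j 0 → s.real 3 i j ≤ st.real 5 0 0) ∧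
      (st.real 5 0 0 = 0 ∨ ∃ i j, P i j ∧ s.int 4 i 0 = s.int 4 j 0 ∧
        st.real 5 0 0 = s.real 3 i j)) (fun _ _ _ h => ⟨h, h⟩) ?_ ?_
  · rfl
  · rfl
  · rfl
  · simp [run, State.real_setReal, IExp.eval, RExp.eval]
  · rintro a ha b hb P st hf h13 h14 ⟨h0, h1, h2⟩
    have e4 : st.int 4 = s.int 4 := hf.int 4 rfl
    have e3 : st.real 3 = s.real 3 :=
      (hf.real 3 rfl).trans (State.real_setReal_ne _ _ _ _ _ _ (by decide))
    have hb : (Test.and (eqTest (.get 4 (.var 13) (.const 0)) (.get 4 (.var 14) (.const 0)))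
        (.realLt (.get 5 (.const 0) (.const 0)) (.get 3 (.var 13) (.var 14)))).Holds st ↔
        s.int 4 a 0 = s.int 4 b 0 ∧ st.real 5 0 0 < s.real 3 a b := by
      simp only [Test.Holds, holds_eqTest, RExp.eval, IExp.eval, h13, h14, e4, e3]
    by_cases h : s.int 4 a 0 = s.int 4 b 0 ∧ st.real 5 0 0 < s.real 3 a b
    · rw [run_ite_pos u (hb.2 h)]
      simp only [run, RExp.eval, IExp.eval, h13, h14, e3, State.real_setReal, and_self, if_true]
      refine ⟨h0.trans h.2.le, ?_, Or.inr ⟨a, b, Or.inr ⟨rfl, rfl⟩, h.1, rfl⟩⟩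
      rintro i j (hij | ⟨rfl, rfl⟩) hE
      · exact (h1 i j hij hE).trans h.2.le
      · exact le_rfl
    · rw [run_ite_neg u (mt hb.1 h)]
      refine ⟨h0, ?_, h2.imp_right fun ⟨i, j, hij, h3⟩ => ⟨i, j, Or.inl hij, h3⟩⟩
      rintro i j (hij | ⟨rfl, rfl⟩) hE
      · exact h1 i j hij hE
      · exact not_lt.1 fun h' => h ⟨hE, h'⟩

/-! ### The program: cells -/

/-- The flags for the cut at the coordinate `11` of the center `12`: whether it separates an
unseparated pair at a large distance (`20`), and at a small distance (`21`). -/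
def flagProg : BoundedProgram :=
  pairLoop (ite (.and (eqTest (.get 4 (.var 13) (.const 0)) (.get 4 (.var 14) (.const 0)))
      (.and (.not (.realLt (coordExp 12 11) (coordExp 13 11)))
        (.realLt (coordExp 12 11) (coordExp 14 11))))
    (ite (.realLt (.get 5 (.const 0) (.const 0))
        (.mul (.mul (.mul (.ofInt (.var 2)) (.ofInt (.var 2))) (.ofInt (.var 2)))
          (.get 3 (.var 13) (.var 14))))
      (setInt 20 (.const 0) (.const 0) (.const 1)) (setInt 21 (.const 0) (.const 0) (.const 1)))
    skip)

/-- The cut at the coordinate `f` of the center `j` separates the unseparated centers `a` and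
`b`. -/
def MemSep (s : State) (f j a b : ℕ) : Prop :=
  s.int 4 a 0 = s.int 4 b 0 ∧ ¬ s.real 1 j f < s.real 1 a f ∧ s.real 1 j f < s.real 1 b f

/-- The pair `(a, b)` is too far apart for its cuts to be forbidden. -/
def MemFar (s : State) (a b : ℕ) : Prop :=
  s.real 5 0 0 < (s.int 2 0 0 : ℝ) * s.int 2 0 0 * s.int 2 0 0 * s.real 3 a b

lemma run_flagProg {k : ℕ} (hk : s.int 2 0 0 = k) (h20 : s.int 20 0 0 = 0)
    (h21 : s.int 21 0 0 = 0) :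
    ((flagProg.run u s).int 20 0 0 = 1 ↔ ∃ a b, (a < k ∧ b < k) ∧
      MemSep s (s.int 11 0 0) (s.int 12 0 0) a b ∧ MemFar s a b) ∧
    ((flagProg.run u s).int 21 0 0 = 1 ↔ ∃ a b, (a < k ∧ b < k) ∧
      MemSep s (s.int 11 0 0) (s.int 12 0 0) a b ∧ ¬ MemFar s a b) := by
  refine run_pairLoop_induction u (by rfl) (by rfl) (by rfl) hk
    (fun P st => (st.int 20 0 0 = 1 ↔ ∃ a b, P a b ∧
      MemSep s (s.int 11 0 0) (s.int 12 0 0) a b ∧ MemFar s a b) ∧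
    (st.int 21 0 0 = 1 ↔ ∃ a b, P a b ∧
      MemSep s (s.int 11 0 0) (s.int 12 0 0) a b ∧ ¬ MemFar s a b)) (fun _ _ _ h => ?_) ?_ ?_
  · simpa [State.int_setInt_ne] using h
  · simp [h20, h21]
  · rintro a ha b hb P st hf h13 h14 ⟨h1, h2⟩
    have hex (Q : ℕ → ℕ → Prop) : (∃ i j, (P i j ∨ (i = a ∧ j = b)) ∧ Q i j) ↔
        (∃ i j, P i j ∧ Q i j) ∨ Q a b := by
      constructor
      · rintro ⟨i, j, hij | ⟨rfl, rfl⟩, h⟩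
        · exact Or.inl ⟨i, j, hij, h⟩
        · exact Or.inr h
      · rintro (⟨i, j, hij, h⟩ | h)
        · exact ⟨i, j, Or.inl hij, h⟩
        · exact ⟨a, b, Or.inr ⟨rfl, rfl⟩, h⟩
    rw [hex, hex, ← h1, ← h2]
    have hsep : (Test.and (eqTest (.get 4 (.var 13) (.const 0)) (.get 4 (.var 14) (.const 0)))
        (.and (.not (.realLt (coordExp 12 11) (coordExp 13 11)))
        (.realLt (coordExp 12 11) (coordExp 14 11)))).Holds st ↔
        MemSep s (s.int 11 0 0) (s.int 12 0 0) a b := by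
      simp only [Test.Holds, holds_eqTest, RExp.eval, IExp.eval, h13, h14, hf.int 4 rfl,
        hf.int 11 rfl, hf.int 12 rfl, hf.real 1 rfl, MemSep]
    have hfar : (Test.realLt (.get 5 (.const 0) (.const 0))
        (.mul (.mul (.mul (.ofInt (.var 2)) (.ofInt (.var 2))) (.ofInt (.var 2)))
          (.get 3 (.var 13) (.var 14)))).Holds st ↔ MemFar s a b := by
      simp only [Test.Holds, RExp.eval, IExp.eval, h13, h14, hf.int 2 rfl, hf.real 3 rfl,
        hf.real 5 rfl, MemFar]
    by_cases hS : MemSep s (s.int 11 0 0) (s.int 12 0 0) a b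
    · rw [run_ite_pos u (hsep.2 hS)]
      by_cases hF : MemFar s a b
      · rw [run_ite_pos u (hfar.2 hF)]
        simp [run, IExp.eval, hS, hF, State.int_setInt, State.int_setInt_ne]
      · rw [run_ite_neg u (mt hfar.1 hF)]
        simp [run, IExp.eval, hS, hF, State.int_setInt, State.int_setInt_ne]
    · rw [run_ite_neg u (mt hsep.1 hS)]
      simp [run, hS]

/-- Set the flag `22` if the center `13` has a smaller number than the center `12` and the same
coordinate. -/
def dupProg : BoundedProgram :=
  ite (.and (.intLt (.var 13) (.var 12)) (realEqTest (coordExp 13 11) (coordExp 12 11)))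
    (setInt 22 (.const 0) (.const 0) (.const 1)) skip

/-- Update the next coordinate by that of the center `13`. -/
def nextStep : BoundedProgram :=
  ite (.and (.realLt (coordExp 12 11) (coordExp 13 11))
      (.not (.and (.realLt (coordExp 12 11) (.get 7 (.const 0) (.const 0)))
        (.not (.realLt (coordExp 13 11) (.get 7 (.const 0) (.const 0)))))))
    (setReal 7 (.const 0) (.const 0) (coordExp 13 11)) skip

/-- The flag `22` for a center with a smaller number and the same coordinate, and the next
coordinate. -/
def nextProg : BoundedProgram := forLoop 2 13 (seq dupProg nextStep)

/-- The value `v` is the least of the numbers `x a` beyond `θ` with `a < k`, and `θ` if there are no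
such numbers. -/
def IsNext (k : ℕ) (x : ℕ → ℝ) (θ v : ℝ) : Prop :=
  (∀ a < k, θ < x a → θ < v ∧ v ≤ x a) ∧ (v = θ ∨ ∃ a < k, x a = v)

lemma run_nextProg {k : ℕ} (hk : s.int 2 0 0 = k) (h22 : s.int 22 0 0 = 0)
    (h7 : s.real 7 0 0 = s.real 1 (s.int 12 0 0) (s.int 11 0 0)) :
    ((nextProg.run u s).int 22 0 0 = 1 ↔ ∃ a < k, a < s.int 12 0 0 ∧
      s.real 1 a (s.int 11 0 0) = s.real 1 (s.int 12 0 0) (s.int 11 0 0)) ∧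
    IsNext k (fun a => s.real 1 a (s.int 11 0 0)) (s.real 1 (s.int 12 0 0) (s.int 11 0 0))
      ((nextProg.run u s).real 7 0 0) := by
  set θ := s.real 1 (s.int 12 0 0) (s.int 11 0 0) with hθ
  refine run_forLoop_induction u (by rfl) hk
    (fun m st => (st.int 22 0 0 = 1 ↔ ∃ a < m, a < s.int 12 0 0 ∧
      s.real 1 a (s.int 11 0 0) = θ) ∧
      IsNext m (fun a => s.real 1 a (s.int 11 0 0)) θ (st.real 7 0 0)) ?_ ?_
  · simp [State.int_setInt_ne, State.real_setInt, h22, h7, IsNext]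
  · rintro a ha st hf h13 ⟨h1, h2, h3⟩
    have hex (Q : ℕ → Prop) : (∃ i < a + 1, Q i) ↔ (∃ i < a, Q i) ∨ Q a := by
      constructor
      · rintro ⟨i, hi, h⟩
        rcases Nat.lt_succ_iff_lt_or_eq.1 hi with hi | rfl
        · exact Or.inl ⟨i, hi, h⟩
        · exact Or.inr h
      · rintro (⟨i, hi, h⟩ | h)
        · exact ⟨i, by omega, h⟩
        · exact ⟨a, by omega, h⟩
    set st1 := dupProg.run u st with hst1
    have hf1 := frame_run u dupProg st
    have hf2 := frame_run u nextStep st1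
    rw [← hst1] at hf1
    rw [run, ← hst1]
    refine ⟨?_, ?_⟩
    · rw [hex, ← h1, State.int_setInt_ne _ _ _ _ _ _ (by decide), hf2.int 22 rfl, hst1]
      have hb : (Test.and (.intLt (.var 13) (.var 12))
          (realEqTest (coordExp 13 11) (coordExp 12 11))).Holds st ↔
          a < s.int 12 0 0 ∧ s.real 1 a (s.int 11 0 0) = θ := by
        simp only [Test.Holds, holds_realEqTest, RExp.eval, IExp.eval, h13, hf.int 11 rfl,
          hf.int 12 rfl, hf.real 1 rfl, ← hθ]
      by_cases hS : a < s.int 12 0 0 ∧ s.real 1 a (s.int 11 0 0) = θ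
      · rw [dupProg, run_ite_pos u (hb.2 hS)]
        simp [run, hS, State.int_setInt, IExp.eval]
      · rw [dupProg, run_ite_neg u (mt hb.1 hS)]
        simp [run, hS]
    · have hb : (Test.and (.realLt (coordExp 12 11) (coordExp 13 11))
          (.not (.and (.realLt (coordExp 12 11) (.get 7 (.const 0) (.const 0)))
            (.not (.realLt (coordExp 13 11) (.get 7 (.const 0) (.const 0))))))).Holds st1 ↔
          θ < s.real 1 a (s.int 11 0 0) ∧ ¬ (θ < st.real 7 0 0 ∧
            ¬ s.real 1 a (s.int 11 0 0) < st.real 7 0 0) := by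
        simp only [Test.Holds, RExp.eval, IExp.eval, hf1.int 11 rfl, hf1.int 12 rfl,
          hf1.int 13 rfl, hf1.real 1 rfl, hf1.real 7 rfl, h13, hf.int 11 rfl,
          hf.int 12 rfl, hf.real 1 rfl, ← hθ]
      rw [State.real_setInt]
      by_cases h : θ < s.real 1 a (s.int 11 0 0) ∧ ¬ (θ < st.real 7 0 0 ∧
            ¬ s.real 1 a (s.int 11 0 0) < st.real 7 0 0)
      · rw [nextStep, run_ite_pos u (hb.2 h)]
        simp only [run, RExp.eval, IExp.eval, hf1.int 13 rfl, hf1.int 11 rfl, hf1.real 1 rfl, h13,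
          hf.int 11 rfl, hf.real 1 rfl, State.real_setReal, and_self, if_true]
        refine ⟨fun i hi hlt => ?_, Or.inr ⟨a, by omega, rfl⟩⟩
        rcases Nat.lt_succ_iff_lt_or_eq.1 hi with hi | rfl
        · obtain ⟨h4, h5⟩ := h2 i hi hlt
          refine ⟨h.1, ?_⟩
          by_contra hc
          exact h.2 ⟨h4, fun hc' => hc (hc'.le.trans h5)⟩
        · exact ⟨h.1, le_rfl⟩
      · rw [nextStep, run_ite_neg u (mt hb.1 h)]
        simp only [run, hf1.real 7 rfl]
        refine ⟨fun i hi hlt => ?_, h3.imp_right fun ⟨i, hi, h⟩ => ⟨i, by omega, h⟩⟩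
        rcases Nat.lt_succ_iff_lt_or_eq.1 hi with hi | rfl
        · exact h2 i hi hlt
        · have : θ < st.real 7 0 0 ∧ ¬ s.real 1 i (s.int 11 0 0) < st.real 7 0 0 := by
            by_contra hc
            exact h ⟨hlt, hc⟩
          exact ⟨this.1, not_lt.1 this.2⟩

/-- The initial values for `cellProg`. -/
def cellInit : BoundedProgram :=
  seq (setInt 20 (.const 0) (.const 0) (.const 0)) (seq (setInt 21 (.const 0) (.const 0) (.const 0))
    (seq (setInt 22 (.const 0) (.const 0) (.const 0))
      (setReal 7 (.const 0) (.const 0) (coordExp 12 11))))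

/-- Store the length of the cell, which depends on the flags. -/
def cellStore : BoundedProgram :=
  ite (.and (eqTest (.var 20) (.const 1)) (.and (.not (eqTest (.var 21) (.const 1)))
      (.not (eqTest (.var 22) (.const 1)))))
    (setReal 4 (.var 11) (.var 12) (.sub (.get 7 (.const 0) (.const 0)) (coordExp 12 11)))
    (setReal 4 (.var 11) (.var 12) (.ofInt (.const 0)))

/-- The length of the cell for the feature `11` and the center `12`, which is added to the total
length. -/
def cellProg : BoundedProgram :=
  seq cellInit (seq flagProg (seq nextProg (seq cellStore
    (setReal 8 (.const 0) (.const 0)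
      (.add (.get 8 (.const 0) (.const 0)) (.get 4 (.var 11) (.var 12)))))))

/-- The interval from the center `j` on makes part of the set from which the cut is picked. -/
def MemCell (s : State) (k f j : ℕ) : Prop :=
  (∃ a b, (a < k ∧ b < k) ∧ MemSep s f j a b ∧ MemFar s a b) ∧
    (¬ ∃ a b, (a < k ∧ b < k) ∧ MemSep s f j a b ∧ ¬ MemFar s a b) ∧
    ¬ ∃ a < k, a < j ∧ s.real 1 a f = s.real 1 j f

lemma run_cellProg {k f j : ℕ} (hk : s.int 2 0 0 = k) (hf : s.int 11 0 0 = f)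
    (hj : s.int 12 0 0 = j) :
    (∀ f' j', ¬ (f' = f ∧ j' = j) → (cellProg.run u s).real 4 f' j' = s.real 4 f' j') ∧
    (cellProg.run u s).real 8 0 0 = s.real 8 0 0 + (cellProg.run u s).real 4 f j ∧
    (MemCell s k f j → IsNext k (fun a => s.real 1 a f) (s.real 1 j f)
      (s.real 1 j f + (cellProg.run u s).real 4 f j)) ∧
    (¬ MemCell s k f j → (cellProg.run u s).real 4 f j = 0) := by
  subst hf hj
  set s1 := cellInit.run u s with hs1
  have f1 := frame_run u cellInit s
  rw [← hs1] at f1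
  have h20 : s1.int 20 0 0 = 0 := by
    simp [hs1, cellInit, run, State.int_setReal, State.int_setInt_ne, State.int_setInt, IExp.eval]
  have h21 : s1.int 21 0 0 = 0 := by
    simp [hs1, cellInit, run, State.int_setReal, State.int_setInt_ne, State.int_setInt, IExp.eval]
  have h22 : s1.int 22 0 0 = 0 := by
    simp [hs1, cellInit, run, State.int_setReal, State.int_setInt, IExp.eval]
  have h7 : s1.real 7 0 0 = s.real 1 (s.int 12 0 0) (s.int 11 0 0) := by
    simp [hs1, cellInit, run, State.real_setReal, State.int_setInt_ne, State.real_setInt, IExp.eval,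
      RExp.eval]
  obtain ⟨hA, hB⟩ := run_flagProg u (by rw [f1.int 2 rfl, hk]) h20 h21
  set s2 := flagProg.run u s1 with hs2
  have f2 := frame_run u flagProg s1
  rw [← hs2] at f2
  obtain ⟨hdup, hnext⟩ := run_nextProg u (s := s2) (by rw [f2.int 2 rfl, f1.int 2 rfl, hk])
    (by rw [f2.int 22 rfl, h22]) (by
      rw [f2.real 7 rfl, f2.int 12 rfl, f2.int 11 rfl, f2.real 1 rfl, h7, f1.int 12 rfl,
        f1.int 11 rfl, f1.real 1 rfl])
  set s3 := nextProg.run u s2 with hs3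
  have f3 := frame_run u nextProg s2
  rw [← hs3] at f3
  have hsep : MemSep s1 = MemSep s := by
    funext f j a b
    simp only [MemSep, f1.int 4 rfl, f1.real 1 rfl]
  have hfar : MemFar s1 = MemFar s := by
    funext a b
    simp only [MemFar, f1.int 2 rfl, f1.real 3 rfl, f1.real 5 rfl]
  have e11 : s3.int 11 = s.int 11 := by rw [f3.int 11 rfl, f2.int 11 rfl, f1.int 11 rfl]
  have e12 : s3.int 12 = s.int 12 := by rw [f3.int 12 rfl, f2.int 12 rfl, f1.int 12 rfl]
  have e1 : s3.real 1 = s.real 1 := by rw [f3.real 1 rfl, f2.real 1 rfl, f1.real 1 rfl]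
  have e4 : s3.real 4 = s.real 4 := by rw [f3.real 4 rfl, f2.real 4 rfl, f1.real 4 rfl]
  have e8 : s3.real 8 = s.real 8 := by rw [f3.real 8 rfl, f2.real 8 rfl, f1.real 8 rfl]
  have hcell : (s3.int 20 0 0 = 1 ∧ ¬ s3.int 21 0 0 = 1 ∧ ¬ s3.int 22 0 0 = 1) ↔
      MemCell s k (s.int 11 0 0) (s.int 12 0 0) := by
    rw [f3.int 20 rfl, f3.int 21 rfl, hA, hB, hdup, hsep, hfar, f1.int 11 rfl, f1.int 12 rfl,
      f2.int 11 rfl, f2.int 12 rfl, f2.real 1 rfl, f1.int 11 rfl, f1.int 12 rfl, f1.real 1 rfl]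
    rfl
  rw [f2.int 11 rfl, f2.int 12 rfl, f2.real 1 rfl, f1.int 11 rfl, f1.int 12 rfl,
    f1.real 1 rfl] at hnext
  set s4 := cellStore.run u s3 with hs4
  have f4 := frame_run u cellStore s3
  rw [← hs4] at f4
  have hrun : (cellProg.run u s).real 4 = s4.real 4 :=
    State.real_setReal_ne _ _ _ _ _ _ (by decide)
  have hrun8 : (cellProg.run u s).real 8 0 0 =
      s.real 8 0 0 + s4.real 4 (s.int 11 0 0) (s.int 12 0 0) := by
    rw [← e11, ← e12, ← e8, ← f4.real 8 rfl, ← f4.int 11 rfl, ← f4.int 12 rfl]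
    rfl
  have hb : (Test.and (eqTest (.var 20) (.const 1)) (.and (.not (eqTest (.var 21) (.const 1)))
      (.not (eqTest (.var 22) (.const 1))))).Holds s3 ↔
      MemCell s k (s.int 11 0 0) (s.int 12 0 0) := by
    rw [← hcell]
    simp only [Test.Holds, holds_eqTest, IExp.eval]
  rw [hrun, hrun8]
  by_cases hc : MemCell s k (s.int 11 0 0) (s.int 12 0 0)
  · rw [cellStore, run_ite_pos u (hb.2 hc)] at hs4
    simp only [run, RExp.eval, IExp.eval, e11, e12, e1] at hs4
    refine ⟨fun f' j' h => ?_, rfl, fun _ => ?_, fun h => absurd hc h⟩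
    · rw [hs4, State.real_setReal, if_neg h, e4]
    · rw [hs4, State.real_setReal, if_pos ⟨rfl, rfl⟩, add_sub_cancel]
      exact hnext
  · rw [cellStore, run_ite_neg u (mt hb.1 hc)] at hs4
    simp only [run, RExp.eval, IExp.eval, e11, e12] at hs4
    refine ⟨fun f' j' h => ?_, rfl, fun h => absurd h hc, fun _ => ?_⟩
    · rw [hs4, State.real_setReal, if_neg h, e4]
    · rw [hs4, State.real_setReal, if_pos ⟨rfl, rfl⟩, Nat.cast_zero]

/-- The lengths of the cells, and their sum. -/
def lenProg : BoundedProgram :=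
  seq (setReal 8 (.const 0) (.const 0) (.ofInt (.const 0))) (forLoop 1 11 (forLoop 2 12 cellProg))

lemma run_lenProg {d k : ℕ} (hd : s.int 1 0 0 = d) (hk : s.int 2 0 0 = k) {g : ℕ → ℕ → ℝ}
    (hg : ∀ f < d, ∀ j < k, ∀ st, Frame lenProg s st → st.int 11 0 0 = f → st.int 12 0 0 = j →
      (cellProg.run u st).real 4 f j = g f j) :
    (∀ f < d, ∀ j < k, (lenProg.run u s).real 4 f j = g f j) ∧
    (lenProg.run u s).real 8 0 0 = ∑ f ∈ Finset.range d, ∑ j ∈ Finset.range k, g f j := by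
  set s0 := (setReal 8 (.const 0) (.const 0) (.ofInt (.const 0))).run u s with hs0
  have f0 : Frame lenProg s s0 := by
    have := frame_run u (setReal 8 (.const 0) (.const 0) (.ofInt (.const 0))) s
    refine ⟨fun a _ => this.int a rfl, fun a h => this.real a ?_, fun _ => this.used rfl⟩
    simp only [lenProg, writesReal, Bool.or_eq_false_iff] at h
    exact h.1
  rw [lenProg, run, ← hs0]
  refine run_forLoop_induction u (by rfl) (by rw [f0.int 1 rfl, hd]) (fun m st =>
    (∀ f < m, ∀ j < k, st.real 4 f j = g f j) ∧
      st.real 8 0 0 = ∑ f ∈ Finset.range m, ∑ j ∈ Finset.range k, g f j) ?_ ?_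
  · simp [hs0, run, State.real_setInt, State.real_setReal, IExp.eval, RExp.eval]
  · rintro f hfd st hf h11 ⟨h1, h2⟩
    simp only [State.real_setInt]
    have := run_forLoop_induction u (p := cellProg) (s := st) (b := 2) (v := 12) rfl
      (by rw [hf.int 2 rfl, f0.int 2 rfl, hk])
      (fun m st' => (∀ f' j', ¬ (f' = f ∧ j' < m) → st'.real 4 f' j' = st.real 4 f' j') ∧
        (∀ j < m, st'.real 4 f j = g f j) ∧
        st'.real 8 0 0 = st.real 8 0 0 + ∑ j ∈ Finset.range m, g f j)
      (by simp [State.real_setInt]) (by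
        rintro j hjk st' hf' h12 ⟨h3, h4, h5⟩
        have hfr : Frame lenProg s st' := by
          refine f0.trans (Frame.trans
            ⟨fun a h => hf.int a ?_, fun a h => hf.real a ?_, fun h => hf.used ?_⟩
            ⟨fun a h => hf'.int a ?_, fun a h => hf'.real a ?_, fun h => hf'.used ?_⟩)
          all_goals
            simp only [lenProg, writesInt, writesReal, usesRandom, Bool.or_eq_false_iff,
              Bool.false_or] at h ⊢
            tauto
        have h11' : st'.int 11 0 0 = f := by rw [hf'.int 11 rfl, h11]
        obtain ⟨c1, c2, -, -⟩ := run_cellProg u (s := st') (by rw [hfr.int 2 rfl, hk]) h11' h12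
        have hgj := hg f hfd j hjk st' hfr h11' h12
        simp only [State.real_setInt]
        refine ⟨fun f' j' h => ?_, fun j' h => ?_, ?_⟩
        · rw [c1 f' j' (by omega), h3 f' j' (by omega)]
        · rcases Nat.lt_succ_iff_lt_or_eq.1 h with h | rfl
          · rw [c1 f j' (by omega), h4 j' h]
          · exact hgj
        · rw [c2, h5, hgj, Finset.sum_range_succ, add_assoc])
    obtain ⟨h3, h4, h5⟩ := this
    refine ⟨fun f' hf' j hj => ?_, ?_⟩
    · rcases Nat.lt_succ_iff_lt_or_eq.1 hf' with h | rfl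
      · rw [h3 f' j (by omega), h1 f' h j hj]
      · exact h4 j hj
    · rw [h5, h2, Finset.sum_range_succ]

end BoundedProgram
end ExplainableClustering

namespace ExplainableClustering

namespace BoundedProgram

variable (u : ℕ → unitInterval) {s : State}

/-! ### The program: the random cut -/

/-- The state of the walk of `pickStep` in the memory. -/
def pickState (s : State) : ℕ × ℝ × ℕ × ℝ :=
  (s.int 23 0 0, s.real 9 0 0, s.int 24 0 0, s.real 10 0 0)

/-- The step of the walk for the feature `11` and the center `12`. -/
def pickCell : BoundedProgram :=
  ite (.intLt (.var 23) (.const 1))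
    (ite (.realLt (.get 9 (.const 0) (.const 0)) (.get 4 (.var 11) (.var 12)))
      (seq (setInt 23 (.const 0) (.const 0) (.const 1)) (seq
        (setInt 24 (.const 0) (.const 0) (.var 11))
        (setReal 10 (.const 0) (.const 0)
          (.add (coordExp 12 11) (.get 9 (.const 0) (.const 0))))))
      (setReal 9 (.const 0) (.const 0)
        (.sub (.get 9 (.const 0) (.const 0)) (.get 4 (.var 11) (.var 12))))) skip

lemma pickState_run_pickCell (s : State) : pickState (pickCell.run u s) =
    pickStep (s.real 4) (s.real 1) (pickState s) (s.int 11 0 0) (s.int 12 0 0) := by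
  have h1 : (Test.intLt (.var 23) (.const 1)).Holds s ↔ s.int 23 0 0 < 1 := Iff.rfl
  have h2 : (Test.realLt (.get 9 (.const 0) (.const 0)) (.get 4 (.var 11) (.var 12))).Holds s ↔
      s.real 9 0 0 < s.real 4 (s.int 11 0 0) (s.int 12 0 0) := Iff.rfl
  rw [pickCell, pickStep]
  by_cases h : s.int 23 0 0 < 1
  · rw [run_ite_pos u (h1.2 h), if_pos (show (pickState s).1 < 1 from h)]
    by_cases h' : s.real 9 0 0 < s.real 4 (s.int 11 0 0) (s.int 12 0 0)
    · rw [run_ite_pos u (h2.2 h'),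
        if_pos (show (pickState s).2.1 < s.real 4 (s.int 11 0 0) (s.int 12 0 0) from h')]
      simp [run, pickState, IExp.eval, RExp.eval, State.int_setInt, State.int_setInt_ne,
        State.real_setInt, State.real_setReal, State.real_setReal_ne, State.int_setReal]
    · rw [run_ite_neg u (mt h2.1 h'),
        if_neg (show ¬ (pickState s).2.1 < s.real 4 (s.int 11 0 0) (s.int 12 0 0) from h')]
      simp [run, pickState, IExp.eval, RExp.eval, State.real_setReal, State.real_setReal_ne,
        State.int_setReal]
  · rw [run_ite_neg u (mt h1.1 h), if_neg (show ¬ (pickState s).1 < 1 from h)]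
    rfl

/-- The start of the walk, at a random position. -/
def pickInit : BoundedProgram :=
  seq (random 9 (.const 0) (.const 0)) (seq
    (setReal 9 (.const 0) (.const 0)
      (.mul (.get 9 (.const 0) (.const 0)) (.get 8 (.const 0) (.const 0)))) (seq
    (setInt 23 (.const 0) (.const 0) (.const 0)) (seq
    (setInt 24 (.const 0) (.const 0) (.const 0))
    (setReal 10 (.const 0) (.const 0) (.ofInt (.const 0))))))

lemma pickState_run_pickInit (s : State) :
    pickState (pickInit.run u s) = (0, (u s.used : ℝ) * s.real 8 0 0, 0, 0) := by
  simp [pickInit, run, pickState, IExp.eval, RExp.eval, State.int_setInt, State.int_setInt_ne,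
    State.real_setInt, State.real_setReal, State.real_setReal_ne, State.int_setReal]

/-- The choice of the random cut. -/
def pickProg : BoundedProgram := seq pickInit (forLoop 1 11 (forLoop 2 12 pickCell))

lemma used_run_pickProg (s : State) : (pickProg.run u s).used = s.used + 1 :=
  (frame_run u (forLoop 1 11 (forLoop 2 12 pickCell)) (pickInit.run u s)).used rfl

lemma pickState_run_pickProg {d k : ℕ} (hd : s.int 1 0 0 = d) (hk : s.int 2 0 0 = k) :
    pickState (pickProg.run u s) =
      pickAll d k (s.real 4) (s.real 1) (0, (u s.used : ℝ) * s.real 8 0 0, 0, 0) := by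
  rw [← pickState_run_pickInit, pickProg, run]
  have f0 := frame_run u pickInit s
  set s0 := pickInit.run u s
  have hset (st : State) (v : ℕ) : pickState (st.setInt 11 0 0 v) = pickState st ∧
      pickState (st.setInt 12 0 0 v) = pickState st := by
    simp [pickState, State.int_setInt_ne, State.real_setInt]
  refine run_forLoop_induction u (s := s0) ?_ (by rw [f0.int 1 rfl, hd]) (fun m st => pickState st =
    pickAll m k (s.real 4) (s.real 1) (pickState s0)) ?_ ?_
  · rfl
  · exact (hset _ _).1
  · intro f hf st hfr h11 hst
    rw [(hset _ _).1, pickAll, List.range_succ, List.foldl_append, ← pickAll, ← hst]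
    refine run_forLoop_induction u (s := st) ?_ (by rw [hfr.int 2 rfl, f0.int 2 rfl, hk])
      (fun m st' => pickState st' = (List.range m).foldl
        (fun ρ j => pickStep (s.real 4) (s.real 1) ρ f j) (pickState st)) ?_ ?_
    · rfl
    · exact (hset _ _).2
    · intro j hj st' hfr' h12 hst'
      rw [(hset _ _).2, pickState_run_pickCell, List.range_succ, List.foldl_append, ← hst',
        h12, hfr'.int 11 rfl, h11, hfr'.real 1 rfl, hfr'.real 4 rfl, hfr.real 1 rfl,
        hfr.real 4 rfl, f0.real 1 rfl, f0.real 4 rfl]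
      rfl

/-! ### The program: growing the tree -/

/-- The test whether the center `a` lies on the right of the cut. -/
abbrev sideTest (a : ℕ) : Test := .realLt (.get 10 (.const 0) (.const 0)) (coordExp a 24)

/-- The center `a` lies on the right of the cut. -/
def MemSide (s : State) (a : ℕ) : Prop := s.real 10 0 0 < s.real 1 a (s.int 24 0 0)

/-- The leaf of the center `j` is to be split. -/
def MemSplits (s : State) (k j : ℕ) : Prop :=
  ∃ a < k, s.int 4 a 0 = s.int 4 j 0 ∧ ¬ (MemSide s a ↔ MemSide s j)

open Classical in
/-- The last number below a bound with a property, and `0` if there is no such number. -/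
def lastIdx (Q : ℕ → Prop) : ℕ → ℕ
  | 0 => 0
  | m + 1 => if Q m then m else lastIdx Q m

lemma lastIdx_spec {Q : ℕ → Prop} {m a : ℕ} (ha : a < m) (h : Q a) :
    lastIdx Q m < m ∧ Q (lastIdx Q m) := by
  induction m with
  | zero => omega
  | succ m ih =>
    rw [lastIdx]
    split_ifs with hm
    · exact ⟨by omega, hm⟩
    · have : a ≠ m := by rintro rfl; exact hm h
      obtain ⟨h1, h2⟩ := ih (by omega)
      exact ⟨by omega, h2⟩

/-- The number that stands for the set of the centers in the leaf of the center `j` on its side of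
the cut. -/
def memRep (s : State) (k j : ℕ) : ℕ :=
  lastIdx (fun a => s.int 4 a 0 = s.int 4 j 0 ∧ (MemSide s a ↔ MemSide s j)) k

lemma memRep_spec {k j : ℕ} (hj : j < k) : memRep s k j < k ∧
    s.int 4 (memRep s k j) 0 = s.int 4 j 0 ∧ (MemSide s (memRep s k j) ↔ MemSide s j) :=
  lastIdx_spec (Q := fun a => s.int 4 a 0 = s.int 4 j 0 ∧ (MemSide s a ↔ MemSide s j)) hj
    ⟨rfl, Iff.rfl⟩

lemma memRep_congr {k i j : ℕ} (h : s.int 4 i 0 = s.int 4 j 0) (h' : MemSide s i ↔ MemSide s j) :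
    memRep s k i = memRep s k j := by
  simp only [memRep, h, h']

/-- Compare the centers `12` and `13`. -/
def searchStep : BoundedProgram :=
  ite (eqTest (.get 4 (.var 13) (.const 0)) (.get 4 (.var 12) (.const 0)))
    (ite (.and (.not (.and (sideTest 13) (.not (sideTest 12))))
        (.not (.and (sideTest 12) (.not (sideTest 13)))))
      (setInt 25 (.const 0) (.const 0) (.var 13))
      (setInt 26 (.const 0) (.const 0) (.const 1))) skip

/-- Determine whether the leaf of the center `12` is to be split, and the representative of the
center. -/
def searchProg : BoundedProgram :=
  seq (seq (setInt 25 (.const 0) (.const 0) (.const 0))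
    (setInt 26 (.const 0) (.const 0) (.const 0)))
    (forLoop 2 13 searchStep)

lemma run_searchProg {k j : ℕ} (hk : s.int 2 0 0 = k) (hj : s.int 12 0 0 = j) :
    (searchProg.run u s).int 25 0 0 = memRep s k j ∧
      ((searchProg.run u s).int 26 0 0 = 1 ↔ MemSplits s k j) := by
  rw [searchProg, run]
  set init := seq (setInt 25 (.const 0) (.const 0) (.const 0))
    (setInt 26 (.const 0) (.const 0) (.const 0)) with hinit
  have f0 := frame_run u init s
  have h25 : (init.run u s).int 25 0 0 = 0 := by
    simp [hinit, run, State.int_setInt, State.int_setInt_ne, IExp.eval]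
  have h26 : (init.run u s).int 26 0 0 = 0 := by
    simp [hinit, run, State.int_setInt, IExp.eval]
  set s0 := init.run u s
  refine run_forLoop_induction u (s := s0) ?_ (by rw [f0.int 2 rfl, hk]) (fun m st =>
    st.int 25 0 0 = lastIdx (fun a => s.int 4 a 0 = s.int 4 j 0 ∧ (MemSide s a ↔ MemSide s j)) m ∧
      (st.int 26 0 0 = 1 ↔ ∃ a < m, s.int 4 a 0 = s.int 4 j 0 ∧
        ¬ (MemSide s a ↔ MemSide s j))) ?_ ?_
  · rfl
  · simp [State.int_setInt_ne, h25, h26, lastIdx]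
  · rintro a ha st hf h13 ⟨h1, h2⟩
    have hex (Q : ℕ → Prop) : (∃ i < a + 1, Q i) ↔ (∃ i < a, Q i) ∨ Q a := by
      constructor
      · rintro ⟨i, hi, h⟩
        rcases Nat.lt_succ_iff_lt_or_eq.1 hi with hi | rfl
        · exact Or.inl ⟨i, hi, h⟩
        · exact Or.inr h
      · rintro (⟨i, hi, h⟩ | h)
        · exact ⟨i, by omega, h⟩
        · exact ⟨a, by omega, h⟩
    rw [hex, ← h2, State.int_setInt_ne _ _ _ _ _ _ (by decide),
      State.int_setInt_ne _ _ _ _ _ _ (by decide), lastIdx, ← h1]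
    have hb : (eqTest (.get 4 (.var 13) (.const 0)) (.get 4 (.var 12) (.const 0))).Holds st ↔
        s.int 4 a 0 = s.int 4 j 0 := by
      simp only [holds_eqTest, IExp.eval, h13, hf.int 4 rfl, hf.int 12 rfl, f0.int 4 rfl,
        f0.int 12 rfl, hj]
    have hside : (Test.and (.not (.and (sideTest 13) (.not (sideTest 12))))
        (.not (.and (sideTest 12) (.not (sideTest 13))))).Holds st ↔
        (MemSide s a ↔ MemSide s j) := by
      simp only [Test.Holds, RExp.eval, IExp.eval, h13, hf.int 24 rfl, hf.int 12 rfl,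
        f0.int 24 rfl, f0.int 12 rfl, hf.real 10 rfl, hf.real 1 rfl, f0.real 10 rfl,
        f0.real 1 rfl, hj, MemSide]
      tauto
    rw [searchStep]
    by_cases hl : s.int 4 a 0 = s.int 4 j 0
    · rw [run_ite_pos u (hb.2 hl)]
      by_cases hs : MemSide s a ↔ MemSide s j
      · rw [run_ite_pos u (hside.2 hs)]
        simp [run, hl, hs, State.int_setInt, State.int_setInt_ne, IExp.eval, h13]
      · rw [run_ite_neg u (mt hside.1 hs)]
        simp [run, hl, hs, State.int_setInt, State.int_setInt_ne, IExp.eval]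
    · rw [run_ite_neg u (mt hb.1 hl)]
      simp [run, hl]

/-- Split the leaf of the center `12`, and assign the center to a child. -/
def splitLeaf : BoundedProgram :=
  seq (seq (setInt 6 (.var 12) (.const 0) (.add (.add (.var 5) (.const 1)) (.var 25))) (seq
    (setInt 3 (.get 4 (.var 12) (.const 0)) (.const 0) (.const 1)) (seq
    (setInt 3 (.get 4 (.var 12) (.const 0)) (.const 1) (.var 24))
    (setReal 2 (.get 4 (.var 12) (.const 0)) (.const 0) (.get 10 (.const 0) (.const 0))))))
  (ite (sideTest 12)
    (setInt 3 (.get 4 (.var 12) (.const 0)) (.const 3) (.get 6 (.var 12) (.const 0)))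
    (setInt 3 (.get 4 (.var 12) (.const 0)) (.const 2) (.get 6 (.var 12) (.const 0))))

lemma run_splitLeaf {j v : ℕ} (hj : s.int 12 0 0 = j) (hv : s.int 4 j 0 = v) :
    (∀ i, (splitLeaf.run u s).int 6 i 0 =
      if i = j then s.int 5 0 0 + 1 + s.int 25 0 0 else s.int 6 i 0) ∧
    (∀ v', v' ≠ v → (splitLeaf.run u s).int 3 v' = s.int 3 v' ∧
      (splitLeaf.run u s).real 2 v' 0 = s.real 2 v' 0) ∧
    (splitLeaf.run u s).int 3 v 0 = 1 ∧ (splitLeaf.run u s).int 3 v 1 = s.int 24 0 0 ∧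
    (splitLeaf.run u s).real 2 v 0 = s.real 10 0 0 ∧
    (splitLeaf.run u s).int 3 v 2 =
      (open Classical in if MemSide s j then s.int 3 v 2 else s.int 5 0 0 + 1 + s.int 25 0 0) ∧
    (splitLeaf.run u s).int 3 v 3 =
      (open Classical in if MemSide s j then s.int 5 0 0 + 1 + s.int 25 0 0 else s.int 3 v 3) := by
  subst hj hv
  rw [splitLeaf, run]
  set init := (seq (setInt 6 (.var 12) (.const 0) (.add (.add (.var 5) (.const 1)) (.var 25))) (seq
    (setInt 3 (.get 4 (.var 12) (.const 0)) (.const 0) (.const 1)) (seq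
    (setInt 3 (.get 4 (.var 12) (.const 0)) (.const 1) (.var 24))
    (setReal 2 (.get 4 (.var 12) (.const 0)) (.const 0) (.get 10 (.const 0) (.const 0)))))) with hi
  have f0 := frame_run u init s
  have h6 (i : ℕ) : (init.run u s).int 6 i 0 =
      if i = s.int 12 0 0 then s.int 5 0 0 + 1 + s.int 25 0 0 else s.int 6 i 0 := by
    simp [hi, run, State.int_setInt, State.int_setInt_ne, State.int_setReal, IExp.eval]
  have h3 (v' i : ℕ) : (init.run u s).int 3 v' i = if v' = s.int 4 (s.int 12 0 0) 0 ∧ i = 1 then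
      s.int 24 0 0 else if v' = s.int 4 (s.int 12 0 0) 0 ∧ i = 0 then 1 else s.int 3 v' i := by
    simp [hi, run, State.int_setInt, State.int_setInt_ne, State.int_setReal, IExp.eval]
  have h2 (v' : ℕ) : (init.run u s).real 2 v' 0 = if v' = s.int 4 (s.int 12 0 0) 0 then
      s.real 10 0 0 else s.real 2 v' 0 := by
    simp [hi, run, State.real_setInt, State.real_setReal, State.int_setInt_ne, IExp.eval,
      RExp.eval]
  set s0 := init.run u s
  have hb : (sideTest 12).Holds s0 ↔ MemSide s (s.int 12 0 0) := by
    simp only [Test.Holds, RExp.eval, IExp.eval, f0.int 12 rfl, f0.int 24 rfl, f0.real 10 rfl,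
      f0.real 1 rfl, MemSide]
  by_cases h : MemSide s (s.int 12 0 0)
  · rw [run_ite_pos u (hb.2 h)]
    simp only [run, IExp.eval, f0.int 12 rfl, f0.int 4 rfl, State.real_setInt, h2, h6, h, if_true]
    refine ⟨fun i => ?_, fun v' hv' => ⟨?_, ?_⟩, ?_, ?_, ?_, ?_, ?_⟩
    · rw [State.int_setInt_ne _ _ _ _ _ _ (by decide), h6]
    · funext i
      simp [State.int_setInt, h3, hv']
    all_goals simp_all [State.int_setInt]
  · rw [run_ite_neg u (mt hb.1 h)]
    simp only [run, IExp.eval, f0.int 12 rfl, f0.int 4 rfl, State.real_setInt, h2, h6, h, if_true,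
      if_false]
    refine ⟨fun i => ?_, fun v' hv' => ⟨?_, ?_⟩, ?_, ?_, ?_, ?_, ?_⟩
    · rw [State.int_setInt_ne _ _ _ _ _ _ (by decide), h6]
    · funext i
      simp [State.int_setInt, h3, hv']
    all_goals simp_all [State.int_setInt]

/-- Split the leaf of the center `12` if necessary. -/
def splitProg : BoundedProgram :=
  ite (eqTest (.var 26) (.const 1)) splitLeaf
    (setInt 6 (.var 12) (.const 0) (.get 4 (.var 12) (.const 0)))

/-- Grow the tree by the cut. -/
def growProg : BoundedProgram :=
  seq (forLoop 2 12 (seq searchProg splitProg)) (seq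
    (forLoop 2 12 (setInt 4 (.var 12) (.const 0) (.get 6 (.var 12) (.const 0))))
    (setInt 5 (.const 0) (.const 0) (.add (.var 5) (.var 2))))

open Classical in
/-- The relation between the memory before and after the leaves of the centers with a number less
than `m` have been dealt with. -/
structure Grown (k m : ℕ) (s s' : State) : Prop where
  loc : ∀ j < m, s'.int 6 j 0 =
    if MemSplits s k j then s.int 5 0 0 + 1 + memRep s k j else s.int 4 j 0
  row : ∀ j < m, MemSplits s k j → s'.int 3 (s.int 4 j 0) 0 = 1 ∧
    s'.int 3 (s.int 4 j 0) 1 = s.int 24 0 0 ∧ s'.real 2 (s.int 4 j 0) 0 = s.real 10 0 0 ∧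
    (¬ MemSide s j → s'.int 3 (s.int 4 j 0) 2 = s.int 5 0 0 + 1 + memRep s k j) ∧
    (MemSide s j → s'.int 3 (s.int 4 j 0) 3 = s.int 5 0 0 + 1 + memRep s k j)
  other : ∀ v, (∀ j < m, MemSplits s k j → s.int 4 j 0 ≠ v) →
    s'.int 3 v = s.int 3 v ∧ s'.real 2 v 0 = s.real 2 v 0

lemma grown_run {k : ℕ} (hk : s.int 2 0 0 = k) :
    Grown k k s ((forLoop 2 12 (seq searchProg splitProg)).run u s) := by
  refine run_forLoop_induction u (by rfl) hk (fun m st => Grown k m s st) ?_ ?_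
  · exact ⟨fun j h => by omega, fun j h => by omega, fun v _ =>
      ⟨by rw [State.int_setInt_ne _ _ _ _ _ _ (by decide)], rfl⟩⟩
  · intro j hj st hf h12 hst
    have hside : MemSide st = MemSide s := by
      funext a; simp only [MemSide, hf.int 24 rfl, hf.real 1 rfl, hf.real 10 rfl]
    have hsplits : MemSplits st = MemSplits s := by
      funext k a; simp only [MemSplits, hside, hf.int 4 rfl]
    have hrep : memRep st = memRep s := by
      funext k a; simp only [memRep, hside, hf.int 4 rfl]
    obtain ⟨h25, h26⟩ := run_searchProg u (s := st) (by rw [hf.int 2 rfl, hk]) h12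
    rw [hrep] at h25
    rw [hsplits] at h26
    have f1 := frame_run u searchProg st
    rw [run]
    set st1 := searchProg.run u st
    have hside1 : MemSide st1 = MemSide s := by
      rw [← hside]
      funext a; simp only [MemSide, f1.int 24 rfl, f1.real 1 rfl, f1.real 10 rfl]
    have e12 : st1.int 12 0 0 = j := by rw [f1.int 12 rfl, h12]
    have e3 : st1.int 3 = st.int 3 := f1.int 3 rfl
    have e4 : st1.int 4 = s.int 4 := by rw [f1.int 4 rfl, hf.int 4 rfl]
    have e5 : st1.int 5 = s.int 5 := by rw [f1.int 5 rfl, hf.int 5 rfl]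
    have e6 : st1.int 6 = st.int 6 := f1.int 6 rfl
    have e24 : st1.int 24 = s.int 24 := by rw [f1.int 24 rfl, hf.int 24 rfl]
    have e2 : st1.real 2 = st.real 2 := f1.real 2 rfl
    have e10 : st1.real 10 = s.real 10 := by rw [f1.real 10 rfl, hf.real 10 rfl]
    have hb : (eqTest (.var 26) (.const 1)).Holds st1 ↔ MemSplits s k j := by
      rw [← h26, holds_eqTest]; rfl
    rw [splitProg]
    by_cases h : MemSplits s k j
    · rw [run_ite_pos u (hb.2 h)]
      obtain ⟨r6, r3, r30, r31, r2, r32, r33⟩ := run_splitLeaf u (s := st1) e12 (by rw [e4])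
      rw [e24] at r31
      rw [e10] at r2
      simp only [e3, e5, e6, e2, h25, hside1] at r6 r3 r32 r33
      set st2 := splitLeaf.run u st1
      have e3' (v) : (st2.setInt 12 0 0 (j + 1)).int 3 v = st2.int 3 v := by
        rw [State.int_setInt_ne _ _ _ _ _ _ (by decide)]
      have e6' (v) : (st2.setInt 12 0 0 (j + 1)).int 6 v = st2.int 6 v := by
        rw [State.int_setInt_ne _ _ _ _ _ _ (by decide)]
      refine ⟨fun i hi => ?_, fun i hi hs => ?_, fun v hv => ?_⟩
      · rw [e6', r6]
        split_ifs with h1 h2 h2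
        · rw [h1]
        · exact absurd (h1 ▸ h) h2
        · rw [hst.loc i (by omega), if_pos h2]
        · rw [hst.loc i (by omega), if_neg h2]
      · simp only [e3', State.real_setInt]
        by_cases hl : s.int 4 i 0 = s.int 4 j 0
        · rw [hl]
          refine ⟨r30, r31, r2, fun hn => ?_, fun hp => ?_⟩
          · rw [r32]
            split_ifs with hjs <;> rw [hside1] at hjs
            · have hij : i < j := by
                rcases Nat.lt_succ_iff_lt_or_eq.1 hi with hi | rfl
                · exact hi
                · exact absurd hjs hn
              rw [← hl]
              exact (hst.row i hij hs).2.2.2.1 hn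
            · rw [memRep_congr hl (iff_of_false hn hjs)]
          · rw [r33]
            split_ifs with hjs <;> rw [hside1] at hjs
            · rw [memRep_congr hl (iff_of_true hp hjs)]
            · have hij : i < j := by
                rcases Nat.lt_succ_iff_lt_or_eq.1 hi with hi | rfl
                · exact hi
                · exact absurd hp hjs
              rw [← hl]
              exact (hst.row i hij hs).2.2.2.2 hp
        · have hij : i < j := by
            rcases Nat.lt_succ_iff_lt_or_eq.1 hi with hi | rfl
            · exact hi
            · exact absurd rfl hl
          rw [(r3 _ hl).1, (r3 _ hl).2]
          exact hst.row i hij hs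
      · rw [e3', State.real_setInt]
        have hne : v ≠ s.int 4 j 0 := (hv j (by omega) h).symm
        rw [(r3 v hne).1, (r3 v hne).2]
        exact hst.other v fun i hi => hv i (by omega)
    · rw [run_ite_neg u (mt hb.1 h)]
      simp only [run, IExp.eval, e12, e4]
      have e3' (v) : ((st1.setInt 6 j 0 (s.int 4 j 0)).setInt 12 0 0 (j + 1)).int 3 v =
          st.int 3 v := by
        rw [State.int_setInt_ne _ _ _ _ _ _ (by decide),
          State.int_setInt_ne _ _ _ _ _ _ (by decide), e3]
      have e2' : ((st1.setInt 6 j 0 (s.int 4 j 0)).setInt 12 0 0 (j + 1)).real 2 = st.real 2 := e2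
      refine ⟨fun i hi => ?_, fun i hi hs => ?_, fun v hv => ?_⟩
      · rw [State.int_setInt_ne _ _ _ _ _ _ (by decide), State.int_setInt, e6]
        by_cases hij : i = j
        · simp [hij, h]
        · rw [if_neg (by simpa using hij), hst.loc i (by omega)]
      · have hij : i < j := by
          rcases Nat.lt_succ_iff_lt_or_eq.1 hi with hi | rfl
          · exact hi
          · exact absurd hs h
        rw [e3', e2']
        exact hst.row i hij hs
      · rw [e3', e2']
        exact hst.other v fun i hi => hv i (by omega)

/-- The leaves of the centers and the tree after `growProg`. -/
lemma run_growProg {k : ℕ} (hk : s.int 2 0 0 = k) : ∃ s', Grown k k s s' ∧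
    (∀ j < k, (growProg.run u s).int 4 j 0 = s'.int 6 j 0) ∧
    (growProg.run u s).int 3 = s'.int 3 ∧ (growProg.run u s).real 2 = s'.real 2 ∧
    (growProg.run u s).int 5 0 0 = s.int 5 0 0 + k := by
  set p1 := forLoop 2 12 (seq searchProg splitProg) with hp1
  set p2 := forLoop 2 12 (setInt 4 (.var 12) (.const 0) (.get 6 (.var 12) (.const 0))) with hp2
  have f1 := frame_run u p1 s
  set s1 := p1.run u s with hs1
  have f2 := frame_run u p2 s1
  set s2 := p2.run u s1 with hs2
  have hrun : growProg.run u s = s2.setInt 5 0 0 (s2.int 5 0 0 + s2.int 2 0 0) := rfl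
  refine ⟨s1, grown_run u hk, ?_, ?_, ?_, ?_⟩
  · rw [hrun, State.int_setInt_ne _ _ _ _ _ _ (by decide)]
    have := run_forLoop_induction u
      (p := setInt 4 (.var 12) (.const 0) (.get 6 (.var 12) (.const 0))) (s := s1) (b := 2)
      (v := 12) (by rfl) (by rw [f1.int 2 rfl, hk])
      (fun m st => ∀ j < m, st.int 4 j 0 = s1.int 6 j 0) (fun j hj => by omega) (by
        intro j hj st hf h12 hst i hi
        simp only [run, IExp.eval, h12]
        rw [State.int_setInt_ne _ _ _ _ _ _ (by decide), State.int_setInt, hf.int 6 rfl]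
        by_cases hij : i = j
        · simp [hij]
        · rw [if_neg (by simpa using hij)]
          exact hst i (by omega))
    exact this
  · rw [hrun, State.int_setInt_ne _ _ _ _ _ _ (by decide), f2.int 3 rfl]
  · rw [hrun, State.real_setInt, f2.real 2 rfl]
  · rw [hrun, State.int_setInt, if_pos ⟨rfl, rfl⟩, f2.int 5 rfl, f2.int 2 rfl, f1.int 5 rfl,
      f1.int 2 rfl, hk]

end BoundedProgram
end ExplainableClustering

namespace ExplainableClustering

variable {d k n : ℕ}

/-! ### Trees in the memory -/

namespace State

/-- The memory holds the tree with the root `v`, and for each center in `S`, where `S` is the set of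
the centers that reach `v`, its leaf (in the array `4`). All leaves contain centers. -/
def Labeled (s : State) (c : Fin k → Fin d → ℝ) : Set (Fin k) → ℕ → ThresholdTree d → Prop
  | S, v, .leaf => s.int 3 v 0 = 0 ∧ S.Nonempty ∧ ∀ j ∈ S, s.int 4 j 0 = v
  | S, v, .node i θ l r => s.int 3 v 0 = 1 ∧ s.int 3 v 1 = i ∧ s.real 2 v 0 = θ ∧
      s.Labeled c {j ∈ S | c j i ≤ θ} (s.int 3 v 2) l ∧
      s.Labeled c {j ∈ S | θ < c j i} (s.int 3 v 3) r

variable {s s' : State} {c : Fin k → Fin d → ℝ}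

lemma Labeled.stores {S : Set (Fin k)} {v : ℕ} {T : ThresholdTree d} (h : s.Labeled c S v T) :
    s.Stores v T := by
  induction T generalizing S v with
  | leaf => exact .leaf h.1
  | node i θ l r ihl ihr =>
    obtain ⟨h1, h2, h3, h4, h5⟩ := h
    exact .node h1 h2 h3 (ihl h4) (ihr h5)

lemma Labeled.congr {S : Set (Fin k)} {v : ℕ} {T : ThresholdTree d} (h : s.Labeled c S v T)
    (h3 : s'.int 3 = s.int 3) (h4 : s'.int 4 = s.int 4) (h2 : s'.real 2 = s.real 2) :
    s'.Labeled c S v T := by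
  induction T generalizing S v with
  | leaf => simpa only [Labeled, h3, h4] using h
  | node i θ l r ihl ihr =>
    obtain ⟨h5, h6, h7, h8, h9⟩ := h
    simp only [Labeled, h3, h2]
    exact ⟨h5, h6, h7, ihl h8, ihr h9⟩

lemma Labeled.leaf_eq_zero {S : Set (Fin k)} {v : ℕ} {T : ThresholdTree d} (h : s.Labeled c S v T)
    {j : Fin k} (hj : j ∈ S) : s.int 3 (s.int 4 j 0) 0 = 0 := by
  induction T generalizing S v with
  | leaf => rw [h.2.2 j hj]; exact h.1
  | node i θ l r ihl ihr =>
    obtain ⟨-, -, -, hl, hr⟩ := h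
    by_cases hc : c j i ≤ θ
    · exact ihl hl ⟨hj, hc⟩
    · exact ihr hr ⟨hj, not_le.1 hc⟩

lemma Labeled.loc_eq {S : Set (Fin k)} {v : ℕ} {T : ThresholdTree d} (h : s.Labeled c S v T)
    {a b : Fin k} (ha : a ∈ S) (hb : b ∈ S) (hab : T.route (c a) = T.route (c b)) :
    s.int 4 a 0 = s.int 4 b 0 := by
  induction T generalizing S v with
  | leaf => rw [h.2.2 a ha, h.2.2 b hb]
  | node i θ l r ihl ihr =>
    obtain ⟨-, -, -, hl, hr⟩ := h
    simp only [ThresholdTree.route] at hab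
    split_ifs at hab with h1 h2 h2
    · exact ihl hl ⟨ha, h1⟩ ⟨hb, h2⟩ (List.cons.inj hab).2
    · simp at hab
    · simp at hab
    · exact ihr hr ⟨ha, not_le.1 h1⟩ ⟨hb, not_le.1 h2⟩ (List.cons.inj hab).2

open BoundedProgram in
/-- The effect of `growProg` on the tree in the memory. -/
lemma Labeled.grow {w : Cut d} {S : Set (Fin k)} {v : ℕ} {T : ThresholdTree d}
    (h : s.Labeled c S v T) (hS : ∀ a ∈ S, ∀ b : Fin k, s.int 4 a 0 = s.int 4 b 0 →
      b ∈ S ∧ T.route (c a) = T.route (c b))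
    (hzero : ∀ v > s.int 5 0 0, s.int 3 v 0 = 0) (hle : ∀ j : Fin k, s.int 4 j 0 ≤ s.int 5 0 0)
    (hleaf : ∀ j : Fin k, s.int 3 (s.int 4 j 0) 0 = 0)
    (hside : ∀ j : Fin k, MemSide s j ↔ w.2 < c j w.1) (hw1 : s.int 24 0 0 = w.1)
    (hw2 : s.real 10 0 0 = w.2) {s₁ : State} (hg : Grown k k s s₁)
    (h4 : ∀ j < k, s'.int 4 j 0 = s₁.int 6 j 0) (h3 : s'.int 3 = s₁.int 3)
    (h2 : s'.real 2 = s₁.real 2) :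
    s'.Labeled c S v (ExplainableClustering.grow w (c '' S) T) := by
  classical
  have hsplits (j : Fin k) : MemSplits s k j ↔
      ∃ a : Fin k, s.int 4 a 0 = s.int 4 j 0 ∧ ¬ (w.2 < c a w.1 ↔ w.2 < c j w.1) := by
    rw [MemSplits, ← hside]
    constructor
    · rintro ⟨a, ha, h5, h6⟩
      exact ⟨⟨a, ha⟩, h5, by rwa [← hside]⟩
    · rintro ⟨a, h5, h6⟩
      exact ⟨a, a.2, h5, by rwa [hside]⟩
  induction T generalizing S v with
  | leaf =>
    obtain ⟨hv, ⟨j₀, hj₀⟩, hloc⟩ := h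
    have hmem (j : Fin k) (hj : s.int 4 j 0 = v) : j ∈ S :=
      (hS j₀ hj₀ j (by rw [hj, hloc j₀ hj₀])).1
    rw [ExplainableClustering.grow]
    split_ifs with hc
    · obtain ⟨⟨_, ⟨a, ha, rfl⟩, ha'⟩, ⟨_, ⟨b, hb, rfl⟩, hb'⟩⟩ := hc
      have hsp (j : Fin k) (hj : j ∈ S) : MemSplits s k j := by
        rw [hsplits]
        by_cases hjw : w.2 < c j w.1
        · exact ⟨a, by rw [hloc a ha, hloc j hj], by simp [hjw, ha']⟩
        · exact ⟨b, by rw [hloc b hb, hloc j hj], by simp [hjw, hb']⟩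
      have hrow (j : Fin k) (hj : j ∈ S) := hg.row j j.2 (hsp j hj)
      have hnew (j : Fin k) (hj : j ∈ S) : s'.int 4 j 0 = s.int 5 0 0 + 1 + memRep s k j := by
        rw [h4 j j.2, hg.loc j j.2, if_pos (hsp j hj)]
      have hnz (m : ℕ) : s'.int 3 (s.int 5 0 0 + 1 + m) 0 = 0 := by
        rw [h3, (hg.other _ fun j hj _ => ?_).1, hzero _ (by omega)]
        have := hle ⟨j, hj⟩
        simp only at this
        omega
      have hrow₀ := hrow j₀ hj₀
      rw [hloc j₀ hj₀, ← h3, ← h2] at hrow₀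
      refine ⟨hrow₀.1, hrow₀.2.1.trans hw1, hrow₀.2.2.1.trans hw2, ⟨?_, ⟨a, ha, ha'⟩, ?_⟩,
        ⟨?_, ⟨b, hb, hb'⟩, ?_⟩⟩
      · have := (hrow a ha).2.2.2.1 (by rw [hside]; exact not_lt.2 ha')
        rw [hloc a ha, ← h3] at this
        rw [this, hnz]
      · rintro j ⟨hj, hjw⟩
        have := (hrow j hj).2.2.2.1 (by rw [hside]; exact not_lt.2 hjw)
        rw [hloc j hj, ← h3] at this
        rw [this, hnew j hj]
      · have := (hrow b hb).2.2.2.2 (by rw [hside]; exact hb')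
        rw [hloc b hb, ← h3] at this
        rw [this, hnz]
      · rintro j ⟨hj, hjw⟩
        have := (hrow j hj).2.2.2.2 (by rw [hside]; exact hjw)
        rw [hloc j hj, ← h3] at this
        rw [this, hnew j hj]
    · have hnsp (j : Fin k) (hj : s.int 4 j 0 = v) : ¬ MemSplits s k j := by
        rw [hsplits]
        rintro ⟨a, ha, hne⟩
        have ha' := hmem a (ha.trans hj)
        have hj' := hmem j hj
        refine hc ?_
        by_cases h1 : w.2 < c a w.1 <;> by_cases h2 : w.2 < c j w.1
        · exact absurd (iff_of_true h1 h2) hne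
        · exact ⟨⟨c j, ⟨j, hj', rfl⟩, not_lt.1 h2⟩, ⟨c a, ⟨a, ha', rfl⟩, h1⟩⟩
        · exact ⟨⟨c a, ⟨a, ha', rfl⟩, not_lt.1 h1⟩, ⟨c j, ⟨j, hj', rfl⟩, h2⟩⟩
        · exact absurd (iff_of_false h1 h2) hne
      refine ⟨?_, ⟨j₀, hj₀⟩, fun j hj => ?_⟩
      · rw [h3, (hg.other v fun j hj hs hjv => hnsp ⟨j, hj⟩ hjv hs).1, hv]
      · rw [h4 j j.2, hg.loc j j.2, if_neg (hnsp j (hloc j hj)), hloc j hj]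
  | node i θ l r ihl ihr =>
    obtain ⟨h5, h6, h7, h8, h9⟩ := h
    have hrow := hg.other v fun j hj _ hjv => by
      have := hleaf ⟨j, hj⟩
      simp only [hjv, h5] at this
      exact one_ne_zero this
    have hroute {a b : Fin k} (hab : (ThresholdTree.node i θ l r).route (c a) =
        (ThresholdTree.node i θ l r).route (c b)) :
        (c a i ≤ θ → c b i ≤ θ ∧ l.route (c a) = l.route (c b)) ∧
        (θ < c a i → θ < c b i ∧ r.route (c a) = r.route (c b)) := by
      simp only [ThresholdTree.route] at hab
      split_ifs at hab with h1 h2 h2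
      · exact ⟨fun _ => ⟨h2, (List.cons.inj hab).2⟩, fun h => absurd h1 (not_le.2 h)⟩
      · simp at hab
      · simp at hab
      · exact ⟨fun h => absurd h h1, fun _ => ⟨not_le.1 h2, (List.cons.inj hab).2⟩⟩
    have hl := ihl h8 (by
      rintro a ⟨ha, ha'⟩ b hab
      obtain ⟨hb, hr⟩ := hS a ha b hab
      exact ⟨⟨hb, ((hroute hr).1 ha').1⟩, ((hroute hr).1 ha').2⟩)
    have hr := ihr h9 (by
      rintro a ⟨ha, ha'⟩ b hab
      obtain ⟨hb, hr⟩ := hS a ha b hab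
      exact ⟨⟨hb, ((hroute hr).2 ha').1⟩, ((hroute hr).2 ha').2⟩)
    have e1 : c '' {j ∈ S | c j i ≤ θ} = {x ∈ c '' S | x i ≤ θ} := by
      ext x
      constructor
      · rintro ⟨j, ⟨hj, hj'⟩, rfl⟩; exact ⟨⟨j, hj, rfl⟩, hj'⟩
      · rintro ⟨⟨j, hj, rfl⟩, hj'⟩; exact ⟨j, ⟨hj, hj'⟩, rfl⟩
    have e2 : c '' {j ∈ S | θ < c j i} = {x ∈ c '' S | θ < x i} := by
      ext x
      constructor
      · rintro ⟨j, ⟨hj, hj'⟩, rfl⟩; exact ⟨⟨j, hj, rfl⟩, hj'⟩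
      · rintro ⟨⟨j, hj, rfl⟩, hj'⟩; exact ⟨j, ⟨hj, hj'⟩, rfl⟩
    rw [e1] at hl
    rw [e2] at hr
    rw [ExplainableClustering.grow]
    simp only [Labeled, h3, h2, hrow]
    exact ⟨h5, h6, h7, hl, hr⟩

end State

/-! ### The correctness of the program -/

lemma l1Dist_comm (x y : Fin d → ℝ) : l1Dist x y = l1Dist y x :=
  Finset.sum_congr rfl fun _ _ => abs_sub_comm _ _

namespace BoundedProgram

/-- The memory at the beginning of the step `t` of the algorithm, where `T` is the tree built so
far. The rows of unused nodes are zero, so that new nodes are leaves. -/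
structure Invariant (c : Fin k → Fin d → ℝ) (T : ThresholdTree d) (t : ℕ) (s : State) : Prop where
  dim : s.int 1 0 0 = d
  num : s.int 2 0 0 = k
  centers : s.real 1 = coordN c
  dist : ∀ i j : Fin k, s.real 3 i j = l1Dist (c i) (c j)
  used : s.used = t
  labeled : s.Labeled c Set.univ 0 T
  route : ∀ a b : Fin k, s.int 4 a 0 = s.int 4 b 0 → T.route (c a) = T.route (c b)
  zero : ∀ v > s.int 5 0 0, s.int 3 v 0 = 0
  le : ∀ j : Fin k, s.int 4 j 0 ≤ s.int 5 0 0

variable {c : Fin k → Fin d → ℝ} {T : ThresholdTree d} {t : ℕ} {s s' : State}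
  (u : ℕ → unitInterval)

lemma Invariant.loc_eq_iff (h : Invariant c T t s) (a b : Fin k) :
    s.int 4 a 0 = s.int 4 b 0 ↔ T.route (c a) = T.route (c b) :=
  ⟨h.route a b, fun hab => h.labeled.loc_eq (Set.mem_univ _) (Set.mem_univ _) hab⟩

lemma Invariant.coord (h : Invariant c T t s) (j : Fin k) (f : Fin d) :
    s.real 1 j f = c j f := by
  rw [h.centers]
  simp [coordN]

/-- The part of the invariant that all parts of a step but `growProg` keep. -/
lemma Invariant.congr (h : Invariant c T t s) {t' : ℕ} (h1 : s'.int 1 = s.int 1)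
    (h2 : s'.int 2 = s.int 2) (h3 : s'.int 3 = s.int 3) (h4 : s'.int 4 = s.int 4)
    (h5 : s'.int 5 = s.int 5) (r1 : s'.real 1 = s.real 1) (r2 : s'.real 2 = s.real 2)
    (r3 : s'.real 3 = s.real 3) (hu : s'.used = t') : Invariant c T t' s' where
  dim := by rw [h1, h.dim]
  num := by rw [h2, h.num]
  centers := by rw [r1, h.centers]
  dist := by rw [r3]; exact h.dist
  used := hu
  labeled := h.labeled.congr h3 h4 r2
  route := by rw [h4]; exact h.route
  zero := by rw [h3, h5]; exact h.zero
  le := by rw [h4, h5]; exact h.le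

lemma Invariant.maxDist_eq (h : Invariant c T t s) :
    (diamProg.run u s).real 5 0 0 = maxDist c T := by
  obtain ⟨h0, h1, h2⟩ := run_diamProg u h.num
  refine le_antisymm ?_ ?_
  · rcases h2 with h2 | ⟨i, j, ⟨hi, hj⟩, h3, h4⟩
    · rw [h2]; exact maxDist_nonneg c T
    · rw [h4, show s.real 3 i j = _ from h.dist ⟨i, hi⟩ ⟨j, hj⟩]
      exact le_csSup (Set.toFinite _).bddAbove
        ⟨(⟨i, hi⟩, ⟨j, hj⟩), (h.loc_eq_iff ⟨i, hi⟩ ⟨j, hj⟩).1 h3, rfl⟩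
  · refine Real.sSup_le ?_ h0
    rintro _ ⟨⟨i, j⟩, hij, rfl⟩
    beta_reduce
    rw [← h.dist]
    exact h1 i j ⟨i.2, j.2⟩ ((h.loc_eq_iff i j).2 hij)

lemma Invariant.memFar_iff (h : Invariant c T t s) (hD : s.real 5 0 0 = maxDist c T)
    (a b : Fin k) : MemFar s a b ↔ maxDist c T / (k : ℝ) ^ 3 < l1Dist (c a) (c b) := by
  have hk : (0 : ℝ) < (k : ℝ) ^ 3 := by
    have := a.pos
    positivity
  rw [MemFar, hD, h.num, h.dist, div_lt_iff₀ hk]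
  ring_nf

lemma Invariant.memCell_iff (h : Invariant c T t s) (hD : s.real 5 0 0 = maxDist c T)
    (f : Fin d) (j : Fin k) : MemCell s k f j ↔ IsCell c T f j := by
  have hsep (a b : Fin k) : MemSep s f j a b ↔ (a, b) ∈ unsepPairs c T ∧
      ¬ c j f < c a f ∧ c j f < c b f := by
    rw [MemSep, h.loc_eq_iff, h.coord, h.coord, h.coord]
    rfl
  rw [MemCell, IsCell, mem_setR_iff, and_assoc.symm]
  refine and_congr ⟨?_, ?_⟩ ?_
  · rintro ⟨⟨a, b, ⟨ha, hb⟩, h1, h2⟩, h3⟩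
    obtain ⟨h4, h5⟩ := (hsep ⟨a, ha⟩ ⟨b, hb⟩).1 h1
    refine ⟨⟨_, h4, fun h => h5.1 (h.2 h5.2)⟩, ?_⟩
    rintro ⟨a', b'⟩ hab hcut
    by_contra hc
    simp only [sepCuts, Set.mem_ofPred_eq] at hcut
    by_cases h6 : c j f < c a' f
    · refine h3 ⟨b', a', ⟨b'.2, a'.2⟩, (hsep b' a').2 ⟨Eq.symm hab, ?_, h6⟩, ?_⟩
      · tauto
      · rw [h.memFar_iff hD, l1Dist_comm]; exact hc
    · refine h3 ⟨a', b', ⟨a'.2, b'.2⟩, (hsep a' b').2 ⟨hab, h6, ?_⟩, ?_⟩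
      · tauto
      · rw [h.memFar_iff hD]; exact hc
  · rintro ⟨⟨⟨a', b'⟩, hab, hcut⟩, h3⟩
    have h3' (a b : Fin k) (hab : MemSep s f j a b) : MemFar s a b := by
      obtain ⟨h4, h5⟩ := (hsep a b).1 hab
      exact (h.memFar_iff hD a b).2 (h3 _ h4 fun h => h5.1 (h.2 h5.2))
    refine ⟨?_, ?_⟩
    · simp only [sepCuts, Set.mem_ofPred_eq] at hcut
      by_cases h6 : c j f < c a' f
      · have := (hsep b' a').2 ⟨Eq.symm hab, by tauto, h6⟩
        exact ⟨b', a', ⟨b'.2, a'.2⟩, this, h3' _ _ this⟩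
      · have := (hsep a' b').2 ⟨hab, h6, by tauto⟩
        exact ⟨a', b', ⟨a'.2, b'.2⟩, this, h3' _ _ this⟩
    · rintro ⟨a, b, ⟨ha, hb⟩, h1, h2⟩
      exact h2 (h3' ⟨a, ha⟩ ⟨b, hb⟩ h1)
  · rw [h.coord]
    constructor
    · intro h1 a ha hac
      exact h1 ⟨a, a.2, ha, by rw [h.coord]; exact hac⟩
    · rintro h1 ⟨a, ha, haj, hac⟩
      exact h1 ⟨a, ha⟩ haj (by rw [← h.coord]; exact hac)

lemma Invariant.run_cellProg_eq (h : Invariant c T t s) (hD : s.real 5 0 0 = maxDist c T)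
    (f : Fin d) (j : Fin k) (hf : s.int 11 0 0 = f) (hj : s.int 12 0 0 = j) :
    (cellProg.run u s).real 4 f j = cellLen c T f j := by
  obtain ⟨-, -, h1, h2⟩ := run_cellProg u h.num hf hj
  rw [h.memCell_iff hD] at h1 h2
  rw [cellLen]
  split_ifs with hc
  · obtain ⟨h3, h4⟩ := h1 hc
    rw [h.coord] at h3 h4
    set v := c j f + (cellProg.run u s).real 4 f j with hv
    obtain ⟨h5, ⟨l, h6⟩, h7⟩ := nextCoord_spec c (exists_lt_of_mem_setR hc.1).1
    have h8 := h3 l l.2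
    simp only [h.coord, h6] at h8
    obtain ⟨h9, h10⟩ := h8 h5
    have h11 : nextCoord c f j ≤ v := by
      rcases h4 with h4 | ⟨a, ha, h4⟩
      · exact absurd h4 h9.ne'
      · have := h7 ⟨a, ha⟩
        rw [← h.coord ⟨a, ha⟩, show s.real 1 (⟨a, ha⟩ : Fin k) f = v from h4] at this
        exact this h9
    linarith
  · exact h2 hc

/-- The choice of the cut. -/
def cutProg : BoundedProgram := seq diamProg (seq lenProg pickProg)

/-- The cut in the memory is the sampled one, computed from the random number `u t`. -/
lemma Invariant.run_cutProg (h : Invariant c T t s) (hd : 0 < d) :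
    Invariant c T (t + 1) (cutProg.run u s) ∧
      (cutProg.run u s).int 24 0 0 = (sample hd c T (u t)).1 ∧
      (cutProg.run u s).real 10 0 0 = (sample hd c T (u t)).2 := by
  have f1 := frame_run u diamProg s
  have hD := h.maxDist_eq u
  set s1 := diamProg.run u s with hs1
  have f2 := frame_run u lenProg s1
  have h1 : Invariant c T t s1 := h.congr (f1.int 1 rfl) (f1.int 2 rfl) (f1.int 3 rfl)
    (f1.int 4 rfl) (f1.int 5 rfl) (f1.real 1 rfl) (f1.real 2 rfl) (f1.real 3 rfl)
    ((f1.used rfl).trans h.used)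
  have hlen := run_lenProg u h1.dim h1.num (g := cellLenN c T) (by
    intro f hf j hj st fr h11 h12
    rw [cellLenN, dif_pos ⟨hf, hj⟩]
    have h2 : Invariant c T t st := h1.congr (fr.int 1 rfl) (fr.int 2 rfl) (fr.int 3 rfl)
      (fr.int 4 rfl) (fr.int 5 rfl) (fr.real 1 rfl) (fr.real 2 rfl) (fr.real 3 rfl)
      ((fr.used rfl).trans h1.used)
    exact h2.run_cellProg_eq u (by rw [fr.real 5 rfl, hD]) ⟨f, hf⟩ ⟨j, hj⟩ h11 h12)
  set s2 := lenProg.run u s1 with hs2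
  have h2 : Invariant c T t s2 := h1.congr (f2.int 1 rfl) (f2.int 2 rfl) (f2.int 3 rfl)
    (f2.int 4 rfl) (f2.int 5 rfl) (f2.real 1 rfl) (f2.real 2 rfl) (f2.real 3 rfl)
    ((f2.used rfl).trans h1.used)
  have f3 := frame_run u pickProg s2
  have hpick := pickState_run_pickProg u h2.dim h2.num
  have hrun : cutProg.run u s = pickProg.run u s2 := rfl
  rw [hrun]
  have hcongr (ρ) : pickAll d k (s2.real 4) (s2.real 1) ρ =
      pickAll d k (cellLenN c T) (coordN c) ρ := by
    rw [h2.centers, pickAll, pickAll]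
    refine List.foldl_ext _ _ _ fun ρ f hf => List.foldl_ext _ _ _ fun ρ j hj => ?_
    rw [pickStep, pickStep, hlen.1 f (List.mem_range.1 hf) j (List.mem_range.1 hj)]
  have hsum : s2.real 8 0 0 = ∑ f : Fin d, ∑ j : Fin k, cellLen c T f j := by
    rw [hlen.2, ← Fin.sum_univ_eq_sum_range
      (fun f => ∑ j ∈ Finset.range k, cellLenN c T f j)]
    refine Finset.sum_congr rfl fun f _ => ?_
    rw [← Fin.sum_univ_eq_sum_range]
    refine Finset.sum_congr rfl fun j _ => ?_
    rw [cellLenN, dif_pos ⟨f.2, j.2⟩]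
  rw [hcongr, hsum, h2.used] at hpick
  refine ⟨h2.congr (f3.int 1 rfl) (f3.int 2 rfl) (f3.int 3 rfl) (f3.int 4 rfl) (f3.int 5 rfl)
    (f3.real 1 rfl) (f3.real 2 rfl) (f3.real 3 rfl) (by rw [used_run_pickProg, h2.used]), ?_, ?_⟩
  · have h24 : (pickProg.run u s2).int 24 0 0 = _ := congrArg (fun ρ => ρ.2.2.1) hpick
    have hlt : (pickAll d k (cellLenN c T) (coordN c)
        (0, (u t : ℝ) * ∑ f : Fin d, ∑ j : Fin k, cellLen c T f j, 0, 0)).2.2.1 < d := by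
      rw [pickAll_eq]
      refine pickList_lt _ _ (fun q hq => ?_) hd
      simp only [cellList, List.mem_flatMap, List.mem_map, List.mem_range] at hq
      obtain ⟨f, hf, j, -, rfl⟩ := hq
      exact hf
    rw [h24, sample, toFeature]
    simp only [hlt, dif_pos]
  · exact congrArg (fun ρ => ρ.2.2.2) hpick

/-- A step of the algorithm. -/
def stepProg : BoundedProgram := seq cutProg growProg

lemma Invariant.run_stepProg (h : Invariant c T t s) (hd : 0 < d) :
    Invariant c (grow (sample hd c T (u t)) (Set.range c) T) (t + 1) (stepProg.run u s) := by
  obtain ⟨h1, hw1, hw2⟩ := h.run_cutProg u hd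
  set s1 := cutProg.run u s with hs1
  set w := sample hd c T (u t) with hw
  have hrun : stepProg.run u s = growProg.run u s1 := rfl
  rw [hrun]
  have f2 := frame_run u growProg s1
  obtain ⟨s2, hg, g4, g3, g2, g5⟩ := run_growProg u h1.num
  set s' := growProg.run u s1
  have hside (j : Fin k) : MemSide s1 j ↔ w.2 < c j w.1 := by
    rw [MemSide, hw1, hw2, h1.coord]
  have hloc (j : Fin k) : s'.int 4 j 0 = s2.int 6 j 0 := g4 j j.2
  have hloc_le (j : Fin k) := h1.le j
  refine ⟨by rw [f2.int 1 rfl, h1.dim], by rw [f2.int 2 rfl, h1.num],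
    by rw [f2.real 1 rfl, h1.centers],
    by rw [f2.real 3 rfl]; exact h1.dist, by rw [f2.used rfl, h1.used], ?_, ?_, ?_, ?_⟩
  · rw [← Set.image_univ]
    exact h1.labeled.grow (fun a _ b hab => ⟨Set.mem_univ _, h1.route a b hab⟩) h1.zero h1.le
      (fun j => h1.labeled.leaf_eq_zero (Set.mem_univ j)) hside hw1 hw2 hg g4 g3 g2
  · intro a b hab
    rw [hloc, hloc, hg.loc a a.2, hg.loc b b.2] at hab
    -- new leaves have numbers beyond the old ones, and representatives determine leaf and side
    have key : s1.int 4 a 0 = s1.int 4 b 0 ∧ (w.2 < c a w.1 ↔ w.2 < c b w.1) := by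
      rw [← hside, ← hside]
      split_ifs at hab with ha hb hb
      · have hr : memRep s1 k a = memRep s1 k b := by omega
        obtain ⟨-, h2, h3⟩ := memRep_spec (s := s1) a.2
        obtain ⟨-, h4, h5⟩ := memRep_spec (s := s1) b.2
        rw [hr] at h2 h3
        exact ⟨h2.symm.trans h4, h3.symm.trans h5⟩
      · have := hloc_le b; omega
      · have := hloc_le a; omega
      · exact ⟨hab, by_contra fun hc => hb ⟨a, a.2, hab, hc⟩⟩
    exact (route_grow_eq_iff _ _ _ _ _).2 ⟨h1.route a b key.1, fun _ _ => key.2⟩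
  · intro v hv
    rw [g5] at hv
    rw [g3, (hg.other v fun j hj _ => ?_).1, h1.zero v (by omega)]
    have := hloc_le ⟨j, hj⟩
    simp only at this
    omega
  · intro j
    rw [hloc, hg.loc j j.2, g5]
    have h2 := hloc_le j
    have h3 := (memRep_spec (s := s1) j.2).1
    split_ifs <;> omega

/-- The program for the algorithm. It always makes `k` steps; those after the end of the loop of the
algorithm do not change the tree. -/
def main : BoundedProgram := seq distProg (forLoop 2 10 stepProg)

lemma invariant_run_distProg (X : Fin n → Fin d → ℝ) (c : Fin k → Fin d → ℝ) (hk : 0 < k) :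
    Invariant c .leaf 0 (distProg.run u (State.init X c)) := by
  have f := frame_run u distProg (State.init X c)
  have h1 : (State.init X c).real 1 = coordN c := by
    funext j f
    simp only [State.init, coordN]
    rfl
  have h2 := run_distProg u (s := State.init X c) (k := k) rfl
  have hint (a : ℕ) (ha : 3 ≤ a) (i j : ℕ) : (State.init X c).int a i j = 0 := by
    simp only [State.init]
    split_ifs <;> omega
  refine ⟨by rw [f.int 1 rfl]; rfl, by rw [f.int 2 rfl]; rfl, by rw [f.real 1 rfl, h1], ?_,
    by rw [f.used rfl]; rfl, ⟨?_, ⟨⟨0, hk⟩, trivial⟩, ?_⟩, fun _ _ _ => rfl, ?_, ?_⟩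
  · intro i j
    rw [h2 i j ⟨i.2, j.2⟩, memDist, h1, l1Dist]
    rw [show (State.init X c).int 1 0 0 = d from rfl,
      ← Fin.sum_univ_eq_sum_range (fun f => |coordN c i f - coordN c j f|)]
    exact Finset.sum_congr rfl fun f _ => by simp [coordN]
  · rw [f.int 3 rfl, hint 3 le_rfl]
  · intro j _
    rw [f.int 4 rfl, hint 4 (by decide)]
  · intro v _
    rw [f.int 3 rfl, hint 3 le_rfl]
  · intro j
    rw [f.int 4 rfl, hint 4 (by decide)]
    exact Nat.zero_le _

lemma stores_run_main (hd : 0 < d) (hk : 0 < k) (X : Fin n → Fin d → ℝ) (c : Fin k → Fin d → ℝ) :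
    (main.run u (State.init X c)).Stores 0 (runTree hd c u k) := by
  have h0 := invariant_run_distProg u X c hk
  rw [main, run]
  set s0 := distProg.run u (State.init X c) with hs0
  have hset {T : ThresholdTree d} {t v : ℕ} {s : State} (h : Invariant c T t s) :
      Invariant c T t (s.setInt 10 0 0 v) := by
    refine h.congr ?_ ?_ ?_ ?_ ?_ rfl rfl rfl h.used <;>
      exact State.int_setInt_ne _ _ _ _ _ _ (by decide)
  have := run_forLoop_induction u (p := stepProg) (s := s0) (b := 2) (v := 10) (by rfl) h0.num
    (fun t st => Invariant c (runTree hd c u t) t st) (hset h0)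
    (fun t _ st _ _ hst => hset (hst.run_stepProg u hd))
  exact this.labeled.stores

/-- The program halts within a polynomial number of steps. -/
lemma exec_main (hd : 0 < d) (hk : 0 < k) (X : Fin n → Fin d → ℝ) (c : Fin k → Fin d → ℝ) :
    ∃ (m : ℕ) (s : State), Exec u main.compile (State.init X c) m s ∧
      m ≤ main.steps.eval (d + k) ∧ s.Stores 0 (runTree hd c u k) := by
  obtain ⟨m, hm, he⟩ := exec_compile u (p := main) (s := State.init X c) (N := d + k) (by rfl)
    (Nat.le_add_right d k) (Nat.le_add_left k d) ⟨rfl, rfl⟩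
  exact ⟨m, _, he, hm, stores_run_main u hd hk X c⟩

end BoundedProgram
end ExplainableClustering

end

theorem theorem1 :
    ∃ (K : ℝ) (p : Polynomial ℕ) (M : Program), 0 < K ∧
      ∀ (n d k : ℕ) (X : Fin n → Fin d → ℝ) (c : Fin k → Fin d → ℝ),
        0 < d → 0 < k → Function.Injective c →
        -- the random-cut algorithm, on any probability space
        (∀ (Ω : Type*) [MeasurableSpace Ω] (P : Measure Ω) [IsProbabilityMeasure P]
            (ω : ℕ → Ω → Cut d), IsRun c P ω →
          (∀ᵐ a ∂P,
            (∃ t ≤ k - 1, Separated c (treeAt c (fun s => ω s a) t)) ∧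
            (output c fun s => ω s a).leaves.card = k ∧
            ∀ v ∈ (output c fun s => ω s a).leaves,
              ∃! j, (output c fun s => ω s a).route (c j) = v) ∧
          Integrable (fun a => (output c fun s => ω s a).cost X) P ∧
          ∫ a, (output c fun s => ω s a).cost X ∂P ≤ K * approxFactor k * centerCost X c) ∧
        -- the program `M` carries it out in polynomial time
        ∃ T : (ℕ → unitInterval) → ThresholdTree d,
          (∀ u, ∃ (m : ℕ) (s : State), Exec u M (State.init X c) m s ∧
            m ≤ p.eval (d + k) ∧ s.Stores 0 (T u)) ∧
          (∃ ω : ℕ → (ℕ → unitInterval) → Cut d, IsRun c uniformSource ω ∧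
            ∀ᵐ u ∂uniformSource, T u = output c fun s => ω s u) ∧
          Integrable (fun u => (T u).cost X) uniformSource ∧
          ∫ u, (T u).cost X ∂uniformSource ≤ K * approxFactor k * centerCost X c := by
  obtain ⟨K, hK, hfac⟩ := exists_factor_le
  refine ⟨K, BoundedProgram.main.steps, BoundedProgram.main.compile, hK, ?_⟩
  intro n d k X c hd hk hc
  obtain ⟨M₀, M, hM₀, hM, hle⟩ := hfac k hk
  have hcost : (3 + 4 * M * (1 + 2 * Real.log k)) * centerCost X c ≤
      K * approxFactor k * centerCost X c :=
    mul_le_mul_of_nonneg_right hle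
      (Finset.sum_nonneg fun a _ => Real.iInf_nonneg fun j => l1Dist_nonneg _ _)
  refine ⟨?_, ?_⟩
  · intro Ω _ P _ ω hω
    obtain ⟨h1, h2⟩ := hω.cost_bound hk hc X hM₀ hM
    refine ⟨?_, h1, h2.trans hcost⟩
    filter_upwards [hω.ae_separated hk, hω.ae_output_eq hk le_rfl] with a ha ha'
    rw [ha'.2]
    exact ⟨ha, ha'.1.card_leaves hc hk, ha'.1.existsUnique_route hc hk⟩
  · have hrun := isRun_runCut hd c
    have : IsProbabilityMeasure uniformSource := by unfold uniformSource; infer_instance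
    have heq : ∀ᵐ u ∂uniformSource,
        runTree hd c u k = output c fun s => runCut hd c s u := by
      filter_upwards [hrun.ae_output_eq hk (Nat.sub_le k 1)] with u hu
      rw [hu.2, treeAt_runCut]
    obtain ⟨h1, h2⟩ := hrun.cost_bound hk hc X hM₀ hM
    have hae : (fun u => (output c fun s => runCut hd c s u).cost X) =ᵐ[uniformSource]
        fun u => (runTree hd c u k).cost X := by
      filter_upwards [heq] with u hu
      rw [hu]
    refine ⟨fun u => runTree hd c u k, fun u => BoundedProgram.exec_main u hd hk X c,
      ⟨_, hrun, heq⟩, h1.congr hae, ?_⟩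
    rw [← integral_congr_ae hae]
    exact h2.trans hcost
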